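/- **Definitions.** A *precubical set* is a graded set $P=(P_n)_{n\ge 0}$ with face operators $d^k_i\colon P_n\to P_{n-1}$ ($k\in\{0,1\}$, $1\le i\le n$) such that $d^k_i d^l_j=d^l_{j-1}d^k_i$ for $i<j$; $|P|$ denotes its geometric realization and $[\![0,k]\!]$ is the precubical interval with $k$ edges. For $x\in P_n$ let $x_\sharp\colon[\![0,1]\!]^{\otimes n}\to P$ be the morphism that sends the top cube to $x$. The cube $x$ is *regular* if $x_\sharp$ is injective, and *weakly regular* if $x_\sharp$ is injective on the cubes having no coordinate equal to the vertex $1$ and on the cubes having no coordinate equal to the vertex $0$; $P$ is weakly regular if all its cubes are. The *star* of $x$ is $\mathrm{star}(x)=\{y\in P: x\in \mathrm{im}\,y_\sharp\}$; a face $d^k_ix$ is *free* if $\mathrm{star}(d^k_ix)=\{x,d^k_ix\}$. For $x\in P_n$, $n\geq 2$, $e^k_ix=d_1^{1-k}\cdots d_{i-1}^{1-k}d_{i+1}^{1-k}\cdots d_n^{1-k}x\in P_1$. Let $M$ be a monoid. An *$M$-HDA* is a tuple $\mathcal A=(P,I,F,\lambda)$ with $P$ a precubical set, $I,F\subseteq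 P_0$ and $\lambda\colon P_1\to M$ such that $\lambda(d^0_iz)=\lambda(d^1_iz)$ for all $z\in P_2$, $i\in\{1,2\}$; it is weakly regular if $P$ is. A *path* of length $k$ in $P$ is a morphism $\omega\colon [\![0,k]\!]\to P$; write $v\to_P w$ if there is a path from $v$ to $w$, and let $\overline\lambda(\omega)$ be the product of the labels of the edges of $\omega$. $\mathcal A$ is *accessible* (*coaccessible*) if for every $v\in P_0$ there is $a\in I$ with $a\to_P v$ ($b\in F$ with $v\to_P b$). *Dihomotopy* of paths is the equivalence relation generated by $\alpha\cdot (d^0_1z)_\sharp\cdot (d^1_2z)_\sharp\cdot\beta\sim\alpha\cdot (d^0_2z)_\sharp\cdot (d^1_1z)_\sharp\cdot\beta$ for $z\in P_2$; the fundamental category $\vec\pi_1(P)$ has the vertices as objects and the dihomotopy classes of paths as morphisms. Let $m_k(P)$ be the set of vertices $v$ such that $d^k_1e\neq v$ for all $e\in P_1$. The *trace category* $TC(\mathcal A)$ is the full subcategory of $\vec\pi_1(P)$ on $I\cup F\cup m_0(P)\cup m_1(P)$. Fix a commutative unital coefficient ring for singular homology. A homology class $\alpha$ of $|P|$ *points to*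 a homology class $\beta$ (possibly of a different degree) if there are precubical subsets $X,Y\subseteq P$ such that $\alpha$ and $\beta$ come from $H_*(|X|)$ and $H_*(|Y|)$, respectively, and $a\to_P b$ for all $a\in X_0$, $b\in Y_0$. The homology classes of $|P|$ with this relation form the *homology graph* of $P$. A *weak morphism* from a precubical set $Q$ to a precubical set $P$ is a continuous map $f\colon|Q|\to|P|$ such that (i) for each $v\in Q_0$ there is a (necessarily unique) $f_0(v)\in P_0$ with $f([v,()])=[f_0(v),()]$, and (ii) for all $n,k_1,\dots,k_n\ge1$ and every morphism $\xi\colon[\![0,k_1]\!]\otimes\cdots\otimes[\![0,k_n]\!]\to Q$ there are $l_1,\dots,l_n\ge 1$, a morphism $\chi\colon[\![0,l_1]\!]\otimes\cdots\otimes[\![0,l_n]\!]\to P$ and a homeomorphism $\phi\colon\prod_j[0,k_j]\to\prod_j[0,l_j]$ with $f\circ|\xi|=|\chi|\circ\phi$ such that $\phi$ and $\phi^{-1}$ preserve the product order. For a path $\omega$ of length $k$ in $Q$, $f^{\mathbb I}(\omega)$ is the unique path $\nu$ in $P$, of length $l$ say, with $f\circ|\omega|=|\nu|\circ\phi$ for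 some increasing homeomorphism $\phi\colon[0,k]\to[0,l]$. A weak morphism from an $M$-HDA $\mathcal B=(Q,J,G,\mu)$ to $\mathcal A$ is a weak morphism $f$ from $Q$ to $P$ with $f_0(J)\subseteq I$, $f_0(G)\subseteq F$ and $\overline\lambda\circ f^{\mathbb I}=\overline\mu$. $\mathcal B$ is a *topological abstraction* of $\mathcal A$, written $\mathcal B\stackrel{\sim}{\to}\mathcal A$, if there is a weak morphism $f$ from $\mathcal B$ to $\mathcal A$ such that (1) $f_0(J)=I$, $f_0(G)=F$, $f_0(m_0(Q))=m_0(P)$ and $f_0(m_1(Q))=m_1(P)$; (2) $f$ is a homotopy equivalence; (3) the functor $f_*\colon TC(\mathcal B)\to TC(\mathcal A)$, $v\mapsto f_0(v)$, $[\omega]\mapsto[f^{\mathbb I}(\omega)]$, is an isomorphism; (4) $f_*\colon H_*(|Q|)\to H_*(|P|)$ is an isomorphism of homology graphs. **Theorem.** Let $\mathcal A=(P,I,F,\lambda)$ be a weakly regular $M$-HDA, and let $x$ be a regular element of $P$ of degree $n\ge2$ with a free face $d^k_ix$. Put $v=d_1^{1-k}\cdots d_1^{1-k}d^k_ix\in P_0$.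 Suppose that there is no $y\in P_1\setminus\{e^k_ix\}$ with $d^k_1y=v$. If $n\le3$, suppose furthermore that $v\notin I\cup F$. If $n=2$, suppose finally that there is an edge $y\in P_1\setminus\{d^k_ix\}$ with $d^{1-k}_1y=v$. Let $Q=P\setminus\mathrm{star}(d^k_ix)$ and $\mathcal B=(Q,I,F,\lambda|_{Q_1})$. Then $\mathcal B\stackrel{\sim}{\to}\mathcal A$. Moreover, $\mathcal A$ is accessible if and only if $\mathcal B$ is accessible, and $\mathcal A$ is coaccessible if and only if $\mathcal B$ is coaccessible. -/

import Mathlib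

open CategoryTheory

universe u v w w'

/-! ### Precubical sets -/

/-- A precubical set. The index `false` stands for `k = 0` (front faces) and `true` for `k = 1`
(back faces); directions are numbered from `0`, so `face k i` is the operator `d^k_{i+1}`. -/
structure PrecubicalSet : Type (u + 1) where
  cube : ℕ → Type u
  face : ∀ {n : ℕ}, Bool → Fin (n + 1) → cube (n + 1) → cube n
  face_face : ∀ {n : ℕ} (k l : Bool) (i j : Fin (n + 1)), i ≤ j → ∀ x : cube (n + 2),
    face k i (face l j.succ x) = face l j (face k i.castSucc x)

namespace PrecubicalSet

/-- The set of all cubes, of all degrees. -/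
abbrev Cubes (P : PrecubicalSet.{u}) : Type u := Σ n, P.cube n

/-- Morphisms of precubical sets. -/
@[ext]
structure Hom (P : PrecubicalSet.{u}) (Q : PrecubicalSet.{v}) where
  map : ∀ {n : ℕ}, P.cube n → Q.cube n
  map_face : ∀ {n : ℕ} (k : Bool) (i : Fin (n + 1)) (x : P.cube (n + 1)),
    map (P.face k i x) = Q.face k i (map x)

/-- Composition of morphisms of precubical sets. -/
def Hom.comp {P : PrecubicalSet.{u}} {Q : PrecubicalSet.{v}} {R : PrecubicalSet.{w}}
    (g : Hom Q R) (f : Hom P Q) : Hom P R where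
  map x := g.map (f.map x)
  map_face k i x := by rw [f.map_face, g.map_face]

/-! ### Precubical subsets -/

/-- Precubical subsets. -/
structure Sub (P : PrecubicalSet.{u}) where
  carrier : ∀ n, Set (P.cube n)
  face_mem : ∀ {n : ℕ} (k : Bool) (i : Fin (n + 1)) (x : P.cube (n + 1)),
    x ∈ carrier (n + 1) → P.face k i x ∈ carrier n

/-- A precubical subset as a precubical set. -/
def Sub.toPrecubicalSet {P : PrecubicalSet.{u}} (X : P.Sub) : PrecubicalSet.{u} where
  cube n := X.carrier n
  face k i x := ⟨P.face k i x.1, X.face_mem k i x.1 x.2⟩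
  face_face k l i j h x := Subtype.ext (P.face_face k l i j h x.1)

/-- The inclusion of a precubical subset. -/
def Sub.incl {P : PrecubicalSet.{u}} (X : P.Sub) : Hom X.toPrecubicalSet P where
  map x := x.1
  map_face _ _ _ := rfl

/-! ### Boxes: tensor products of precubical intervals -/

/-- An `m`-cube of `⟦0,k₁⟧ ⊗ ⋯ ⊗ ⟦0,kₙ⟧`: its coordinates in the `m` directions
`dir 0 < ⋯ < dir (m-1)` are the edges `[base j, base j + 1]`, its other coordinates are the
vertices `base j`. -/
@[ext]
structure BoxCell {n : ℕ} (k : Fin n → ℕ) (m : ℕ) : Type where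
  dir : Fin m ↪o Fin n
  base : Fin n → ℕ
  base_le : ∀ j, base j ≤ k j
  base_dir_lt : ∀ a, base (dir a) < k (dir a)

/-- `d^b_{i+1}` replaces the `i`-th edge coordinate by its initial or final vertex. -/
def BoxCell.face {n : ℕ} {k : Fin n → ℕ} {m : ℕ} (b : Bool) (i : Fin (m + 1))
    (c : BoxCell k (m + 1)) : BoxCell k m where
  dir := (Fin.succAboveOrderEmb i).trans c.dir
  base := Function.update c.base (c.dir i) (c.base (c.dir i) + b.toNat)
  base_le j := by
    by_cases h : j = c.dir i
    · subst h
      have := c.base_dir_lt i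
      have := b.toNat_le
      simp only [Function.update_self]
      omega
    · simpa [Function.update_of_ne h] using c.base_le j
  base_dir_lt a := by
    have h : c.dir (i.succAbove a) ≠ c.dir i := fun h =>
      Fin.succAbove_ne i a (c.dir.injective h)
    simpa [Function.update_of_ne h] using c.base_dir_lt (i.succAbove a)

/-- The precubical set `⟦0,k₁⟧ ⊗ ⋯ ⊗ ⟦0,kₙ⟧`. -/
def box {n : ℕ} (k : Fin n → ℕ) : PrecubicalSet.{0} where
  cube m := BoxCell k m
  face b i c := c.face b i
  face_face b l i j h c := by
    have h1 : j.succ.succAbove i = i.castSucc :=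
      Fin.succAbove_of_castSucc_lt _ _ (by simpa [Fin.lt_def, Nat.lt_succ_iff] using h)
    have h2 : i.castSucc.succAbove j = j.succ :=
      Fin.succAbove_of_le_castSucc _ _ (by simpa using h)
    have hne : c.dir i.castSucc ≠ c.dir j.succ := fun e => by
      have := c.dir.injective e
      rw [Fin.ext_iff] at this
      have := Fin.le_def.1 h
      simp at *
      omega
    ext a
    · simp only [BoxCell.face, RelEmbedding.coe_trans, Function.comp_apply,
        Fin.succAboveOrderEmb_apply]
      congr 2
      simp only [Fin.succAbove, Fin.lt_def, Fin.le_def] at *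
      split_ifs <;> simp_all <;> omega
    · simp only [BoxCell.face, RelEmbedding.coe_trans, Function.comp_apply,
        Fin.succAboveOrderEmb_apply, h1, h2]
      rw [Function.update_of_ne hne, Function.update_of_ne hne.symm,
        Function.update_comm hne.symm]

/-- The precubical `n`-cube `⟦0,1⟧^{⊗ n}`. -/
abbrev stdCube (n : ℕ) : PrecubicalSet.{0} := box (fun _ : Fin n => 1)

/-- The unique `n`-cube `ι_n` of `⟦0,1⟧^{⊗ n}`. -/
def stdCube.top (n : ℕ) : (stdCube n).cube n where
  dir := RelEmbedding.refl _
  base _ := 0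
  base_le _ := Nat.zero_le _
  base_dir_lt _ := Nat.zero_lt_one

/-! ### The morphism `x_♯` -/

/-- The cubes of `P` of degree `n + 1` as a precubical set in degree `n`, obtained by forgetting
the faces in the last direction (auxiliary, for the construction of `x_♯`). -/
abbrev dec (P : PrecubicalSet.{u}) : PrecubicalSet.{u} where
  cube n := P.cube (n + 1)
  face k i x := P.face k i.castSucc x
  face_face k l i j h x := P.face_face k l i.castSucc j.castSucc (by simpa using h) x

/-- The face in the last direction is a morphism. -/
def decFace (P : PrecubicalSet.{u}) (l : Bool) : Hom P.dec P where
  map {n} x := P.face l (Fin.last n) x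
  map_face {n} k i x := by
    exact (P.face_face k l i (Fin.last n) (Fin.le_last i) x).symm

/-- Restriction of an increasing map with `θ m = last` to the first `m` elements. -/
def restrictEmb {m n : ℕ} (θ : Fin (m + 1) ↪o Fin (n + 1)) : Fin m ↪o Fin n :=
  OrderEmbedding.ofStrictMono
    (fun a => (θ a.castSucc).castPred
      (Fin.ne_last_of_lt (θ.strictMono (Fin.castSucc_lt_succ (i := a)))))
    (fun _ _ h => θ.strictMono (Fin.castSucc_lt_castSucc_iff.2 h))

/-- Corestriction of an increasing map that does not take the value `last`. -/
def lowerEmb {m n : ℕ} (θ : Fin m ↪o Fin (n + 1)) (h : ∀ a, θ a ≠ Fin.last n) :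
    Fin m ↪o Fin n :=
  OrderEmbedding.ofStrictMono (fun a => (θ a).castPred (h a))
    (fun _ _ hab => θ.strictMono hab)

theorem restrictEmb_castSucc {m n : ℕ} (θ : Fin (m + 1) ↪o Fin (n + 1)) (a : Fin m) :
    (restrictEmb θ a).castSucc = θ a.castSucc := rfl

theorem lowerEmb_castSucc {m n : ℕ} (θ : Fin m ↪o Fin (n + 1)) (h : ∀ a, θ a ≠ Fin.last n)
    (a : Fin m) : (lowerEmb θ h a).castSucc = θ a := rfl

theorem ne_last_of_last_ne {m n : ℕ} {θ : Fin (m + 1) ↪o Fin (n + 1)}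
    (h : θ (Fin.last m) ≠ Fin.last n) (a : Fin (m + 1)) : θ a ≠ Fin.last n := fun ha =>
  h (le_antisymm (Fin.le_last _) (ha ▸ θ.monotone (Fin.le_last a)))

/-- The iterated face of `x` that keeps the directions in the image of `θ` and takes the face of
type `ε j` in every other direction `j`. -/
def along : ∀ {n : ℕ} (P : PrecubicalSet.{u}) {m : ℕ}, (Fin m ↪o Fin n) → (Fin n → Bool) →
    P.cube n → P.cube m
  | 0, _, 0, _, _, x => x
  | 0, _, _ + 1, θ, _, _ => (θ 0).elim0
  | n + 1, P, 0, θ, ε, x =>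
      along P (lowerEmb θ (fun a => a.elim0)) (fun j => ε j.castSucc)
        (P.face (ε (Fin.last n)) (Fin.last n) x)
  | n + 1, P, m + 1, θ, ε, x =>
      if h : θ (Fin.last m) = Fin.last n then
        along P.dec (restrictEmb θ) (fun j => ε j.castSucc) x
      else
        along P (lowerEmb θ (ne_last_of_last_ne h)) (fun j => ε j.castSucc)
          (P.face (ε (Fin.last n)) (Fin.last n) x)

theorem along_lower {n : ℕ} (P : PrecubicalSet.{u}) {m : ℕ} (θ : Fin m ↪o Fin (n + 1))
    (ε : Fin (n + 1) → Bool) (x : P.cube (n + 1)) (h : ∀ a, θ a ≠ Fin.last n) :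
    P.along θ ε x = P.along (lowerEmb θ h) (fun j => ε j.castSucc)
        (P.face (ε (Fin.last n)) (Fin.last n) x) := by
  cases m with
  | zero => rfl
  | succ m => rw [along, dif_neg (h _)]

theorem along_restrict {n : ℕ} (P : PrecubicalSet.{u}) {m : ℕ} (θ : Fin (m + 1) ↪o Fin (n + 1))
    (ε : Fin (n + 1) → Bool) (x : P.cube (n + 1)) (h : θ (Fin.last m) = Fin.last n) :
    P.along θ ε x = P.dec.along (restrictEmb θ) (fun j => ε j.castSucc) x := by
  rw [along, dif_pos h]

theorem along_refl : ∀ {n : ℕ} (P : PrecubicalSet.{u}) (ε : Fin n → Bool) (x : P.cube n),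
    P.along (RelEmbedding.refl _) ε x = x
  | 0, _, _, _ => rfl
  | n + 1, P, ε, x => by
    rw [along_restrict P _ ε x rfl]
    have : restrictEmb (RelEmbedding.refl (α := Fin (n + 1)) (· ≤ ·)) = RelEmbedding.refl _ := by
      ext a; rfl
    rw [this]
    exact along_refl P.dec _ x

/-- A morphism, seen after forgetting the last direction. -/
def Hom.dec {P : PrecubicalSet.{u}} {Q : PrecubicalSet.{v}} (g : Hom P Q) :
    Hom P.dec Q.dec where
  map x := g.map x
  map_face k i x := g.map_face k i.castSucc x

theorem Hom.map_along : ∀ {n : ℕ} {P : PrecubicalSet.{u}} {Q : PrecubicalSet.{v}} (g : Hom P Q)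
    {m : ℕ} (θ : Fin m ↪o Fin n) (ε : Fin n → Bool) (x : P.cube n),
    g.map (P.along θ ε x) = Q.along θ ε (g.map x)
  | 0, _, _, _, 0, _, _, _ => rfl
  | 0, _, _, _, _ + 1, θ, _, _ => (θ 0).elim0
  | n + 1, P, Q, g, 0, θ, ε, x => by
    rw [along, along, map_along g, g.map_face]
  | n + 1, P, Q, g, m + 1, θ, ε, x => by
    by_cases h : θ (Fin.last m) = Fin.last n
    · rw [along_restrict P θ ε x h, along_restrict Q θ ε _ h]
      exact map_along g.dec _ _ _
    · rw [along_lower P θ ε x (ne_last_of_last_ne h), along_lower Q θ ε _ (ne_last_of_last_ne h),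
        map_along g, g.map_face]

theorem along_congr {n : ℕ} (P : PrecubicalSet.{u}) {m : ℕ} {θ θ' : Fin m ↪o Fin n}
    {ε ε' : Fin n → Bool} {x x' : P.cube n} (h : ∀ a, θ a = θ' a) (h' : ∀ j, ε j = ε' j)
    (hx : x = x') : P.along θ ε x = P.along θ' ε' x' := by
  obtain rfl : θ = θ' := by ext a; rw [h]
  obtain rfl : ε = ε' := funext h'
  rw [hx]

theorem face_along : ∀ {n : ℕ} (P : PrecubicalSet.{u}) {m : ℕ} (θ : Fin (m + 1) ↪o Fin n)
    (ε : Fin n → Bool) (x : P.cube n) (k : Bool) (i : Fin (m + 1)),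
    P.face k i (P.along θ ε x) =
      P.along ((Fin.succAboveOrderEmb i).trans θ) (Function.update ε (θ i) k) x
  | 0, _, _, θ, _, _, _, _ => (θ 0).elim0
  | n + 1, P, m, θ, ε, x, k, i => by
    by_cases h : θ (Fin.last m) = Fin.last n
    · rw [along_restrict P θ ε x h]
      by_cases hi : i = Fin.last m
      · subst hi
        have hl : ∀ a, ((Fin.succAboveOrderEmb (Fin.last m)).trans θ) a ≠ Fin.last n := by
          intro a ha
          have := θ.injective (ha.trans h.symm)
          exact Fin.succAbove_ne _ _ this
        rw [along_lower P _ _ x hl]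
        have := (P.decFace k).map_along (restrictEmb θ) (fun j => ε j.castSucc) x
        refine Eq.trans this (along_congr P ?_ ?_ ?_)
        · intro a
          apply Fin.castSucc_injective
          rw [restrictEmb_castSucc, lowerEmb_castSucc]
          simp
        · intro j
          rw [h, Function.update_of_ne (Fin.castSucc_lt_last j).ne]
        · rw [h, Function.update_self]; rfl
      · obtain ⟨i, rfl⟩ := Fin.exists_castSucc_eq.2 hi
        cases m with
        | zero => exact i.elim0
        | succ m =>
          have hl : ((Fin.succAboveOrderEmb i.castSucc).trans θ) (Fin.last m) = Fin.last n := by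
            have : i.castSucc.succAbove (Fin.last m) = Fin.last (m + 1) := by
              rw [Fin.succAbove_of_le_castSucc _ _ (by simpa using Fin.le_last i), Fin.succ_last]
            simp [this, h]
          rw [along_restrict P _ _ x hl]
          refine Eq.trans (face_along P.dec (restrictEmb θ) _ x k i) (along_congr P.dec ?_ ?_ rfl)
          · intro a
            apply Fin.castSucc_injective
            rw [restrictEmb_castSucc]
            simp [restrictEmb_castSucc]
          · intro j
            have e : (restrictEmb θ i).castSucc = θ i.castSucc := rfl
            by_cases hj : j = restrictEmb θ i
            · subst hj
              rw [e, Function.update_self, Function.update_self]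
            · have hj' : j.castSucc ≠ θ i.castSucc := fun hh =>
                hj (Fin.castSucc_injective _ (hh.trans e.symm))
              rw [Function.update_of_ne hj, Function.update_of_ne hj']
    · have hl := ne_last_of_last_ne h
      have hl' : ∀ a, ((Fin.succAboveOrderEmb i).trans θ) a ≠ Fin.last n := fun a => hl _
      rw [along_lower P θ ε x hl, face_along P, along_lower P _ _ x hl']
      refine along_congr P ?_ ?_ ?_
      · intro a
        apply Fin.castSucc_injective
        rw [lowerEmb_castSucc]
        simp [lowerEmb_castSucc]
      · intro j
        have e : (lowerEmb θ hl i).castSucc = θ i := rfl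
        by_cases hj : j = lowerEmb θ hl i
        · subst hj
          rw [e, Function.update_self, Function.update_self]
        · have hj' : j.castSucc ≠ θ i := fun hh =>
            hj (Fin.castSucc_injective _ (hh.trans e.symm))
          rw [Function.update_of_ne hj, Function.update_of_ne hj']
      · rw [Function.update_of_ne (hl i).symm]

/-- The morphism `x_♯ : ⟦0,1⟧^{⊗ n} → P` with `ι_n ↦ x`. -/
def sharp (P : PrecubicalSet.{u}) {n : ℕ} (x : P.cube n) : Hom (stdCube n) P where
  map c := P.along c.dir (fun j => decide (c.base j = 1)) x
  map_face k i c := by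
    rw [face_along]
    refine along_congr P (fun _ => rfl) (fun j => ?_) rfl
    have h0 : c.base (c.dir i) = 0 := Nat.lt_one_iff.1 (c.base_dir_lt i)
    change decide (Function.update c.base (c.dir i) (c.base (c.dir i) + k.toNat) j = 1) = _
    by_cases hj : j = c.dir i
    · subst hj
      cases k <;> simp [h0]
    · simp [Function.update_of_ne hj]

theorem sharp_top (P : PrecubicalSet.{u}) {n : ℕ} (x : P.cube n) :
    (P.sharp x).map (stdCube.top n) = x :=
  along_refl P _ x

/-- Being an iterated face (auxiliary, used to show that complements of stars are closed under
faces). -/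
inductive IsFace (P : PrecubicalSet.{u}) : ∀ {m n : ℕ}, P.cube m → P.cube n → Prop
  | refl {n : ℕ} (x : P.cube n) : IsFace P x x
  | step {m n : ℕ} (z : P.cube m) (k : Bool) (i : Fin (n + 1)) (y : P.cube (n + 1)) :
      IsFace P z (P.face k i y) → IsFace P z y

theorem IsFace.of_dec {P : PrecubicalSet.{u}} {m n : ℕ} {z : P.dec.cube m} {y : P.dec.cube n}
    (h : IsFace P.dec z y) : IsFace P (m := m + 1) (n := n + 1) z y := by
  induction h with
  | refl x => exact IsFace.refl (P := P) x
  | step z k i y _ ih => exact IsFace.step (P := P) z k i.castSucc y ih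

theorem isFace_along : ∀ {n : ℕ} (P : PrecubicalSet.{u}) {m : ℕ} (θ : Fin m ↪o Fin n)
    (ε : Fin n → Bool) (x : P.cube n), IsFace P (P.along θ ε x) x
  | 0, _, 0, _, _, x => IsFace.refl x
  | 0, _, _ + 1, θ, _, _ => (θ 0).elim0
  | n + 1, P, 0, θ, ε, x => by
    rw [along]
    exact IsFace.step _ _ _ _ (isFace_along P _ _ _)
  | n + 1, P, m + 1, θ, ε, x => by
    by_cases h : θ (Fin.last m) = Fin.last n
    · rw [along_restrict P θ ε x h]
      exact IsFace.of_dec (isFace_along P.dec _ _ _)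
    · rw [along_lower P θ ε x (ne_last_of_last_ne h)]
      exact IsFace.step _ _ _ _ (isFace_along P _ _ _)

theorem exists_map_eq_of_isFace {Q : PrecubicalSet.{v}} {P : PrecubicalSet.{u}} (g : Hom Q P)
    {m n : ℕ} {z : P.cube m} {y : P.cube n} (h : IsFace P z y) :
    (∃ d, g.map d = y) → ∃ c, g.map c = z := by
  induction h with
  | refl x => exact id
  | step z k i y _ ih =>
    rintro ⟨d, rfl⟩
    exact ih ⟨Q.face k i d, g.map_face k i d⟩

/-! ### Regularity, stars, free faces -/

/-- `x` is regular: `x_♯` is injective. -/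
def IsRegular (P : PrecubicalSet.{u}) {n : ℕ} (x : P.cube n) : Prop :=
  ∀ m, Function.Injective (fun c : (stdCube n).cube m => (P.sharp x).map c)

/-- The cubes of `⟦0,1⟧^{⊗ n}` none of whose coordinates is the vertex `1 - b`: for `b = 0` these
are the cubes of `⟦0,1⟦^{⊗ n}`, for `b = 1` the cubes of `⟧0,1⟧^{⊗ n}`. -/
def halfOpenCube (n : ℕ) (b : Bool) (m : ℕ) : Set ((stdCube n).cube m) :=
  {c | ∀ j, j ∉ Set.range c.dir → c.base j = b.toNat}

/-- `x` is weakly regular: the restrictions of `x_♯` to `⟦0,1⟦^{⊗ n}` and to `⟧0,1⟧^{⊗ n}` are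
injective. -/
def IsWeaklyRegularCube (P : PrecubicalSet.{u}) {n : ℕ} (x : P.cube n) : Prop :=
  ∀ (b : Bool) (m : ℕ), Set.InjOn (fun c => (P.sharp x).map c) (halfOpenCube n b m)

/-- `P` is weakly regular: all its elements are. -/
def IsWeaklyRegular (P : PrecubicalSet.{u}) : Prop :=
  ∀ (n : ℕ) (x : P.cube n), P.IsWeaklyRegularCube x

/-- The star of `x`: the cubes `y` with `x ∈ y_♯(⟦0,1⟧^{⊗ deg y})`. -/
def star (P : PrecubicalSet.{u}) {n : ℕ} (x : P.cube n) : Set P.Cubes :=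
  {y | ∃ c, (P.sharp y.2).map c = x}

theorem mem_star_of_face {P : PrecubicalSet.{u}} {n m : ℕ} {x : P.cube n} (k : Bool)
    (i : Fin (m + 1)) (y : P.cube (m + 1)) (h : (⟨m, P.face k i y⟩ : P.Cubes) ∈ P.star x) :
    (⟨m + 1, y⟩ : P.Cubes) ∈ P.star x := by
  obtain ⟨c, rfl⟩ := h
  exact exists_map_eq_of_isFace (P.sharp y) (IsFace.step _ k i y (isFace_along P _ _ _))
    ⟨_, P.sharp_top y⟩

/-- The precubical subset `P ∖ star(x)`. -/
def removeStar (P : PrecubicalSet.{u}) {n : ℕ} (x : P.cube n) : P.Sub where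
  carrier m := {y | (⟨m, y⟩ : P.Cubes) ∉ P.star x}
  face_mem k i y hy h := hy (mem_star_of_face k i y h)

/-- The face `d^k_{i+1} x` of `x` is free: `star(d^k_{i+1} x) = {x, d^k_{i+1} x}`. -/
def IsFreeFace (P : PrecubicalSet.{u}) {n : ℕ} (x : P.cube (n + 1)) (k : Bool)
    (i : Fin (n + 1)) : Prop :=
  P.star (P.face k i x) = {⟨n + 1, x⟩, ⟨n, P.face k i x⟩}

/-- The vertex `d^b_1 ⋯ d^b_1 x` (initial vertex of `x` for `b = 0`, final one for `b = 1`). -/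
def corner (P : PrecubicalSet.{u}) (b : Bool) : ∀ {n : ℕ}, P.cube n → P.cube 0
  | 0, x => x
  | _ + 1, x => corner P b (P.face b 0 x)

/-- The edge `e^k_{i+1} x = d_1^{1-k} ⋯ d_i^{1-k} d_{i+2}^{1-k} ⋯ d_{n+1}^{1-k} x` of a cube `x` of
degree `n + 1`. -/
def edge (P : PrecubicalSet.{u}) (k : Bool) : ∀ {n : ℕ}, Fin (n + 1) → P.cube (n + 1) → P.cube 1
  | 0, _, x => x
  | n + 1, i, x =>
      if h : i = Fin.last (n + 1) then
        edge P k (Fin.last n) (P.face (!k) (Fin.last n).castSucc x)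
      else
        edge P k (i.castPred h) (P.face (!k) (Fin.last (n + 1)) x)

/-! ### Geometric realization -/

/-- The disjoint union of the topological cubes `{x} × [0,1]ⁿ`, `x ∈ Pₙ`, `n ≥ 0`. -/
abbrev PreRealization (P : PrecubicalSet.{u}) : Type u :=
  Σ c : P.Cubes, (Fin c.1 → unitInterval)

/-- The relation `(d^k_i x, u) ∼ (x, δ^k_i u)`, where `δ^k_i` inserts `k` at place `i`. -/
inductive Glue (P : PrecubicalSet.{u}) : P.PreRealization → P.PreRealization → Prop
  | mk {n : ℕ} (k : Bool) (i : Fin (n + 1)) (x : P.cube (n + 1)) (u : Fin n → unitInterval) :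
      Glue P ⟨⟨n, P.face k i x⟩, u⟩
        ⟨⟨n + 1, x⟩, Fin.insertNth (α := fun _ => unitInterval) i (if k then 1 else 0) u⟩

/-- The geometric realization `|P|`, with the quotient topology. -/
def Realization (P : PrecubicalSet.{u}) : Type u := Quot P.Glue

instance (P : PrecubicalSet.{u}) : TopologicalSpace P.Realization :=
  inferInstanceAs (TopologicalSpace (Quot P.Glue))

/-- The point `[x, u]` of `|P|`. -/
def point (P : PrecubicalSet.{u}) {n : ℕ} (x : P.cube n) (u : Fin n → unitInterval) :
    P.Realization :=
  Quot.mk _ ⟨⟨n, x⟩, u⟩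

/-- The point `[v, ()]` of `|P|` given by a vertex. -/
def vertexPoint (P : PrecubicalSet.{u}) (x : P.cube 0) : P.Realization := P.point x Fin.elim0

/-- The continuous map `|g| : |P| → |Q|`, `[x, u] ↦ [g x, u]`. -/
def Hom.realize {P : PrecubicalSet.{u}} {Q : PrecubicalSet.{v}} (g : Hom P Q) :
    C(P.Realization, Q.Realization) where
  toFun := Quot.lift (fun z => Q.point (g.map z.1.2) z.2) (by
    rintro _ _ ⟨k, i, x, u⟩
    simp only [g.map_face]
    exact Quot.sound (Glue.mk k i (g.map x) u))
  continuous_toFun := by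
    refine continuous_quot_lift _ (continuous_sigma fun c => ?_)
    exact continuous_quot_mk.comp
      (continuous_sigmaMk (σ := fun c : Q.Cubes => Fin c.1 → unitInterval)
        (i := ⟨c.1, g.map c.2⟩))

/-- The map `|⟦0,k₁⟧ ⊗ ⋯ ⊗ ⟦0,kₙ⟧| → ℝⁿ` that identifies the realization of the box with
`[0,k₁] × ⋯ × [0,kₙ]`. -/
def boxCoord {n : ℕ} (k : Fin n → ℕ) : (box k).Realization → (Fin n → ℝ) :=
  Quot.lift (fun z j => (z.1.2.base j : ℝ) + ∑ a, if z.1.2.dir a = j then (z.2 a : ℝ) else 0) (by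
    rintro _ _ ⟨b, i, c, u⟩
    funext j
    have hs : ∀ a, c.dir (i.succAbove a) ≠ c.dir i := fun a h =>
      Fin.succAbove_ne i a (c.dir.injective h)
    have hd : ∀ a, ((box k).face b i c).dir a = c.dir (i.succAbove a) := fun _ => rfl
    have hb : ((box k).face b i c).base j =
      Function.update c.base (c.dir i) (c.base (c.dir i) + b.toNat) j := rfl
    simp only [Fin.sum_univ_succAbove _ i, Fin.insertNth_apply_same,
      Fin.insertNth_apply_succAbove, hd, hb]
    by_cases hj : c.dir i = j
    · subst hj
      cases b <;> simp [hs]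
    · rw [Function.update_of_ne (Ne.symm hj)]
      simp [hj])

/-- A dihomeomorphism between realizations of boxes: `φ` and `φ⁻¹` preserve the natural partial
order of `ℝⁿ`. -/
def IsDihomeomorphism {n : ℕ} {k l : Fin n → ℕ}
    (φ : (box k).Realization ≃ₜ (box l).Realization) : Prop :=
  ∀ a b, boxCoord k a ≤ boxCoord k b ↔ boxCoord l (φ a) ≤ boxCoord l (φ b)

/-! ### Paths -/

/-- The precubical interval `⟦0,k⟧`. -/
abbrev interval (k : ℕ) : PrecubicalSet.{0} := box (fun _ : Fin 1 => k)

/-- The vertex `j` of `⟦0,k⟧`. -/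
def interval.vertex {k : ℕ} (j : ℕ) (hj : j ≤ k) : (interval k).cube 0 where
  dir := OrderEmbedding.ofStrictMono Fin.elim0 (fun a => a.elim0)
  base _ := j
  base_le _ := hj
  base_dir_lt a := a.elim0

/-- The edge `[j, j+1]` of `⟦0,k⟧`. -/
def interval.edge {k : ℕ} (j : ℕ) (hj : j < k) : (interval k).cube 1 where
  dir := RelEmbedding.refl _
  base _ := j
  base_le _ := hj.le
  base_dir_lt _ := hj

theorem interval.face_edge_false {k : ℕ} (j : ℕ) (hj : j < k) :
    (interval k).face false 0 (interval.edge j hj) = interval.vertex j hj.le := by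
  refine BoxCell.ext ?_ ?_
  · ext a; exact a.elim0
  · funext a
    change Function.update (fun _ : Fin 1 => j) _ (j + 0) a = j
    simp

theorem interval.face_edge_true {k : ℕ} (j : ℕ) (hj : j < k) :
    (interval k).face true 0 (interval.edge j hj) = interval.vertex (j + 1) hj := by
  refine BoxCell.ext ?_ ?_
  · ext a; exact a.elim0
  · funext a
    change Function.update (fun _ : Fin 1 => j) (0 : Fin 1) (j + 1) a = j + 1
    rw [Subsingleton.elim a 0, Function.update_self]

/-- A path of length `k` in `P`: a morphism `⟦0,k⟧ → P`. -/
abbrev PathOfLength (P : PrecubicalSet.{u}) (k : ℕ) : Type u := Hom (interval k) P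

namespace PathOfLength

variable {P : PrecubicalSet.{u}} {k : ℕ}

/-- The vertex `ω(j)`. -/
def vertex (ω : P.PathOfLength k) (j : ℕ) (hj : j ≤ k) : P.cube 0 :=
  ω.map (interval.vertex j hj)

/-- The edge `ω([j, j+1])`. -/
def edge (ω : P.PathOfLength k) (j : ℕ) (hj : j < k) : P.cube 1 :=
  ω.map (interval.edge j hj)

/-- The start `ω(0)`. -/
def source (ω : P.PathOfLength k) : P.cube 0 := ω.vertex 0 (Nat.zero_le k)

/-- The end `ω(k)`. -/
def target (ω : P.PathOfLength k) : P.cube 0 := ω.vertex k le_rfl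

end PathOfLength

/-- `v →_P w`: there is a path in `P` from `v` to `w`. -/
def Reaches (P : PrecubicalSet.{u}) (v w : P.cube 0) : Prop :=
  ∃ (k : ℕ) (ω : P.PathOfLength k), ω.source = v ∧ ω.target = w

/-! ### The fundamental category -/

/-- The vertices of `P`, as the vertices of the underlying directed graph of `P`. -/
def Vert (P : PrecubicalSet.{u}) : Type u := P.cube 0

/-- The edges from `v` to `w` are the `e ∈ P₁` with `d^0_1 e = v` and `d^1_1 e = w`. -/
instance (P : PrecubicalSet.{u}) : Quiver.{u} P.Vert where
  Hom v w := {e : P.cube 1 // P.face false 0 e = v ∧ P.face true 0 e = w}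

/-- The edge `e` as an arrow. -/
def arrow (P : PrecubicalSet.{u}) (e : P.cube 1) {v w : P.Vert} (hv : P.face false 0 e = v)
    (hw : P.face true 0 e = w) : v ⟶ w := ⟨e, hv, hw⟩

/-- A path, as a morphism of the category of paths (the free category on the underlying directed
graph, whose composition is concatenation): `ω` restricted to `⟦0,j⟧`. -/
def PathOfLength.initialSegment {P : PrecubicalSet.{u}} {k : ℕ} (ω : P.PathOfLength k) :
    ∀ (j : ℕ) (hj : j ≤ k),
      Quiver.Path (V := P.Vert) (ω.vertex 0 (Nat.zero_le k)) (ω.vertex j hj)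
  | 0, _ => Quiver.Path.nil
  | j + 1, hj => (initialSegment ω j (Nat.le_of_succ_le hj)).cons
      (P.arrow (ω.edge j hj)
        ((ω.map_face false 0 _).symm.trans (congrArg _ (interval.face_edge_false j hj)))
        ((ω.map_face true 0 _).symm.trans (congrArg _ (interval.face_edge_true j hj))))

/-- The generating dihomotopies: `(d_1^0 z)_♯ · (d_2^1 z)_♯` and `(d_2^0 z)_♯ · (d_1^1 z)_♯` for
`z ∈ P₂`, as paths from `d_1^0 d_1^0 z` to `d_1^1 d_1^1 z`. -/
inductive Square (P : PrecubicalSet.{u}) : HomRel (Paths P.Vert)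
  | mk (z : P.cube 2) :
      Square P (X := P.face false 0 (P.face false 0 z)) (Y := P.face true 0 (P.face true 0 z))
        ((Quiver.Path.nil.cons (P.arrow (P.face false 0 z) rfl rfl)).cons
          (P.arrow (P.face true 1 z) (P.face_face false true 0 0 le_rfl z)
            (P.face_face true true 0 0 le_rfl z)))
        ((Quiver.Path.nil.cons
          (P.arrow (P.face false 1 z) (P.face_face false false 0 0 le_rfl z) rfl)).cons
          (P.arrow (P.face true 0 z) (P.face_face true false 0 0 le_rfl z).symm rfl))

/-- The fundamental category: objects are the vertices, morphisms are the
dihomotopy classes of paths, i.e. the classes of paths for the equivalence relation generated by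
`α · p · β ∼ α · q · β` where `p`, `q` are the two paths around the boundary of a `2`-cube. -/
abbrev FundamentalCategory (P : PrecubicalSet.{u}) : Type u := CategoryTheory.Quotient P.Square

/-- A vertex as an object of the fundamental category. -/
def FundamentalCategory.of (P : PrecubicalSet.{u}) (v : P.cube 0) : P.FundamentalCategory := ⟨v⟩

/-- The dihomotopy class of a path, as a morphism (with its source and target) of the fundamental
category. -/
def PathOfLength.dihomotopyClass {P : PrecubicalSet.{u}} {k : ℕ} (ω : P.PathOfLength k) :
    Arrow P.FundamentalCategory :=
  Arrow.mk ((CategoryTheory.Quotient.functor P.Square).map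
    (X := (ω.source : P.Vert)) (Y := (ω.target : P.Vert)) (ω.initialSegment k le_rfl))

/-! ### Weak morphisms of precubical sets -/

/-- Weak morphisms from `Q` to `P`. -/
structure WeakMorphism (Q : PrecubicalSet.{u}) (P : PrecubicalSet.{v}) where
  toMap : C(Q.Realization, P.Realization)
  exists_vertex : ∀ x : Q.cube 0, ∃ y : P.cube 0, toMap (Q.vertexPoint x) = P.vertexPoint y
  exists_box : ∀ (n : ℕ), 1 ≤ n → ∀ (k : Fin n → ℕ), (∀ j, 1 ≤ k j) → ∀ ξ : Hom (box k) Q,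
    ∃ l : Fin n → ℕ, (∀ j, 1 ≤ l j) ∧ ∃ (χ : Hom (box l) P)
      (φ : (box k).Realization ≃ₜ (box l).Realization),
      IsDihomeomorphism φ ∧ ∀ t, toMap (ξ.realize t) = χ.realize (φ t)

namespace WeakMorphism

variable {Q : PrecubicalSet.{u}} {P : PrecubicalSet.{v}}

/-- The map `f₀` on vertices: `f([x, ()]) = [f₀(x), ()]`. -/
noncomputable def onVertex (f : WeakMorphism Q P) (x : Q.cube 0) : P.cube 0 :=
  (f.exists_vertex x).choose

/-- `ν = f^𝕀(ω)`: there is a dihomeomorphism `φ : [0,k] → [0,l]` with `f ∘ |ω| = |ν| ∘ φ`. (For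
`k = 0` this forces `l = 0` and says that `ν(0) = f₀(ω(0))`.) -/
def IsPathImage (f : WeakMorphism Q P) {k l : ℕ} (ω : Q.PathOfLength k)
    (ν : P.PathOfLength l) : Prop :=
  ∃ φ : (interval k).Realization ≃ₜ (interval l).Realization,
    IsDihomeomorphism φ ∧ ∀ t, f.toMap (ω.realize t) = ν.realize (φ t)

/-- `F` is the functor `f_*` between fundamental categories: `F(v) = f₀(v)` and
`F([ω]) = [f^𝕀(ω)]`. -/
def IsInducedFunctor (f : WeakMorphism Q P)
    (F : Q.FundamentalCategory ⥤ P.FundamentalCategory) : Prop :=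
  (∀ x : Q.cube 0, F.obj (FundamentalCategory.of Q x) = FundamentalCategory.of P (f.onVertex x)) ∧
  ∀ (k l : ℕ) (ω : Q.PathOfLength k) (ν : P.PathOfLength l), f.IsPathImage ω ν →
    F.mapArrow.obj ω.dihomotopyClass = ν.dihomotopyClass

end WeakMorphism

/-! ### The homology graph -/

section Homology

variable (R : Type w) [CommRing R]

/-- Singular homology `H_n(X)` with coefficients in `R`. -/
noncomputable def singularHomology (n : ℕ) : TopCat.{u} ⥤ ModuleCat.{max w u} R :=
  (AlgebraicTopology.singularHomologyFunctor (ModuleCat.{max w u} R) n).obj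
    (ModuleCat.of R (ULift.{u} R))

/-- The homology classes of `|P|`: the (homogeneous) elements of `H_*(|P|)`. -/
abbrev HomologyClass (P : PrecubicalSet.{u}) : Type (max w u) :=
  Σ n : ℕ, (singularHomology R n).obj (TopCat.of P.Realization)

/-- The map in homology induced by a continuous map of realizations. -/
noncomputable def homologyMap {Q P : PrecubicalSet.{u}} (f : C(Q.Realization, P.Realization))
    (α : Q.HomologyClass R) : P.HomologyClass R :=
  ⟨α.1, ((singularHomology R α.1).map (TopCat.ofHom f)).hom α.2⟩

/-- `α ↗ β`: the homology class `α` points to the homology class `β`. -/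
def PointsTo (P : PrecubicalSet.{u}) (α β : P.HomologyClass R) : Prop :=
  ∃ X Y : P.Sub, α ∈ Set.range (homologyMap R X.incl.realize) ∧
    β ∈ Set.range (homologyMap R Y.incl.realize) ∧
    ∀ x ∈ X.carrier 0, ∀ y ∈ Y.carrier 0, P.Reaches x y

/-- `f` induces an isomorphism of homology graphs. -/
def IsHomologyGraphIso {Q P : PrecubicalSet.{u}} (f : C(Q.Realization, P.Realization)) : Prop :=
  Function.Bijective (homologyMap R f) ∧
  ∀ α β : Q.HomologyClass R, PointsTo R Q α β ↔ PointsTo R P (homologyMap R f α) (homologyMap R f β)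

end Homology

/-- The set `m_b(P)` of the vertices `v` such that there is no edge `e` with `d^b_1 e = v`: the
maximal vertices for `b = 0`, the minimal ones for `b = 1`. -/
def extremal (P : PrecubicalSet.{u}) (b : Bool) : Set (P.cube 0) :=
  {v | ¬ ∃ e : P.cube 1, P.face b 0 e = v}

end PrecubicalSet

open PrecubicalSet

/-! ### Higher-dimensional automata -/

/-- Higher-dimensional automata over the monoid `M`. -/
structure HDA (M : Type w) [Monoid M] where
  P : PrecubicalSet.{u}
  init : Set (P.cube 0)
  final : Set (P.cube 0)
  label : P.cube 1 → M
  label_face : ∀ (x : P.cube 2) (i : Fin 2),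
    label (P.face false i x) = label (P.face true i x)

namespace HDA

variable {M : Type w} [Monoid M]

/-- The extended labeling function on paths. -/
def pathLabel (A : HDA.{u} M) {k : ℕ} (ω : A.P.PathOfLength k) : M :=
  (List.ofFn fun j : Fin k => A.label (ω.edge j j.2)).prod

/-- `A` is accessible: every vertex can be reached from an initial state. -/
def IsAccessible (A : HDA.{u} M) : Prop :=
  ∀ b : A.P.cube 0, ∃ a ∈ A.init, A.P.Reaches a b

/-- `A` is coaccessible: a final state can be reached from every vertex. -/
def IsCoaccessible (A : HDA.{u} M) : Prop :=
  ∀ a : A.P.cube 0, ∃ b ∈ A.final, A.P.Reaches a b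

/-- The HDA `(Q, I, F, λ|_{Q₁})` on a precubical subset `Q` of `P` (with `I ∩ Q₀` and `F ∩ Q₀` in
place of `I` and `F` if `Q` does not contain all vertices). -/
def restrict (A : HDA.{u} M) (Q : A.P.Sub) : HDA.{u} M where
  P := Q.toPrecubicalSet
  init := {a | a.1 ∈ A.init}
  final := {a | a.1 ∈ A.final}
  label e := A.label e.1
  label_face x i := A.label_face x.1 i

/-- A weak morphism from `B` to `A`: a weak morphism `f` of the underlying precubical sets with
`f(J) ⊆ I`, `f(G) ⊆ F` and `λ̄ ∘ f^𝕀 = μ̄`. -/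
def IsWeakMorphism (B : HDA.{u} M) (A : HDA.{v} M) (f : WeakMorphism B.P A.P) : Prop :=
  (∀ a ∈ B.init, f.onVertex a ∈ A.init) ∧ (∀ a ∈ B.final, f.onVertex a ∈ A.final) ∧
  ∀ (k l : ℕ) (ω : B.P.PathOfLength k) (ν : A.P.PathOfLength l), f.IsPathImage ω ν →
    A.pathLabel ν = B.pathLabel ω

/-- The objects of the trace category: `I ∪ F ∪ m_0(P) ∪ m_1(P)`. -/
def traceObjects (A : HDA.{u} M) : ObjectProperty A.P.FundamentalCategory := fun X =>
  ∃ a : A.P.cube 0, a ∈ A.init ∪ A.final ∪ A.P.extremal false ∪ A.P.extremal true ∧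
    X = FundamentalCategory.of A.P a

/-- The trace category: the full subcategory of the fundamental category on these objects. -/
abbrev TraceCategory (A : HDA.{u} M) : Type u := A.traceObjects.FullSubcategory

/-- `f_*` restricts to an isomorphism of trace categories. -/
def IsTraceCategoryIso {B : HDA.{u} M} {A : HDA.{v} M} (f : WeakMorphism B.P A.P) : Prop :=
  ∃ F : B.P.FundamentalCategory ⥤ A.P.FundamentalCategory, f.IsInducedFunctor F ∧
  ∃ Φ : B.TraceCategory ⥤ A.TraceCategory,
    Φ ⋙ A.traceObjects.ι = B.traceObjects.ι ⋙ F ∧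
    ∃ Ψ : A.TraceCategory ⥤ B.TraceCategory,
      Φ ⋙ Ψ = 𝟭 B.TraceCategory ∧ Ψ ⋙ Φ = 𝟭 A.TraceCategory

/-- `B` is a topological abstraction of `A` (homology being taken with coefficients in `R`). -/
def IsTopologicalAbstraction (R : Type w') [CommRing R] (B A : HDA.{u} M) : Prop :=
  ∃ f : WeakMorphism B.P A.P, IsWeakMorphism B A f ∧
    f.onVertex '' B.init = A.init ∧ f.onVertex '' B.final = A.final ∧
    (∀ b : Bool, f.onVertex '' B.P.extremal b = A.P.extremal b) ∧
    (∃ h : ContinuousMap.HomotopyEquiv B.P.Realization A.P.Realization, h.toFun = f.toMap) ∧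
    IsTraceCategoryIso (B := B) (A := A) f ∧
    IsHomologyGraphIso R f.toMap

end HDA

/-! The weak morphism is the inclusion of `Q` into `P`, and all conditions are checked for it. A
path is determined by its realization up to increasing reparametrization
(`PathOfLength.eq_of_realize_eq`), so the inclusion sends a path to the same path seen in `P`. This
settles the labels and the induced functor.

Homotopy type: passing from `P` to `Q` is an elementary collapse. Regularity makes the other faces
of `x` different from the free one, so they lie in `Q`. Radial projection of the cube onto the union
of these faces, glued with the constant homotopy on `Q`, deforms `|P|` onto `|Q|`
(`Hom.IsCollapse.exists_homotopyEquiv`).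

For the directed conditions take `k = 1`; the case `k = 0` is the reversal. Let `e` be the edge
`e^k_i x`, from the first vertex `w` of `x` to `v`. It is the only edge into `v`, and no square ends
in `v`: its last two edges would both be `e`, against weak regularity. A path that reaches `v` from
elsewhere therefore arrives along `e`. If the removed face is an edge, it starts in `v`, and `e`
followed by it can be replaced by the other two sides of the square `x`. Hence reachability from
vertices other than `v` is the same in `P` and in `Q` (`IsFreeCube.sub_reachesTo`).

Homology graph: if `X` and `Y` witness a relation in `P`, they are replaced by precubical subsets of
`Q` carrying at least the same classes. A subset containing the free face is enlarged by `x` and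
then collapsed (`exists_sub_le`). If `X` contains `v` but no edge leaving it, then `v` is pushed
back along `e` by another collapse (`exists_sub_le_avoiding`). If an edge of `X` does leave `v`,
paths from `v` can begin with that edge.

Trace category: in degree at least 4 no edge or square is removed. In degrees 2 and 3 an inverse is
built by sending `v` to `w` and precomposing with `e` (`Sub.homMap_bijective_of_unique_ingoing`).
For a 3-cube the five remaining faces show that the two sides of the removed square agree after
precomposition with `e`. This handles morphisms between vertices other than `v`, which suffices: `v`
is not in `I ∪ F` by hypothesis and is not extremal, because edges both enter and leave it.

Accessibility and coaccessibility follow from the comparison of reachability; for a square, the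
additional edge at `v` allows paths from `v` to start inside `Q`. -/

namespace PrecubicalSet

/-! ### Normal forms of points of the realization -/

/-- The end point of the unit interval with index `k`. -/
abbrev bit (k : Bool) : unitInterval := if k then 1 else 0

theorem bit_injective {k l : Bool} (h : bit k = bit l) : k = l := by
  cases k <;> cases l <;> first | rfl | simp [bit] at h

theorem glue_iff {P : PrecubicalSet.{u}} {n : ℕ} {y : P.cube (n + 1)}
    {z : Fin (n + 1) → unitInterval} {c : P.PreRealization} :
    P.Glue c ⟨⟨n + 1, y⟩, z⟩ ↔ ∃ (l : Bool) (j : Fin (n + 1)), z j = bit l ∧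
      c = ⟨⟨n, P.face l j y⟩, fun a => z (j.succAbove a)⟩ := by
  constructor
  · intro h
    generalize hp : (⟨⟨n + 1, y⟩, z⟩ : P.PreRealization) = p at h
    cases h with
    | mk k i x u =>
      simp only [Sigma.mk.injEq] at hp
      obtain ⟨⟨h1, h2⟩, h3⟩ := hp
      obtain rfl := Nat.succ.inj h1
      obtain rfl := eq_of_heq h2
      obtain rfl := eq_of_heq h3
      exact ⟨k, i, by simp [bit], by simp⟩
  · rintro ⟨l, j, hz, rfl⟩
    have := Glue.mk l j y (fun a => z (j.succAbove a))
    have e : Fin.insertNth (α := fun _ => unitInterval) j (if l then 1 else 0)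
        (fun a => z (j.succAbove a)) = z := by
      rw [Fin.insertNth_eq_iff]
      exact ⟨hz.symm, rfl⟩
    rwa [e] at this

theorem not_glue_zero {P : PrecubicalSet.{u}} {y : P.cube 0}
    {z : Fin 0 → unitInterval} {c : P.PreRealization} : ¬ P.Glue c ⟨⟨0, y⟩, z⟩ := by
  intro h
  generalize hp : (⟨⟨0, y⟩, z⟩ : P.PreRealization) = p at h
  cases h with
  | mk k i x u =>
    simp only [Sigma.mk.injEq] at hp
    omega

/-- The relation between a point and its expressions by cubes of one degree less. -/
def Red (P : PrecubicalSet.{u}) (p q : P.PreRealization) : Prop := P.Glue q p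

theorem succAbove_succAbove_comm {n : ℕ} {i j : Fin (n + 1)} (h : i ≤ j) (a : Fin n) :
    i.castSucc.succAbove (j.succAbove a) = j.succ.succAbove (i.succAbove a) := by
  ext
  simp only [Fin.succAbove, Fin.lt_def, Fin.le_def] at *
  split_ifs <;> simp_all <;> omega

/-- Two end-point coordinates of one point can be deleted in either order, and the precubical
identity says that the resulting cubes coincide. -/
theorem red_diamond_aux {P : PrecubicalSet.{u}} {n : ℕ} (y : P.cube (n + 1))
    (z : Fin (n + 1) → unitInterval) (k l : Bool) (i j : Fin (n + 1)) (hij : i < j)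
    (hi : z i = bit k) (hj : z j = bit l) :
    ∃ d, P.Red ⟨⟨n, P.face k i y⟩, fun a => z (i.succAbove a)⟩ d ∧
      P.Red ⟨⟨n, P.face l j y⟩, fun a => z (j.succAbove a)⟩ d := by
  cases n with
  | zero => simp only [Fin.lt_def] at hij; omega
  | succ n =>
    obtain ⟨j, rfl⟩ := Fin.exists_succ_eq.2 (Fin.ne_zero_of_lt hij)
    obtain ⟨i, rfl⟩ := Fin.exists_castSucc_eq.2 (Fin.ne_last_of_lt hij)
    have hle : i ≤ j := by
      simp only [Fin.lt_def, Fin.le_def] at *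
      simp at hij
      omega
    have h1 : j.succ.succAbove i = i.castSucc :=
      Fin.succAbove_of_castSucc_lt _ _ hij
    have h2 : i.castSucc.succAbove j = j.succ :=
      Fin.succAbove_of_le_castSucc _ _ (by simpa using hle)
    refine ⟨⟨⟨n, P.face k i (P.face l j.succ y)⟩, fun a => z (j.succ.succAbove (i.succAbove a))⟩,
      glue_iff.2 ⟨l, j, by rw [h2, hj], ?_⟩, glue_iff.2 ⟨k, i, by rw [h1, hi], rfl⟩⟩
    rw [P.face_face k l i j hle]
    simp only [succAbove_succAbove_comm hle]

/-- At most one step is needed on the first side. This strong form of local confluence gives the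
Church–Rosser property without a termination argument. -/
theorem red_diamond {P : PrecubicalSet.{u}} (a b c : P.PreRealization) (hb : P.Red a b)
    (hc : P.Red a c) : ∃ d, Relation.ReflGen P.Red b d ∧ Relation.ReflTransGen P.Red c d := by
  obtain ⟨⟨n, y⟩, z⟩ := a
  cases n with
  | zero => exact (not_glue_zero hb).elim
  | succ n =>
    obtain ⟨k, i, hi, rfl⟩ := glue_iff.1 hb
    obtain ⟨l, j, hj, rfl⟩ := glue_iff.1 hc
    rcases lt_trichotomy i j with h | rfl | h
    · obtain ⟨d, h1, h2⟩ := red_diamond_aux y z k l i j h hi hj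
      exact ⟨d, .single h1, .single h2⟩
    · obtain rfl := bit_injective (hi.symm.trans hj)
      exact ⟨_, .refl, .refl⟩
    · obtain ⟨d, h1, h2⟩ := red_diamond_aux y z l k j i h hj hi
      exact ⟨d, .single h2, .single h1⟩

theorem mk_eq_of_reflTransGen {P : PrecubicalSet.{u}} {p q : P.PreRealization}
    (h : Relation.ReflTransGen P.Red p q) : Quot.mk P.Glue p = Quot.mk P.Glue q := by
  induction h with
  | refl => rfl
  | tail _ h ih => exact ih.trans (Quot.sound (r := P.Glue) h).symm

/-- Church–Rosser: equality in the realization, a priori a zigzag of gluings, is witnessed by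
passing to faces on both sides. -/
theorem exists_common_reduct {P : PrecubicalSet.{u}} {p q : P.PreRealization}
    (h : Quot.mk P.Glue p = Quot.mk P.Glue q) :
    ∃ r, Relation.ReflTransGen P.Red p r ∧ Relation.ReflTransGen P.Red q r := by
  have hE := Relation.equivalence_join_reflTransGen (r := P.Red) red_diamond
  have key : ∀ a b, Relation.EqvGen P.Glue a b →
      Relation.Join (Relation.ReflTransGen P.Red) a b := by
    intro a b hab
    induction hab with
    | rel a b h => exact ⟨a, .refl, .single h⟩
    | refl a => exact hE.refl a
    | symm a b _ ih => exact hE.symm ih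
    | trans a b c _ _ h1 h2 => exact hE.trans h1 h2
  exact key _ _ (Quot.eqvGen_exact h)

/-- Points in the interior of a cube admit no reduction. -/
theorem eq_of_reflTransGen_of_interior {P : PrecubicalSet.{u}} {n : ℕ} {y : P.cube n}
    {z : Fin n → unitInterval} (hz : ∀ j, z j ≠ 0 ∧ z j ≠ 1) {r : P.PreRealization}
    (h : Relation.ReflTransGen P.Red ⟨⟨n, y⟩, z⟩ r) : r = ⟨⟨n, y⟩, z⟩ := by
  rcases h.cases_head with h | ⟨c, hc, -⟩
  · exact h.symm
  · cases n with
    | zero => exact (not_glue_zero hc).elim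
    | succ n =>
      obtain ⟨l, j, hj, -⟩ := glue_iff.1 hc
      cases l
      · exact absurd hj (hz j).1
      · exact absurd hj (hz j).2

theorem sigma_eq_of_point_eq {P : PrecubicalSet.{u}} {n m : ℕ} {y : P.cube n} {y' : P.cube m}
    {z : Fin n → unitInterval} {z' : Fin m → unitInterval} (hz : ∀ j, z j ≠ 0 ∧ z j ≠ 1)
    (hz' : ∀ j, z' j ≠ 0 ∧ z' j ≠ 1) (h : P.point y z = P.point y' z') :
    (⟨n, y⟩ : P.Cubes) = ⟨m, y'⟩ := by
  obtain ⟨r, h1, h2⟩ := exists_common_reduct h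
  have := (eq_of_reflTransGen_of_interior hz h1).symm.trans (eq_of_reflTransGen_of_interior hz' h2)
  exact congrArg Sigma.fst this

theorem vertexPoint_injective (P : PrecubicalSet.{u}) : Function.Injective P.vertexPoint := by
  intro a b h
  have := sigma_eq_of_point_eq (fun j => j.elim0) (fun j => j.elim0) h
  exact eq_of_heq (Sigma.mk.inj this).2

theorem point_face (P : PrecubicalSet.{u}) {n : ℕ} (k : Bool) (i : Fin (n + 1))
    (x : P.cube (n + 1)) (z : Fin (n + 1) → unitInterval) (h : z i = bit k) :
    P.point x z = P.point (P.face k i x) (fun a => z (i.succAbove a)) :=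
  (Quot.sound (glue_iff.2 ⟨k, i, h, rfl⟩)).symm

theorem continuous_point (P : PrecubicalSet.{u}) {n : ℕ} (x : P.cube n) :
    Continuous (P.point x) :=
  continuous_quot_mk.comp
    (continuous_sigmaMk (σ := fun c : P.Cubes => Fin c.1 → unitInterval) (i := ⟨n, x⟩))

theorem isClosed_iff {P : PrecubicalSet.{u}} {A : Set P.Realization} :
    IsClosed A ↔ ∀ (n : ℕ) (x : P.cube n), IsClosed (P.point x ⁻¹' A) := by
  constructor
  · exact fun h n x => h.preimage (P.continuous_point x)
  · intro h
    have : Topology.IsQuotientMap (Quot.mk P.Glue) := isQuotientMap_quot_mk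
    refine (this.isClosed_preimage (s := A)).1 ?_
    rw [isClosed_sigma_iff]
    rintro ⟨n, x⟩
    exact h n x

theorem Realization.ind {P : PrecubicalSet.{u}} {p : P.Realization → Prop}
    (h : ∀ (n : ℕ) (x : P.cube n) (z : Fin n → unitInterval), p (P.point x z)) (t) : p t := by
  obtain ⟨⟨⟨n, x⟩, z⟩, rfl⟩ := Quot.exists_rep t
  exact h n x z

theorem Hom.realize_point {P : PrecubicalSet.{u}} {Q : PrecubicalSet.{v}} (g : Hom P Q) {n : ℕ}
    (x : P.cube n) (z : Fin n → unitInterval) :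
    g.realize (P.point x z) = Q.point (g.map x) z := rfl

theorem Hom.realize_comp {P : PrecubicalSet.{u}} {Q : PrecubicalSet.{v}} {S : PrecubicalSet.{w}}
    (g : Hom Q S) (f : Hom P Q) : (g.comp f).realize = g.realize.comp f.realize := by
  ext t
  induction t using Realization.ind with
  | h n x z => rfl

/-! ### Injective morphisms realize to closed embeddings -/

/-- A morphism that is injective in every degree. -/
def Hom.IsInjective {P : PrecubicalSet.{u}} {Q : PrecubicalSet.{v}} (g : Hom P Q) : Prop :=
  ∀ n, Function.Injective (fun x : P.cube n => g.map x)

theorem Sub.incl_isInjective {P : PrecubicalSet.{u}} (X : P.Sub) : X.incl.IsInjective :=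
  fun _ _ _ h => Subtype.ext h

/-- A morphism on representatives of points. -/
def Hom.pre {P : PrecubicalSet.{u}} {Q : PrecubicalSet.{v}} (g : Hom P Q)
    (p : P.PreRealization) : Q.PreRealization := ⟨⟨p.1.1, g.map p.1.2⟩, p.2⟩

theorem Hom.IsInjective.pre {P : PrecubicalSet.{u}} {Q : PrecubicalSet.{v}} {g : Hom P Q}
    (hg : g.IsInjective) : Function.Injective g.pre := by
  rintro ⟨⟨n, x⟩, z⟩ ⟨⟨m, y⟩, z'⟩ h
  simp only [Hom.pre, Sigma.mk.injEq] at h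
  obtain ⟨⟨rfl, h2⟩, h3⟩ := h
  obtain rfl := hg _ (eq_of_heq h2)
  obtain rfl := eq_of_heq h3
  rfl

/-- Whether a point reduces depends only on its coordinates, which a morphism does not change, so
reductions lift. -/
theorem Hom.exists_of_reflTransGen {P : PrecubicalSet.{u}} {Q : PrecubicalSet.{v}} (g : Hom P Q)
    {p : P.PreRealization} {r : Q.PreRealization}
    (h : Relation.ReflTransGen Q.Red (g.pre p) r) :
    ∃ q, Relation.ReflTransGen P.Red p q ∧ r = g.pre q := by
  induction h with
  | refl => exact ⟨p, .refl, rfl⟩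
  | tail _ h ih =>
    obtain ⟨⟨⟨n, x⟩, z⟩, hq, rfl⟩ := ih
    cases n with
    | zero => exact (not_glue_zero h).elim
    | succ n =>
      obtain ⟨l, j, hj, rfl⟩ := glue_iff.1 h
      refine ⟨⟨⟨n, P.face l j x⟩, fun a => z (j.succAbove a)⟩,
        hq.tail (glue_iff.2 ⟨l, j, hj, rfl⟩), ?_⟩
      exact congrArg (fun y => (⟨⟨n, y⟩, fun a => z (j.succAbove a)⟩ : Q.PreRealization))
        (g.map_face l j x).symm

theorem Hom.IsInjective.realize {P : PrecubicalSet.{u}} {Q : PrecubicalSet.{v}} {g : Hom P Q}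
    (hg : g.IsInjective) : Function.Injective g.realize := by
  intro s t h
  induction s using Realization.ind with
  | h n x z =>
  induction t using Realization.ind with
  | h m y z' =>
  obtain ⟨r, h1, h2⟩ := exists_common_reduct h
  obtain ⟨q, hq, rfl⟩ := g.exists_of_reflTransGen (p := ⟨⟨n, x⟩, z⟩) h1
  obtain ⟨q', hq', e⟩ := g.exists_of_reflTransGen (p := ⟨⟨m, y⟩, z'⟩) h2
  obtain rfl := hg.pre e
  exact (mk_eq_of_reflTransGen hq).trans (mk_eq_of_reflTransGen hq').symm

theorem continuous_insertNth_right {n : ℕ} (j : Fin (n + 1)) (c : unitInterval) :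
    Continuous (fun u : Fin n → unitInterval =>
      (Fin.insertNth (α := fun _ => unitInterval) j c u : Fin (n + 1) → unitInterval)) :=
  Continuous.finInsertNth j continuous_const continuous_id

/-- Closedness of an image is tested on each cube of the target, by induction on the degree. On a
cube outside the image of `g`, the image of a closed set can only meet the boundary, where it is
described by the faces. -/
theorem Hom.IsInjective.isClosedEmbedding {P : PrecubicalSet.{u}} {Q : PrecubicalSet.{v}}
    {g : Hom P Q} (hg : g.IsInjective) : Topology.IsClosedEmbedding g.realize := by
  refine .of_continuous_injective_isClosedMap g.realize.continuous hg.realize fun A hA => ?_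
  rw [isClosed_iff]
  intro n
  induction n with
  | zero => exact fun y => Set.Subsingleton.isClosed Set.subsingleton_of_subsingleton
  | succ n ih =>
    intro y
    by_cases hy : ∃ s, g.map s = y
    · obtain ⟨s, rfl⟩ := hy
      convert isClosed_iff.1 hA _ s using 1
      ext z
      simp only [Set.mem_preimage]
      rw [← Hom.realize_point, hg.realize.mem_set_image]
    · have e : Q.point y ⁻¹' (g.realize '' A) = ⋃ p : Bool × Fin (n + 1),
          (fun u => (Fin.insertNth (α := fun _ => unitInterval) p.2 (bit p.1) u)) ''
            (Q.point (Q.face p.1 p.2 y) ⁻¹' (g.realize '' A)) := by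
        ext z
        simp only [Set.mem_iUnion]
        constructor
        · rintro ⟨t, ht, h⟩
          induction t using Realization.ind with
          | h m s z' =>
          obtain ⟨r, h1, h2⟩ := exists_common_reduct (P := Q) (p := ⟨⟨m, g.map s⟩, z'⟩)
            (q := ⟨⟨n + 1, y⟩, z⟩) h
          obtain ⟨q, hq, rfl⟩ := g.exists_of_reflTransGen (p := ⟨⟨m, s⟩, z'⟩) h1
          rcases h2.cases_head with h3 | ⟨c, hc, -⟩
          -- If the point of `y` needed no reduction, it would equal a point on a cube coming from
          -- the source, and `y` would be in the image of `g`.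
          · exfalso
            obtain ⟨⟨m', s'⟩, z''⟩ := q
            simp only [Hom.pre, Sigma.mk.injEq] at h3
            obtain ⟨⟨rfl, h4⟩, -⟩ := h3
            exact hy ⟨s', (eq_of_heq h4).symm⟩
          · obtain ⟨l, j, hj, rfl⟩ := glue_iff.1 hc
            refine ⟨(l, j), fun a => z (j.succAbove a), ⟨_, ht, ?_⟩, ?_⟩
            · rw [h]
              exact Q.point_face l j y z hj
            · rw [Fin.insertNth_eq_iff]
              exact ⟨hj.symm, rfl⟩
        · rintro ⟨⟨l, j⟩, u, hu, rfl⟩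
          simp only [Set.mem_preimage] at hu ⊢
          rw [Q.point_face l j y _ (by simp)]
          simpa using hu
      rw [e]
      refine isClosed_iUnion_of_finite fun p => ?_
      -- Closed subsets of the face cube are compact, so their images under the coface maps are
      -- closed; there are finitely many faces.
      exact ((ih _).isCompact.image (continuous_insertNth_right p.2 (bit p.1))).isClosed

end PrecubicalSet

namespace PrecubicalSet

/-! ### Deformation of a cube onto the union of all faces but one -/

section Cube

variable {n : ℕ} (k : Bool) (i : Fin (n + 1))

/-- Distance of `z` from the face opposite to the face `(k, i)`. -/
def boxHeight (z : Fin (n + 1) → unitInterval) : ℝ := if k then (z i : ℝ) else 1 - z i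

/-- The displacement of `z` from the central line in direction `i`. -/
noncomputable def boxOffset (z : Fin (n + 1) → unitInterval) : Fin (n + 1) → ℝ :=
  fun j => if j = i then 0 else (z j : ℝ) - 1 / 2

/-- The inverse of the scaling factor of the radial projection. -/
noncomputable def boxScale (z : Fin (n + 1) → unitInterval) : ℝ :=
  -- The centre of projection has height 2 and offset 0, while the free face has height 1. The ray
  -- from it through `z`, scaled by `s`, has offset `s` times that of `z` and height `2 - s * (2 -
  -- height)`. It meets a side wall when `2 * s * ‖offset‖ = 1` and the bottom when `s * (2 -
  -- height) = 2`. The first of these occurs at the inverse of this maximum.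
  max (2 * ‖boxOffset i z‖) ((2 - boxHeight k i z) / 2)

/-- Radial projection, from a point above the face `(k, i)`, onto the union of the other faces. -/
noncomputable def boxProj (z : Fin (n + 1) → unitInterval) (j : Fin (n + 1)) : ℝ :=
  if j = i then
    (if k then 2 - (2 - boxHeight k i z) / boxScale k i z
      else 1 - (2 - (2 - boxHeight k i z) / boxScale k i z))
  else boxOffset i z j / boxScale k i z + 1 / 2

/-- The linear homotopy from the identity to the radial projection. -/
noncomputable def boxDeform (p : (Fin (n + 1) → unitInterval) × unitInterval) : Fin (n + 1) → unitInterval :=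
  -- The homotopy already takes values in the cube; the clamping only provides the type
  -- `unitInterval` without a proof of this.
  fun j => Set.projIcc (0 : ℝ) 1 zero_le_one
    ((1 - (p.2 : ℝ)) * p.1 j + p.2 * boxProj k i p.1 j)

theorem boxHeight_le (z : Fin (n + 1) → unitInterval) : boxHeight k i z ≤ 1 := by
  have h0 := (z i).2.1
  have h1 := (z i).2.2
  unfold boxHeight
  split_ifs <;> linarith

theorem boxHeight_nonneg (z : Fin (n + 1) → unitInterval) : 0 ≤ boxHeight k i z := by
  have h0 := (z i).2.1
  have h1 := (z i).2.2
  unfold boxHeight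
  split_ifs <;> linarith

theorem boxScale_pos (z : Fin (n + 1) → unitInterval) : 0 < boxScale k i z := by
  have := boxHeight_le k i z
  exact lt_max_of_lt_right (by linarith)

theorem norm_boxOffset_le (z : Fin (n + 1) → unitInterval) : ‖boxOffset i z‖ ≤ 1 / 2 := by
  refine (pi_norm_le_iff_of_nonneg (by norm_num)).2 fun j => ?_
  have h0 := (z j).2.1
  have h1 := (z j).2.2
  unfold boxOffset
  split_ifs
  · norm_num
  · rw [Real.norm_eq_abs, abs_le]
    constructor <;> linarith

/-- On a side wall the offset has sup norm 1/2, on the bottom the height is 0. One of the two terms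
of the maximum is then 1, and neither exceeds 1 on the cube. Hence the projection fixes all faces
other than `(k, i)`. -/
theorem boxScale_eq_one {z : Fin (n + 1) → unitInterval} {l : Bool} {m : Fin (n + 1)}
    (hlm : (l, m) ≠ (k, i)) (hz : z m = bit l) : boxScale k i z = 1 := by
  have h1 := norm_boxOffset_le i z
  have h2 := boxHeight_nonneg k i z
  refine le_antisymm (max_le (by linarith) (by linarith)) ?_
  by_cases hm : m = i
  · subst hm
    have hl : l = !k := by
      cases k <;> cases l <;> simp_all
    refine le_max_of_le_right ?_
    have : boxHeight k m z = 0 := by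
      unfold boxHeight
      rw [hz, hl]
      cases k <;> simp [bit]
    rw [this]; norm_num
  · refine le_max_of_le_left ?_
    have h3 : ‖boxOffset i z m‖ ≤ ‖boxOffset i z‖ := norm_le_pi_norm _ m
    have h4 : ‖boxOffset i z m‖ = 1 / 2 := by
      simp only [boxOffset, hm, if_false, hz]
      cases l
      · simp [bit]
      · simp only [bit, if_true, Set.Icc.coe_one]; norm_num
    linarith

theorem boxDeform_zero (z : Fin (n + 1) → unitInterval) : boxDeform k i (z, 0) = z := by
  funext j
  simp only [boxDeform, Set.Icc.coe_zero, sub_zero, one_mul, zero_mul, add_zero]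
  exact Set.projIcc_val zero_le_one (z j)

theorem boxDeform_of_mem {z : Fin (n + 1) → unitInterval} {l : Bool} {m : Fin (n + 1)}
    (hlm : (l, m) ≠ (k, i)) (hz : z m = bit l) (t : unitInterval) :
    boxDeform k i (z, t) = z := by
  funext j
  have h : boxProj k i z j = z j := by
    unfold boxProj
    rw [boxScale_eq_one k i hlm hz]
    by_cases hj : j = i
    · subst hj
      cases k <;> simp [boxHeight]
    · simp [hj, boxOffset]
  have h' : (1 - (t : ℝ)) * z j + t * z j = z j := by ring
  simp only [boxDeform, h, h']
  exact Set.projIcc_val zero_le_one (z j)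

/-- The term attaining the maximum in `boxScale` tells where the ray leaves the cube: through the
wall where the offset is largest in absolute value, or through the bottom. -/
theorem exists_boxDeform_one (z : Fin (n + 1) → unitInterval) :
    ∃ (l : Bool) (m : Fin (n + 1)), (l, m) ≠ (k, i) ∧ boxDeform k i (z, 1) m = bit l := by
  have hpos := boxScale_pos k i z
  have hval : ∀ j, boxDeform k i (z, 1) j =
      Set.projIcc (0 : ℝ) 1 zero_le_one (boxProj k i z j) := fun j => by
    simp [boxDeform]
  rcases max_choice (2 * ‖boxOffset i z‖) ((2 - boxHeight k i z) / 2) with h | h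
  · change boxScale k i z = _ at h
    obtain ⟨m, hm⟩ : ∃ m, ‖boxOffset i z m‖ = ‖boxOffset i z‖ := by
      obtain ⟨m, -, hm⟩ := Finset.exists_max_image Finset.univ (fun m => ‖boxOffset i z m‖)
        Finset.univ_nonempty
      exact ⟨m, le_antisymm (norm_le_pi_norm _ m)
        ((pi_norm_le_iff_of_nonneg (norm_nonneg _)).2 fun j => hm j (Finset.mem_univ j))⟩
    have hmi : m ≠ i := by
      rintro rfl
      simp only [boxOffset, if_true, norm_zero] at hm
      rw [h, ← hm] at hpos
      simp at hpos
    have hv : boxProj k i z m = boxOffset i z m / boxScale k i z + 1 / 2 := by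
      simp [boxProj, hmi]
    rw [← hm, Real.norm_eq_abs] at h
    rcases abs_choice (boxOffset i z m) with h' | h'
    · refine ⟨true, m, by simp [hmi], ?_⟩
      have e : boxProj k i z m = 1 := by
        rw [hv]
        rw [h'] at h
        rw [h] at hpos ⊢
        have : boxOffset i z m ≠ 0 := by rintro h0; rw [h0] at hpos; simp at hpos
        field_simp
        norm_num
      rw [hval, e]
      simp [bit]
    · refine ⟨false, m, by simp [hmi], ?_⟩
      have e : boxProj k i z m = 0 := by
        rw [hv]
        rw [h'] at h
        rw [h] at hpos ⊢
        have : boxOffset i z m ≠ 0 := by rintro h0; rw [h0] at hpos; simp at hpos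
        field_simp
        norm_num
      rw [hval, e]
      simp [bit]
  · change boxScale k i z = _ at h
    refine ⟨!k, i, by simp, ?_⟩
    have h2 : 2 - boxHeight k i z ≠ 0 := by
      have := boxHeight_le k i z
      linarith
    have e : (2 - boxHeight k i z) / boxScale k i z = 2 := by
      rw [h]
      field_simp
    rw [hval]
    simp only [boxProj, if_true, e]
    cases k <;> simp [bit]

theorem continuous_boxDeform : Continuous (boxDeform k i) := by
  have hz : ∀ j : Fin (n + 1), Continuous fun z : Fin (n + 1) → unitInterval => (z j : ℝ) :=
    fun j => continuous_subtype_val.comp (continuous_apply j)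
  have hh : Continuous (boxHeight k i) := by
    unfold boxHeight
    cases k
    · simp only [Bool.false_eq_true, if_false]
      exact continuous_const.sub (hz i)
    · simpa using hz i
  have ho : Continuous (boxOffset i) := by
    refine continuous_pi fun j => ?_
    unfold boxOffset
    split_ifs
    · exact continuous_const
    · exact (hz j).sub continuous_const
  have hs : Continuous (boxScale k i) :=
    (continuous_const.mul ho.norm).max ((continuous_const.sub hh).div_const 2)
  have hp : ∀ j, Continuous fun z => boxProj k i z j := by
    intro j
    have hd : Continuous fun z => (2 - boxHeight k i z) / boxScale k i z :=
      (continuous_const.sub hh).div hs fun z => (boxScale_pos k i z).ne'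
    unfold boxProj
    split_ifs
    · exact continuous_const.sub hd
    · exact continuous_const.sub (continuous_const.sub hd)
    · exact (((continuous_apply j).comp ho).div hs fun z => (boxScale_pos k i z).ne').add
        continuous_const
  refine continuous_pi fun j => continuous_projIcc.comp ?_
  have ht : Continuous fun p : (Fin (n + 1) → unitInterval) × unitInterval => (p.2 : ℝ) :=
    continuous_subtype_val.comp continuous_snd
  exact ((continuous_const.sub ht).mul ((hz j).comp continuous_fst)).add
    (ht.mul ((hp j).comp continuous_fst))

end Cube

/-! ### Elementary collapses -/

/-- `T` arises from (the image of) `S` by adding a cube `x` together with its face `d^k_i x`. -/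
structure Hom.IsCollapse {S : PrecubicalSet.{u}} {T : PrecubicalSet.{v}} (j : Hom S T) {n : ℕ}
    (x : T.cube (n + 1)) (k : Bool) (i : Fin (n + 1)) : Prop where
  inj : j.IsInjective
  map_ne : ∀ s, j.map s ≠ x
  map_ne_face : ∀ s, j.map s ≠ T.face k i x
  cover : ∀ (m : ℕ) (y : T.cube m), (∃ s, j.map s = y) ∨ (⟨m, y⟩ : T.Cubes) = ⟨n + 1, x⟩ ∨
    (⟨m, y⟩ : T.Cubes) = ⟨n, T.face k i x⟩
  face_ne : ∀ l m, (l, m) ≠ (k, i) → T.face l m x ≠ T.face k i x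

namespace Hom.IsCollapse

variable {S : PrecubicalSet.{u}} {T : PrecubicalSet.{v}} {j : Hom S T} {n : ℕ}
    {x : T.cube (n + 1)} {k : Bool} {i : Fin (n + 1)}

theorem exists_map_eq_face (h : j.IsCollapse x k i) {l : Bool} {m : Fin (n + 1)}
    (hlm : (l, m) ≠ (k, i)) : ∃ s, j.map s = T.face l m x := by
  rcases h.cover _ (T.face l m x) with h1 | h1 | h1
  · exact h1
  · simp at h1
  · exact absurd (eq_of_heq (Sigma.mk.inj h1).2) (h.face_ne l m hlm)

theorem exists_map_eq_of_lt (h : j.IsCollapse x k i) {m : ℕ} (hm : m < n) (y : T.cube m) :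
    ∃ s, j.map s = y := by
  rcases h.cover _ y with h1 | h1 | h1
  · exact h1
  · exact absurd (Sigma.mk.inj h1).1 (by omega)
  · exact absurd (Sigma.mk.inj h1).1 (by omega)

/-- The homotopy is prescribed on each cube: constant on the image of `j`, `boxDeform` on `x`, and
its restriction on the free face. The three cases exclude each other. Stating the last two by
equalities of points in the disjoint union avoids transport along equalities of degrees. -/
theorem exists_cube_deformation (h : j.IsCollapse x k i) (c : T.Cubes) :
    ∃ H : C((Fin c.1 → unitInterval) × unitInterval, T.Realization),
      ((∃ s, j.map s = c.2) → ∀ z t, H (z, t) = T.point c.2 z) ∧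
      (∀ z z' t, (⟨c, z⟩ : T.PreRealization) = ⟨⟨n + 1, x⟩, z'⟩ →
        H (z, t) = T.point x (boxDeform k i (z', t))) ∧
      (∀ z z' t, (⟨c, z⟩ : T.PreRealization) = ⟨⟨n, T.face k i x⟩, z'⟩ → H (z, t) =
        T.point x (boxDeform k i (Fin.insertNth (α := fun _ => unitInterval) i (bit k) z', t))) := by
  obtain ⟨m, y⟩ := c
  rcases h.cover m y with ⟨s, rfl⟩ | h1 | h1
  · refine ⟨⟨fun p => T.point (j.map s) p.1, (T.continuous_point _).comp continuous_fst⟩,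
      fun _ _ _ => rfl, fun z z' t e => ?_, fun z z' t e => ?_⟩
    · simp only [Sigma.mk.injEq] at e
      obtain ⟨⟨rfl, e⟩, -⟩ := e
      exact absurd (eq_of_heq e) (h.map_ne s)
    · simp only [Sigma.mk.injEq] at e
      obtain ⟨⟨rfl, e⟩, -⟩ := e
      exact absurd (eq_of_heq e) (h.map_ne_face s)
  · obtain ⟨rfl, h1⟩ := Sigma.mk.inj h1
    obtain rfl := eq_of_heq h1
    refine ⟨⟨fun p => T.point y (boxDeform k i p),
      (T.continuous_point _).comp (continuous_boxDeform k i)⟩, fun ⟨s, hs⟩ => absurd hs (h.map_ne s),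
      fun z z' t e => ?_, fun z z' t e => ?_⟩
    · simp only [Sigma.mk.injEq] at e
      obtain ⟨-, e⟩ := e
      obtain rfl := eq_of_heq e
      rfl
    · simp at e
  · obtain ⟨rfl, h1⟩ := Sigma.mk.inj h1
    obtain rfl := eq_of_heq h1
    refine ⟨⟨fun p => T.point x
        (boxDeform k i (Fin.insertNth (α := fun _ => unitInterval) i (bit k) p.1, p.2)),
      (T.continuous_point _).comp ((continuous_boxDeform k i).comp
        (((continuous_insertNth_right i (bit k)).comp continuous_fst).prodMk continuous_snd))⟩,
      fun ⟨s, hs⟩ => absurd hs (h.map_ne_face s), fun z z' t e => ?_, fun z z' t e => ?_⟩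
    · simp at e
    · simp only [Sigma.mk.injEq] at e
      obtain ⟨-, e⟩ := e
      obtain rfl := eq_of_heq e
      rfl

theorem exists_deformation (h : j.IsCollapse x k i) :
    ∃ H : C(T.Realization × unitInterval, T.Realization),
      (∀ p, H (p, 0) = p) ∧ (∀ q t, H (j.realize q, t) = j.realize q) ∧
      ∀ p, H (p, 1) ∈ Set.range j.realize := by
  choose H H1 H2 H3 using h.exists_cube_deformation
  -- Compatibility with the face relations, according to whether the larger cube comes from `S`, is
  -- `x`, or is the free face. On the other faces of `x` the deformation is constant, as it is on
  -- `S`.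
  have hglue : ∀ p q : T.PreRealization, T.Glue p q → (H p.1).curry p.2 = (H q.1).curry q.2 := by
    rintro _ _ ⟨l, m, y, z⟩
    ext t
    rename_i n'
    simp only [ContinuousMap.curry_apply]
    change H ⟨n', T.face l m y⟩ (z, t) = H ⟨n' + 1, y⟩
      (Fin.insertNth (α := fun _ => unitInterval) m (bit l) z, t)
    rcases h.cover _ y with ⟨s, rfl⟩ | h1 | h1
    · rw [H1 ⟨n', _⟩ ⟨S.face l m s, j.map_face l m s⟩, H1 ⟨n' + 1, _⟩ ⟨s, rfl⟩]
      simp only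
      rw [T.point_face l m (j.map s) _ (by simp)]
      simp
    · obtain ⟨h0, h1⟩ := Sigma.mk.inj h1
      obtain rfl := Nat.succ.inj h0
      obtain rfl := eq_of_heq h1
      rw [H2 ⟨n' + 1, y⟩ _ _ t rfl]
      by_cases hlm : (l, m) = (k, i)
      · obtain ⟨rfl, rfl⟩ := Prod.mk.inj hlm
        rw [H3 ⟨n', _⟩ _ _ t rfl]
      · rw [H1 ⟨n', _⟩ (h.exists_map_eq_face hlm),
          boxDeform_of_mem k i hlm (by simp), T.point_face l m y _ (by simp)]
        simp
    · obtain ⟨rfl, h1⟩ := Sigma.mk.inj h1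
      obtain rfl := eq_of_heq h1
      -- A proper face of the free face lies in the image of `S`, and inside `x` it also lies on a
      -- face in another direction than `i`, where `boxDeform` is constant.
      have hne : i.succAbove m ≠ i := Fin.succAbove_ne i m
      rw [H3 ⟨n' + 1, _⟩ _ _ t rfl, H1 ⟨n', _⟩ (h.exists_map_eq_of_lt n'.lt_succ_self _),
        boxDeform_of_mem k i (l := l) (m := i.succAbove m) (by simp [hne]) (by simp),
        T.point_face k i x _ (by simp)]
      simp only [Fin.insertNth_apply_succAbove]
      rw [T.point_face l m _ _ (by simp)]
      simp
  -- Currying puts the time into the target, so the universal property of the quotient `|T|` applies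
  -- without treating `|T| × [0,1]` as a quotient.
  let F : C(T.Realization, C(unitInterval, T.Realization)) :=
    ⟨Quot.lift (fun p => (H p.1).curry p.2) hglue,
      continuous_quot_lift _ (continuous_sigma fun c => (H c).curry.continuous)⟩
  have hF : ∀ (m : ℕ) (y : T.cube m) z t, F.uncurry (T.point y z, t) = H ⟨m, y⟩ (z, t) :=
    fun _ _ _ _ => rfl
  refine ⟨F.uncurry, fun p => ?_, fun q t => ?_, fun p => ?_⟩
  · induction p using Realization.ind with
    | h m y z =>
    rw [hF]
    rcases h.cover _ y with h1 | h1 | h1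
    · rw [H1 ⟨m, y⟩ h1]
    · obtain ⟨rfl, h1⟩ := Sigma.mk.inj h1
      obtain rfl := eq_of_heq h1
      rw [H2 ⟨n + 1, y⟩ _ _ _ rfl, boxDeform_zero]
    · obtain ⟨rfl, h1⟩ := Sigma.mk.inj h1
      obtain rfl := eq_of_heq h1
      rw [H3 ⟨m, _⟩ _ _ _ rfl, boxDeform_zero, T.point_face k i x _ (by simp)]
      simp
  · induction q using Realization.ind with
    | h m s z =>
    rw [Hom.realize_point, hF, H1 ⟨m, j.map s⟩ ⟨s, rfl⟩]
  · have key : ∀ z, T.point x (boxDeform k i (z, 1)) ∈ Set.range j.realize := by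
      intro z
      obtain ⟨l, m, hlm, hz⟩ := exists_boxDeform_one k i z
      obtain ⟨s, hs⟩ := h.exists_map_eq_face hlm
      rw [T.point_face l m x _ hz, ← hs]
      exact ⟨S.point s _, rfl⟩
    induction p using Realization.ind with
    | h m y z =>
    rw [hF]
    rcases h.cover _ y with h1 | h1 | h1
    · rw [H1 ⟨m, y⟩ h1]
      obtain ⟨s, rfl⟩ := h1
      exact ⟨S.point s z, rfl⟩
    · obtain ⟨rfl, h1⟩ := Sigma.mk.inj h1
      obtain rfl := eq_of_heq h1
      rw [H2 ⟨n + 1, y⟩ _ _ _ rfl]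
      exact key _
    · obtain ⟨rfl, h1⟩ := Sigma.mk.inj h1
      obtain rfl := eq_of_heq h1
      rw [H3 ⟨m, _⟩ _ _ _ rfl]
      exact key _

/-- An elementary collapse realizes to a homotopy equivalence. -/
theorem exists_homotopyEquiv (h : j.IsCollapse x k i) :
    ∃ e : ContinuousMap.HomotopyEquiv S.Realization T.Realization, e.toFun = j.realize := by
  obtain ⟨H, H0, Hj, H1⟩ := h.exists_deformation
  choose r hr using H1
  -- The final map of the deformation factors through the embedding `j.realize`, which makes the
  -- factor continuous.
  have hcont : Continuous r := by
    rw [h.inj.isClosedEmbedding.isEmbedding.continuous_iff]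
    have : j.realize ∘ r = fun p => H (p, 1) := funext hr
    rw [this]
    exact H.continuous.comp (continuous_id.prodMk continuous_const)
  refine ⟨⟨j.realize, ⟨r, hcont⟩, ?_, ?_⟩, rfl⟩
  · have : (ContinuousMap.mk r hcont).comp j.realize = ContinuousMap.id _ := by
      ext q
      refine h.inj.realize ?_
      simp [hr, Hj]
    rw [this]
  · refine ContinuousMap.Homotopic.symm ⟨⟨⟨fun p => H (p.2, p.1), ?_⟩, fun p => ?_, fun p => ?_⟩⟩
    · exact H.continuous.comp (continuous_snd.prodMk continuous_fst)
    · simp [H0]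
    · simp [hr]

end Hom.IsCollapse

end PrecubicalSet

namespace PrecubicalSet

/-! ### Homology -/

section Homology

variable (R : Type w) [CommRing R]

theorem singularHomology_map_congr {X Y : Type u} [TopologicalSpace X] [TopologicalSpace Y]
    {f g : C(X, Y)} (h : f.Homotopic g) (n : ℕ) :
    (singularHomology.{u, w} R n).map (TopCat.ofHom f) =
      (singularHomology R n).map (TopCat.ofHom g) := by
  obtain ⟨H⟩ := h
  have H' : TopCat.Homotopy (TopCat.ofHom f) (TopCat.ofHom g) := H
  exact H'.congr_homologyMap_singularChainComplexFunctor
    (C := ModuleCat.{max w u} R) (ModuleCat.of R (ULift.{u} R)) n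

theorem homologyMap_congr {Q P : PrecubicalSet.{u}} {f g : C(Q.Realization, P.Realization)}
    (h : f.Homotopic g) (α : Q.HomologyClass R) : homologyMap R f α = homologyMap R g α := by
  unfold homologyMap
  rw [singularHomology_map_congr R h]

theorem homologyMap_id {P : PrecubicalSet.{u}} (α : P.HomologyClass R) :
    homologyMap R (ContinuousMap.id P.Realization) α = α := by
  unfold homologyMap
  have : TopCat.ofHom (ContinuousMap.id P.Realization) = 𝟙 (TopCat.of P.Realization) := rfl
  rw [this, CategoryTheory.Functor.map_id]
  rfl

theorem homologyMap_comp {S Q P : PrecubicalSet.{u}} (f : C(Q.Realization, P.Realization))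
    (g : C(S.Realization, Q.Realization)) (α : S.HomologyClass R) :
    homologyMap R (f.comp g) α = homologyMap R f (homologyMap R g α) := by
  unfold homologyMap
  rw [TopCat.ofHom_comp, Functor.map_comp]
  rfl

theorem homologyMap_bijective {Q P : PrecubicalSet.{u}}
    (e : ContinuousMap.HomotopyEquiv Q.Realization P.Realization) :
    Function.Bijective (homologyMap R e.toFun) := by
  refine Function.bijective_iff_has_inverse.2 ⟨homologyMap R e.invFun, fun α => ?_, fun α => ?_⟩
  · rw [← homologyMap_comp, homologyMap_congr R e.left_inv, homologyMap_id]
  · rw [← homologyMap_comp, homologyMap_congr R e.right_inv, homologyMap_id]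

theorem Hom.IsCollapse.homologyMap_bijective {S T : PrecubicalSet.{u}} {j : Hom S T} {n : ℕ}
    {x : T.cube (n + 1)} {k : Bool} {i : Fin (n + 1)} (h : j.IsCollapse x k i) :
    Function.Bijective (homologyMap R j.realize) := by
  obtain ⟨e, he⟩ := h.exists_homotopyEquiv
  rw [← he]
  exact PrecubicalSet.homologyMap_bijective R e

end Homology

/-! ### Precubical subsets -/

/-- Inclusion of precubical subsets. -/
def Sub.le {P : PrecubicalSet.{u}} (X Y : P.Sub) : Prop := ∀ n, X.carrier n ⊆ Y.carrier n

/-- The inclusion morphism between precubical subsets. -/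
def Sub.inclusion {P : PrecubicalSet.{u}} {X Y : P.Sub} (h : X.le Y) :
    Hom X.toPrecubicalSet Y.toPrecubicalSet where
  map {n} x := ⟨x.1, h n x.2⟩
  map_face _ _ _ := rfl

theorem Sub.incl_comp_inclusion {P : PrecubicalSet.{u}} {X Y : P.Sub} (h : X.le Y) :
    Y.incl.comp (Sub.inclusion h) = X.incl := rfl

/-- The homology classes that come from a precubical subset. -/
def Sub.classes {P : PrecubicalSet.{u}} (R : Type w) [CommRing R] (X : P.Sub) :
    Set (P.HomologyClass R) := Set.range (homologyMap R X.incl.realize)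

theorem Sub.classes_mono {P : PrecubicalSet.{u}} (R : Type w) [CommRing R] {X Y : P.Sub}
    (h : X.le Y) : X.classes R ⊆ Y.classes R := by
  rintro _ ⟨α, rfl⟩
  refine ⟨homologyMap R (Sub.inclusion h).realize α, ?_⟩
  rw [← homologyMap_comp, ← Hom.realize_comp, Sub.incl_comp_inclusion]

/-- `Y` arises from `X` by adding the cube `x` together with its face `d^k_i x`. -/
structure Sub.Collapses {P : PrecubicalSet.{u}} (Y X : P.Sub) {n : ℕ} (x : P.cube (n + 1))
    (k : Bool) (i : Fin (n + 1)) : Prop where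
  le : X.le Y
  mem : x ∈ Y.carrier (n + 1)
  notMem : x ∉ X.carrier (n + 1)
  notMem_face : P.face k i x ∉ X.carrier n
  cover : ∀ (m : ℕ), ∀ y ∈ Y.carrier m, y ∈ X.carrier m ∨ (⟨m, y⟩ : P.Cubes) = ⟨n + 1, x⟩ ∨
    (⟨m, y⟩ : P.Cubes) = ⟨n, P.face k i x⟩
  face_ne : ∀ l m, (l, m) ≠ (k, i) → P.face l m x ≠ P.face k i x

theorem Sub.Collapses.isCollapse {P : PrecubicalSet.{u}} {Y X : P.Sub} {n : ℕ}
    {x : P.cube (n + 1)} {k : Bool} {i : Fin (n + 1)} (h : Y.Collapses X x k i) :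
    (Sub.inclusion h.le).IsCollapse (⟨x, h.mem⟩ : Y.toPrecubicalSet.cube (n + 1)) k i where
  inj _ a b e := by
    have e' : a.1 = b.1 := congrArg (fun y : Y.toPrecubicalSet.cube _ => y.1) e
    exact Subtype.ext e'
  map_ne s e := by
    have e' : s.1 = x := congrArg Subtype.val e
    exact h.notMem (e' ▸ s.2)
  map_ne_face s e := by
    have e' : s.1 = P.face k i x := congrArg Subtype.val e
    exact h.notMem_face (e' ▸ s.2)
  cover m y := by
    rcases h.cover m y.1 y.2 with h1 | h1 | h1
    · exact .inl ⟨⟨y.1, h1⟩, rfl⟩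
    · obtain ⟨rfl, h1⟩ := Sigma.mk.inj h1
      have : y = ⟨x, h.mem⟩ := Subtype.ext (eq_of_heq h1)
      exact .inr (.inl (this ▸ rfl))
    · obtain ⟨rfl, h1⟩ := Sigma.mk.inj h1
      refine .inr (.inr ?_)
      have : y = Y.toPrecubicalSet.face k i ⟨x, h.mem⟩ := Subtype.ext (eq_of_heq h1)
      rw [this]
  face_ne l m hlm e := h.face_ne l m hlm (congrArg Subtype.val e)

/-- The inclusion of `X` in `Y` is a homotopy equivalence, so every homology class of `|Y|` already
comes from `|X|`. -/
theorem Sub.Collapses.classes_eq {P : PrecubicalSet.{u}} {Y X : P.Sub} {n : ℕ}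
    {x : P.cube (n + 1)} {k : Bool} {i : Fin (n + 1)} (h : Y.Collapses X x k i) (R : Type w)
    [CommRing R] : Y.classes R = X.classes R := by
  refine Set.Subset.antisymm ?_ (Sub.classes_mono R h.le)
  rintro _ ⟨α, rfl⟩
  obtain ⟨β, rfl⟩ := (h.isCollapse.homologyMap_bijective R).2 α
  refine ⟨β, ?_⟩
  rw [← homologyMap_comp, ← Hom.realize_comp, Sub.incl_comp_inclusion]

/-- The intersection of `X` with `Q`, as a precubical subset of `Q`. -/
def Sub.comap {P : PrecubicalSet.{u}} (Q X : P.Sub) : Q.toPrecubicalSet.Sub where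
  carrier n := {y | y.1 ∈ X.carrier n}
  face_mem k i y h := X.face_mem k i y.1 h

/-- The image in `P` of a precubical subset of `Q ⊆ P`. -/
def Sub.image {P : PrecubicalSet.{u}} {Q : P.Sub} (X : Q.toPrecubicalSet.Sub) : P.Sub where
  carrier n := {y | ∃ h : y ∈ Q.carrier n, (⟨y, h⟩ : Q.toPrecubicalSet.cube n) ∈ X.carrier n}
  face_mem k i y h := ⟨Q.face_mem k i y h.1, X.face_mem k i _ h.2⟩

/-- A class of `|X|` with the right image in `|P|` has an image in `|Q|` that can differ from `α`
only by the kernel of the inclusion, and injectivity excludes this. -/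
theorem Sub.mem_classes_comap {P : PrecubicalSet.{u}} {Q X : P.Sub} (h : X.le Q) (R : Type w)
    [CommRing R] (hQ : Function.Injective (homologyMap R Q.incl.realize))
    {α : Q.toPrecubicalSet.HomologyClass R}
    (hα : homologyMap R Q.incl.realize α ∈ X.classes R) : α ∈ (Q.comap X).classes R := by
  obtain ⟨β, hβ⟩ := hα
  let g : Hom X.toPrecubicalSet (Q.comap X).toPrecubicalSet :=
    { map := fun {n} x => ⟨⟨x.1, h n x.2⟩, x.2⟩
      map_face := fun _ _ _ => rfl }
  refine ⟨homologyMap R g.realize β, hQ ?_⟩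
  rw [← homologyMap_comp, ← homologyMap_comp, ← Hom.realize_comp, ← Hom.realize_comp, ← hβ]
  rfl

theorem Sub.mem_classes_image {P : PrecubicalSet.{u}} {Q : P.Sub} {X : Q.toPrecubicalSet.Sub}
    (R : Type w) [CommRing R] {α : Q.toPrecubicalSet.HomologyClass R} (hα : α ∈ X.classes R) :
    homologyMap R Q.incl.realize α ∈ (Sub.image X).classes R := by
  obtain ⟨β, rfl⟩ := hα
  let g : Hom X.toPrecubicalSet (Sub.image X).toPrecubicalSet :=
    { map := fun {n} x => ⟨x.1.1, x.1.2, x.2⟩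
      map_face := fun _ _ _ => rfl }
  refine ⟨homologyMap R g.realize β, ?_⟩
  rw [← homologyMap_comp, ← homologyMap_comp, ← Hom.realize_comp, ← Hom.realize_comp]
  rfl

end PrecubicalSet

namespace PrecubicalSet

/-! ### Reachability -/

/-- There is an edge from `a` to `b` (`k = 1`) or from `b` to `a` (`k = 0`). -/
def StepTo (P : PrecubicalSet.{u}) (k : Bool) (a b : P.cube 0) : Prop :=
  ∃ e : P.cube 1, P.face (!k) 0 e = a ∧ P.face k 0 e = b

/-- There is a path from `a` to `b` (`k = 1`) or from `b` to `a` (`k = 0`). -/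
abbrev ReachesTo (P : PrecubicalSet.{u}) (k : Bool) : P.cube 0 → P.cube 0 → Prop :=
  Relation.ReflTransGen (P.StepTo k)

theorem BoxCell.dir_eq_zero {k m : ℕ} (c : BoxCell (fun _ : Fin 1 => k) m) (a : Fin m) :
    c.dir a = 0 := Subsingleton.elim _ _

theorem BoxCell.degree_le_one {k m : ℕ} (c : BoxCell (fun _ : Fin 1 => k) (m + 2)) : False := by
  have := c.dir.injective ((c.dir_eq_zero 0).trans (c.dir_eq_zero 1).symm)
  simp at this

/-- The path with given vertices and edges. -/
def PathOfLength.ofEdges {P : PrecubicalSet.{u}} {k : ℕ} (V : ℕ → P.cube 0)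
    (E : ∀ j < k, P.cube 1) (h0 : ∀ j hj, P.face false 0 (E j hj) = V j)
    (h1 : ∀ j hj, P.face true 0 (E j hj) = V (j + 1)) : P.PathOfLength k where
  map {m} c := match m, c with
    | 0, c => V (c.base 0)
    | 1, c => E (c.base 0) (by have := c.base_dir_lt 0; rwa [c.dir_eq_zero] at this)
    | _ + 2, c => (BoxCell.degree_le_one c).elim
  map_face {m} b i c := by
    match m, i, c with
    | 0, i, c =>
      obtain rfl : i = 0 := Subsingleton.elim (α := Fin 1) i 0
      have e : ((interval k).face b 0 c).base 0 = c.base 0 + b.toNat := by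
        change Function.update c.base (c.dir 0) _ 0 = _
        rw [c.dir_eq_zero 0, Function.update_self]
      change V (((interval k).face b 0 c).base 0) = _
      rw [e]
      cases b
      · exact (h0 _ _).symm
      · exact (h1 _ _).symm
    | m + 1, i, c => exact (BoxCell.degree_le_one c).elim

theorem PathOfLength.face_edge_false {P : PrecubicalSet.{u}} {k : ℕ} (ω : P.PathOfLength k)
    (j : ℕ) (hj : j < k) : P.face false 0 (ω.edge j hj) = ω.vertex j hj.le :=
  (ω.map_face false 0 _).symm.trans (congrArg _ (interval.face_edge_false j hj))

theorem PathOfLength.face_edge_true {P : PrecubicalSet.{u}} {k : ℕ} (ω : P.PathOfLength k)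
    (j : ℕ) (hj : j < k) : P.face true 0 (ω.edge j hj) = ω.vertex (j + 1) hj :=
  (ω.map_face true 0 _).symm.trans (congrArg _ (interval.face_edge_true j hj))

theorem exists_sequence_of_reflTransGen {α : Type u} {r : α → α → Prop} {a b : α}
    (h : Relation.ReflTransGen r a b) :
    ∃ (k : ℕ) (V : ℕ → α), V 0 = a ∧ V k = b ∧ ∀ j < k, r (V j) (V (j + 1)) := by
  induction h with
  | refl => exact ⟨0, fun _ => a, rfl, rfl, by simp⟩
  | tail _ h ih =>
    rename_i b c _
    obtain ⟨k, V, h0, hk, hV⟩ := ih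
    refine ⟨k + 1, fun j => if j ≤ k then V j else c, by simp [h0], by simp, fun j hj => ?_⟩
    rcases Nat.lt_succ_iff_lt_or_eq.1 hj with hj | rfl
    · simpa [hj.le, Nat.succ_le_of_lt hj] using hV j hj
    · simpa [hk] using h

theorem reaches_iff {P : PrecubicalSet.{u}} {a b : P.cube 0} :
    P.Reaches a b ↔ P.ReachesTo true a b := by
  constructor
  · rintro ⟨k, ω, rfl, rfl⟩
    have : ∀ j hj, P.ReachesTo true ω.source (ω.vertex j hj) := by
      intro j
      induction j with
      | zero => exact fun _ => .refl
      | succ j ih =>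
        exact fun hj => (ih (Nat.le_of_succ_le hj)).tail
          ⟨ω.edge j hj, ω.face_edge_false j hj, ω.face_edge_true j hj⟩
    exact this k le_rfl
  · intro h
    obtain ⟨k, V, h0, hk, hV⟩ := exists_sequence_of_reflTransGen h
    choose E hE using hV
    exact ⟨k, .ofEdges V E (fun j hj => (hE j hj).1) (fun j hj => (hE j hj).2), h0, hk⟩

/-- The parameter `k` of `StepTo` is the direction of travel. It lets both kinds of free faces share
the arguments on reachability, with reversal applied only at the end. -/
theorem reachesTo_false_iff {P : PrecubicalSet.{u}} {a b : P.cube 0} :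
    P.ReachesTo false a b ↔ P.ReachesTo true b a := by
  unfold ReachesTo
  rw [← Relation.reflTransGen_swap]
  have : P.StepTo true = Function.swap (P.StepTo false) := by
    funext a b
    simp [StepTo, Function.swap, and_comm]
  rw [this]

/-- There is an edge of `Q` from `a` to `b` (`k = 1`) or from `b` to `a` (`k = 0`). -/
def Sub.StepTo {P : PrecubicalSet.{u}} (Q : P.Sub) (k : Bool) (a b : P.cube 0) : Prop :=
  ∃ e ∈ Q.carrier 1, P.face (!k) 0 e = a ∧ P.face k 0 e = b

/-- There is a path in `Q` from `a` to `b` (`k = 1`) or from `b` to `a` (`k = 0`). -/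
abbrev Sub.ReachesTo {P : PrecubicalSet.{u}} (Q : P.Sub) (k : Bool) :
    P.cube 0 → P.cube 0 → Prop :=
  Relation.ReflTransGen (Q.StepTo k)

theorem Sub.reachesTo_iff {P : PrecubicalSet.{u}} {Q : P.Sub} {k : Bool}
    {a b : Q.toPrecubicalSet.cube 0} :
    Q.toPrecubicalSet.ReachesTo k a b ↔ Q.ReachesTo k a.1 b.1 := by
  constructor
  · intro h
    refine Relation.ReflTransGen.lift (fun a : Q.toPrecubicalSet.cube 0 => a.1) ?_ _ _ h
    rintro a b ⟨e, rfl, rfl⟩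
    exact ⟨e.1, e.2, rfl, rfl⟩
  · intro h
    obtain ⟨b, hb⟩ := b
    simp only at h
    induction h with
    | refl => exact .refl
    | tail _ h ih =>
      obtain ⟨e, he, rfl, rfl⟩ := h
      exact (ih (Q.face_mem _ _ _ he)).tail ⟨⟨e, he⟩, rfl, rfl⟩

theorem Sub.ReachesTo.of_sub {P : PrecubicalSet.{u}} {Q : P.Sub} {k : Bool} {a b : P.cube 0}
    (h : Q.ReachesTo k a b) : P.ReachesTo k a b :=
  Relation.ReflTransGen.mono (fun _ _ ⟨e, _, h⟩ => ⟨e, h⟩) _ _ h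

/-! ### Corners and edges of a cube -/

theorem corner_face (P : PrecubicalSet.{u}) (b : Bool) : ∀ {n : ℕ} (i : Fin (n + 1))
    (z : P.cube (n + 1)), P.corner b (P.face b i z) = P.corner b z
  | 0, i, z => by rw [Subsingleton.elim (α := Fin 1) i 0]; rfl
  | n + 1, i, z => by
    refine Fin.cases rfl (fun i => ?_) i
    have h := P.face_face b b 0 i (Fin.zero_le i) z
    change P.corner b (P.face b 0 (P.face b i.succ z)) = P.corner b (P.face b 0 z)
    rw [h, corner_face]
    rfl

/-- All faces defining the edge are of type `1 - k` and avoid the direction `i`. Its end vertices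
are thus corners of `x` and of `d^k_i x`, independently of the order in which faces are taken
(`corner_face`). -/
theorem edge_spec (P : PrecubicalSet.{u}) (k : Bool) : ∀ {n : ℕ} (i : Fin (n + 1))
    (z : P.cube (n + 1)), P.face (!k) 0 (P.edge k i z) = P.corner (!k) z ∧
      P.face k 0 (P.edge k i z) = P.corner (!k) (P.face k i z)
  | 0, i, z => by rw [Subsingleton.elim (α := Fin 1) i 0]; exact ⟨rfl, rfl⟩
  | n + 1, i, z => by
    rw [edge]
    split_ifs with h
    · subst h
      obtain ⟨h1, h2⟩ := edge_spec P k (Fin.last n) (P.face (!k) (Fin.last n).castSucc z)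
      refine ⟨h1.trans (P.corner_face _ _ _), h2.trans ?_⟩
      rw [← P.face_face (!k) k _ _ le_rfl, corner_face, Fin.succ_last]
    · obtain ⟨i, rfl⟩ := Fin.exists_castSucc_eq.2 h
      obtain ⟨h1, h2⟩ := edge_spec P k i (P.face (!k) (Fin.last (n + 1)) z)
      refine ⟨h1.trans (P.corner_face _ _ _), h2.trans ?_⟩
      rw [← Fin.succ_last, P.face_face k (!k) _ _ (Fin.le_last i), corner_face]

theorem IsFace.trans {P : PrecubicalSet.{u}} {l m n : ℕ} {a : P.cube l} {b : P.cube m}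
    {c : P.cube n} (hab : IsFace P a b) (hbc : IsFace P b c) : IsFace P a c := by
  induction hbc with
  | refl x => exact hab
  | step z k i y _ ih => exact .step _ k i y (ih hab)

theorem IsFace.face {P : PrecubicalSet.{u}} {m n : ℕ} {a : P.cube (m + 1)} {b : P.cube n}
    (h : IsFace P a b) (k : Bool) (i : Fin (m + 1)) : IsFace P (P.face k i a) b :=
  (IsFace.step _ k i a (.refl _)).trans h

theorem isFace_corner (P : PrecubicalSet.{u}) (b : Bool) : ∀ {n : ℕ} (z : P.cube n),
    IsFace P (P.corner b z) z
  | 0, z => .refl z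
  | _ + 1, z => .step _ b 0 z (isFace_corner P b _)

theorem IsFace.degree_le {P : PrecubicalSet.{u}} {m n : ℕ} {a : P.cube m} {b : P.cube n}
    (h : IsFace P a b) : m ≤ n := by
  induction h with
  | refl x => exact le_rfl
  | step z k i y _ ih => omega

theorem IsFace.eq_of_degree {P : PrecubicalSet.{u}} {n : ℕ} {a b : P.cube n}
    (h : IsFace P a b) : a = b := by
  cases h with
  | refl => rfl
  | step _ k i y h => exact absurd h.degree_le (by omega)

theorem IsFace.mem {P : PrecubicalSet.{u}} (X : P.Sub) {m n : ℕ} {a : P.cube m} {b : P.cube n}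
    (h : IsFace P a b) : b ∈ X.carrier n → a ∈ X.carrier m := by
  induction h with
  | refl x => exact id
  | step z k i y _ ih => exact fun hy => ih (X.face_mem k i y hy)

theorem mem_star_iff {P : PrecubicalSet.{u}} {m n : ℕ} {a : P.cube m} {b : P.cube n} :
    (⟨n, b⟩ : P.Cubes) ∈ P.star a ↔ IsFace P a b := by
  constructor
  · rintro ⟨c, rfl⟩
    exact isFace_along P _ _ _
  · exact fun h => exists_map_eq_of_isFace (P.sharp b) h ⟨_, P.sharp_top b⟩

/-- Passing to a face of type `l` keeps the corner of type `l`, and moves the opposite corner along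
one edge of the cube. -/
theorem IsFace.reachesTo {P : PrecubicalSet.{u}} (k : Bool) {m n : ℕ} {a : P.cube m}
    {z : P.cube n} (h : IsFace P a z) : P.ReachesTo k (P.corner (!k) z) (P.corner (!k) a) ∧
      P.ReachesTo k (P.corner k a) (P.corner k z) := by
  induction h with
  | refl x => exact ⟨.refl, .refl⟩
  | step a l i y _ ih =>
    obtain ⟨h1, h2⟩ := ih
    by_cases hl : l = k
    · subst hl
      rw [corner_face] at h2
      exact ⟨.head ⟨P.edge l i y, P.edge_spec l i y⟩ h1, h2⟩
    · obtain rfl : l = !k := by cases l <;> cases k <;> simp_all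
      rw [corner_face] at h1
      refine ⟨h1, h2.tail ⟨P.edge (!k) i y, ?_, ?_⟩⟩
      · simpa using (P.edge_spec (!k) i y).2
      · simpa using (P.edge_spec (!k) i y).1

theorem Hom.map_corner {P : PrecubicalSet.{u}} {Q : PrecubicalSet.{v}} (g : Hom P Q) (b : Bool) :
    ∀ {n : ℕ} (z : P.cube n), g.map (P.corner b z) = Q.corner b (g.map z)
  | 0, _ => rfl
  | _ + 1, z => by
    rw [corner, map_corner g b, g.map_face]
    rfl

theorem box_corner_base {N : ℕ} {K : Fin N → ℕ} (b : Bool) (j : Fin N) :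
    ∀ {n : ℕ} (z : (box K).cube n), (∀ a, BoxCell.dir z a ≠ j) →
      BoxCell.base ((box K).corner b z) j = BoxCell.base z j
  | 0, _, _ => rfl
  | _ + 1, z, h => by
    exact (box_corner_base b j ((box K).face b 0 z) (fun a => h _)).trans
      (Function.update_of_ne (h 0).symm _ _)

/-- The two corners are images under `x_♯` of vertices of the standard cube that differ in the
coordinate `i`. -/
theorem IsRegular.corner_ne {P : PrecubicalSet.{u}} {n : ℕ} {x : P.cube (n + 1)}
    (hx : P.IsRegular x) (k : Bool) (i : Fin (n + 1)) :
    P.corner (!k) x ≠ P.corner (!k) (P.face k i x) := by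
  intro h
  have key : ∀ l, BoxCell.base ((stdCube (n + 1)).corner (!k)
      ((stdCube (n + 1)).face l i (stdCube.top (n + 1)))) i = l.toNat := by
    intro l
    rw [box_corner_base]
    · change Function.update _ i _ i = _
      rw [Function.update_self]
      simp [stdCube.top]
    · exact fun a => Fin.succAbove_ne i a
  rw [← P.corner_face (!k) i x] at h
  have h' : (P.sharp x).map ((stdCube (n + 1)).corner (!k)
      ((stdCube (n + 1)).face (!k) i (stdCube.top (n + 1)))) = (P.sharp x).map
      ((stdCube (n + 1)).corner (!k) ((stdCube (n + 1)).face k i (stdCube.top (n + 1)))) := by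
    rw [Hom.map_corner, Hom.map_corner, Hom.map_face, Hom.map_face, sharp_top]
    exact h
  have h'' := congrArg (fun c => BoxCell.base c i) (hx 0 h')
  simp only [key] at h''
  cases k <;> simp at h''

theorem IsRegular.face_ne {P : PrecubicalSet.{u}} {n : ℕ} {x : P.cube (n + 1)}
    (hx : P.IsRegular x) {k l : Bool} {i m : Fin (n + 1)} (h : (l, m) ≠ (k, i)) :
    P.face l m x ≠ P.face k i x := by
  intro e
  have h' : (P.sharp x).map ((stdCube (n + 1)).face l m (stdCube.top (n + 1))) =
      (P.sharp x).map ((stdCube (n + 1)).face k i (stdCube.top (n + 1))) := by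
    rw [Hom.map_face, Hom.map_face, sharp_top]
    exact e
  have h'' := hx n h'
  have hm : m = i := by
    have := congrArg (fun c => BoxCell.dir c) h''
    have h3 : ∀ a, m.succAbove a = i.succAbove a := fun a => DFunLike.congr_fun this a
    exact Fin.succAbove_left_injective (funext h3)
  subst hm
  have h4 : Function.update (fun _ => 0) m (0 + l.toNat) m =
      Function.update (fun _ : Fin (n + 1) => 0) m (0 + k.toNat) m :=
    congrFun (congrArg (fun c => BoxCell.base c) h'') m
  simp only [Function.update_self] at h4
  cases k <;> cases l <;> simp_all

/-- Both faces of type `k` of the standard square lie in the same half-open square, where `z_♯` is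
injective. This is the form in which weak regularity enters the proof: two edges of a square at its
last (first) vertex are distinct. -/
theorem IsWeaklyRegular.face_ne {P : PrecubicalSet.{u}} (hP : P.IsWeaklyRegular) (k : Bool)
    (z : P.cube 2) : P.face k 0 z ≠ P.face k 1 z := by
  intro e
  have h' : (P.sharp z).map ((stdCube 2).face k 0 (stdCube.top 2)) =
      (P.sharp z).map ((stdCube 2).face k 1 (stdCube.top 2)) := by
    rw [Hom.map_face, Hom.map_face, sharp_top]
    exact e
  have hmem : ∀ i : Fin 2, (stdCube 2).face k i (stdCube.top 2) ∈ halfOpenCube 2 k 1 := by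
    intro i j hj
    have : j = i := by
      by_contra hji
      obtain ⟨a, ha⟩ := Fin.exists_succAbove_eq hji
      exact hj ⟨a, ha⟩
    subst this
    change Function.update (fun _ => 0) j (0 + k.toNat) j = _
    simp
  have h'' := hP 2 z k 1 (hmem 0) (hmem 1) h'
  have := congrArg (fun c => BoxCell.dir c 0) h''
  have h3 : (0 : Fin 2).succAbove (0 : Fin 1) = (1 : Fin 2).succAbove (0 : Fin 1) := this
  exact absurd h3 (by decide)

end PrecubicalSet

/-! ### Free faces of regular cubes: reachability in the complement of the star. -/

namespace PrecubicalSet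

/-- A regular cube `x` with a free face `d^k_i x` of positive degree, such that the edge `e^k_i x`
is the only edge `y` with `d^k_1 y = d_1^{1-k} ⋯ d_1^{1-k} d^k_i x`. -/
structure IsFreeCube (P : PrecubicalSet.{u}) {n : ℕ} (x : P.cube (n + 1)) (k : Bool)
    (i : Fin (n + 1)) : Prop where
  pos : 1 ≤ n
  weaklyRegular : P.IsWeaklyRegular
  regular : P.IsRegular x
  free : P.IsFreeFace x k i
  edge_unique : ∀ y : P.cube 1, P.face k 0 y = P.corner (!k) (P.face k i x) → y = P.edge k i x

/-- The precubical subset generated by `X` and `x`. -/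
def Sub.adjoin {P : PrecubicalSet.{u}} (X : P.Sub) {n : ℕ} (x : P.cube n) : P.Sub where
  carrier m := {y | y ∈ X.carrier m ∨ IsFace P y x}
  face_mem k i y := Or.imp (X.face_mem k i y) (fun h => h.face k i)

/-- The intersection of two precubical subsets. -/
def Sub.inter {P : PrecubicalSet.{u}} (X Y : P.Sub) : P.Sub where
  carrier m := X.carrier m ∩ Y.carrier m
  face_mem k i y h := ⟨X.face_mem k i y h.1, Y.face_mem k i y h.2⟩

namespace IsFreeCube

variable {P : PrecubicalSet.{u}} {n : ℕ} {x : P.cube (n + 1)} {k : Bool} {i : Fin (n + 1)}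

theorem isFace_iff (h : P.IsFreeCube x k i) {m : ℕ} {y : P.cube m} :
    IsFace P (P.face k i x) y ↔
      (⟨m, y⟩ : P.Cubes) = ⟨n + 1, x⟩ ∨ (⟨m, y⟩ : P.Cubes) = ⟨n, P.face k i x⟩ := by
  rw [← mem_star_iff, h.free]
  rfl

theorem mem_removeStar (h : P.IsFreeCube x k i) {m : ℕ} {y : P.cube m} :
    y ∈ (P.removeStar (P.face k i x)).carrier m ↔
      (⟨m, y⟩ : P.Cubes) ≠ ⟨n + 1, x⟩ ∧ (⟨m, y⟩ : P.Cubes) ≠ ⟨n, P.face k i x⟩ := by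
  rw [← not_or, ← h.isFace_iff, ← mem_star_iff]
  rfl

theorem mem_of_lt (h : P.IsFreeCube x k i) {m : ℕ} (hm : m < n) (y : P.cube m) :
    y ∈ (P.removeStar (P.face k i x)).carrier m := by
  rw [h.mem_removeStar]
  exact ⟨fun e => absurd (Sigma.mk.inj e).1 (by omega), fun e => absurd (Sigma.mk.inj e).1 (by omega)⟩

theorem ne_of_notMem (h : P.IsFreeCube x k i) {m : ℕ} {y : P.cube m}
    (hy : y ∉ (P.removeStar (P.face k i x)).carrier m) :
    (⟨m, y⟩ : P.Cubes) = ⟨n + 1, x⟩ ∨ (⟨m, y⟩ : P.Cubes) = ⟨n, P.face k i x⟩ := by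
  rw [h.mem_removeStar] at hy
  tauto

theorem face_mem (h : P.IsFreeCube x k i) {l : Bool} {m : Fin (n + 1)} (hlm : (l, m) ≠ (k, i)) :
    P.face l m x ∈ (P.removeStar (P.face k i x)).carrier n := by
  rw [h.mem_removeStar]
  refine ⟨fun e => absurd (Sigma.mk.inj e).1 (by omega), fun e => ?_⟩
  exact h.regular.face_ne hlm (eq_of_heq (Sigma.mk.inj e).2)

theorem isCollapse (h : P.IsFreeCube x k i) :
    (P.removeStar (P.face k i x)).incl.IsCollapse x k i where
  inj := Sub.incl_isInjective _
  map_ne s e := (h.mem_removeStar.1 s.2).1 (congrArg (Sigma.mk (n + 1)) e)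
  map_ne_face s e := (h.mem_removeStar.1 s.2).2 (congrArg (Sigma.mk n) e)
  cover m y := by
    by_cases hy : y ∈ (P.removeStar (P.face k i x)).carrier m
    · exact .inl ⟨⟨y, hy⟩, rfl⟩
    · exact .inr (h.ne_of_notMem hy)
  face_ne _ _ := h.regular.face_ne

theorem corner_ne (h : P.IsFreeCube x k i) :
    P.corner (!k) x ≠ P.corner (!k) (P.face k i x) := h.regular.corner_ne k i

/-- Only for a square could `e^k_i x` be the free face itself. The corner of type `1 - k` of the
edge is that of `x`, however, and regularity separates it from the corner of the free face. -/
theorem edge_mem (h : P.IsFreeCube x k i) :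
    P.edge k i x ∈ (P.removeStar (P.face k i x)).carrier 1 := by
  by_contra hy
  have hpos := h.pos
  rcases h.ne_of_notMem hy with e | e
  · exact absurd (Sigma.mk.inj e).1 (by omega)
  · obtain ⟨rfl, e⟩ := Sigma.mk.inj e
    have e' := eq_of_heq e
    have h1 := (P.edge_spec k i x).1
    rw [e'] at h1
    exact h.corner_ne h1.symm

theorem eq_of_face_eq (h : P.IsFreeCube x k i) {y : P.cube 1}
    (hy : P.face k 0 y = P.corner (!k) (P.face k i x)) :
    P.face (!k) 0 y = P.corner (!k) x := by
  rw [h.edge_unique y hy]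
  exact (P.edge_spec k i x).1

/-- A loop at `v` would be the edge `e^k_i x`, whose other end is a different vertex by regularity.
-/
theorem face_ne_corner (h : P.IsFreeCube x k i) {y : P.cube 1}
    (hy : P.face (!k) 0 y = P.corner (!k) (P.face k i x)) :
    P.face k 0 y ≠ P.corner (!k) (P.face k i x) := by
  intro hy'
  exact h.corner_ne ((h.eq_of_face_eq hy').symm.trans hy)

/-- A chain that arrives at `v` from elsewhere has a last step, and that step must be along `e^k_i
x`. -/
theorem reachesTo_corner (h : P.IsFreeCube x k i) {a : P.cube 0}
    (ha : a ≠ P.corner (!k) (P.face k i x))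
    (hr : P.ReachesTo k a (P.corner (!k) (P.face k i x))) : P.ReachesTo k a (P.corner (!k) x) := by
  rcases Relation.ReflTransGen.cases_tail hr with e | ⟨c, hc, y, rfl, hy⟩
  · exact absurd e.symm ha
  · rwa [h.eq_of_face_eq hy] at hc

theorem sub_reachesTo_corner (h : P.IsFreeCube x k i) {a : P.cube 0}
    (ha : a ≠ P.corner (!k) (P.face k i x))
    (hr : (P.removeStar (P.face k i x)).ReachesTo k a (P.corner (!k) (P.face k i x))) :
    (P.removeStar (P.face k i x)).ReachesTo k a (P.corner (!k) x) := by
  rcases Relation.ReflTransGen.cases_tail hr with e | ⟨c, hc, y, -, rfl, hy⟩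
  · exact absurd e.symm ha
  · rwa [h.eq_of_face_eq hy] at hc

theorem exists_detour {x : P.cube 2} {i : Fin 2} (h : P.IsFreeCube x k i) :
    ∃ j : Fin 2, j ≠ i ∧ P.face (!k) 0 (P.face k j x) = P.face k 0 (P.face (!k) i x) := by
  fin_cases i
  · exact ⟨1, by decide, P.face_face (!k) k 0 0 le_rfl x⟩
  · exact ⟨0, by decide, (P.face_face k (!k) 0 0 le_rfl x).symm⟩

/-- The half of the boundary of `x` not containing the free edge consists of the face opposite to it
and of the other face of type `k`. -/
theorem detour_reachesTo {x : P.cube 2} {i : Fin 2} (h : P.IsFreeCube x k i) :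
    (P.removeStar (P.face k i x)).ReachesTo k (P.corner (!k) x) (P.corner k x) := by
  obtain ⟨j, hj, e⟩ := h.exists_detour
  refine .head ⟨P.face (!k) i x, h.face_mem (by simp), ?_, rfl⟩
    (.single ⟨P.face k j x, h.face_mem (by simp [hj]), e, ?_⟩)
  · exact P.corner_face (!k) i x
  · exact P.corner_face k j x

/-- Paths that start (end, for `k = 0`) at another vertex than `d_1^{1-k} ⋯ d_1^{1-k} d^k_i x` may
be deformed into `P ∖ star(d^k_i x)`. -/
theorem sub_reachesTo (h : P.IsFreeCube x k i) {a b : P.cube 0}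
    (ha : a ≠ P.corner (!k) (P.face k i x)) (hr : P.ReachesTo k a b) :
    (P.removeStar (P.face k i x)).ReachesTo k a b := by
  induction hr with
  | refl => exact .refl
  | tail _ hs ih =>
    obtain ⟨y, rfl, rfl⟩ := hs
    by_cases hy : y ∈ (P.removeStar (P.face k i x)).carrier 1
    · exact ih.tail ⟨y, hy, rfl, rfl⟩
    · have hpos := h.pos
      rcases h.ne_of_notMem hy with e | e
      · exact absurd (Sigma.mk.inj e).1 (by omega)
      · obtain ⟨rfl, e⟩ := Sigma.mk.inj e
        obtain rfl := eq_of_heq e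
        -- The removed edge starts at `v` in the direction `k`. The chain up to there has come
        -- through the corner of `x`, from which the detour reaches the end of the removed edge.
        have h1 := (h.sub_reachesTo_corner ha ih).trans h.detour_reachesTo
        rwa [← P.corner_face k i x] at h1

/-! ### Homology classes and reachability -/

/-- If `X` contains the free face, adding all of `x` loses no homology class, and the enlarged
subset collapses into `Q`. The price is that vertices of `x` may be added. Otherwise `X` contains
neither removed cube. -/
theorem exists_sub_le (h : P.IsFreeCube x k i) (X : P.Sub) :
    ∃ X' : P.Sub, X'.le (P.removeStar (P.face k i x)) ∧
      (∀ (R : Type w) [CommRing R], X.classes R ⊆ X'.classes R) ∧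
      ∀ a ∈ X'.carrier 0, a ∈ X.carrier 0 ∨ (P.face k i x ∈ X.carrier n ∧ IsFace P a x) := by
  by_cases hX : P.face k i x ∈ X.carrier n
  · have hc : (X.adjoin x).Collapses ((X.adjoin x).inter (P.removeStar (P.face k i x))) x k i :=
      { le := fun _ _ h => h.1
        mem := .inr (.refl x)
        notMem := fun hy => (h.mem_removeStar.1 hy.2).1 rfl
        notMem_face := fun hy => (h.mem_removeStar.1 hy.2).2 rfl
        cover := fun m y hy => by
          by_cases hy' : y ∈ (P.removeStar (P.face k i x)).carrier m
          · exact .inl ⟨hy, hy'⟩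
          · exact .inr (h.ne_of_notMem hy')
        face_ne := fun _ _ => h.regular.face_ne }
    refine ⟨(X.adjoin x).inter (P.removeStar (P.face k i x)), fun m y hy => hy.2, fun R _ => ?_,
      fun a ha => ?_⟩
    · rw [← hc.classes_eq R]
      exact Sub.classes_mono R fun m y hy => .inl hy
    · exact ha.1.imp_right fun h => ⟨hX, h⟩
  · refine ⟨X, fun m y hy => ?_, fun R _ => subset_rfl, fun a ha => .inl ha⟩
    by_contra hy'
    rcases h.ne_of_notMem hy' with e | e
    · obtain ⟨rfl, e⟩ := Sigma.mk.inj e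
      obtain rfl := eq_of_heq e
      exact hX (X.face_mem k i y hy)
    · obtain ⟨rfl, e⟩ := Sigma.mk.inj e
      obtain rfl := eq_of_heq e
      exact hX hy

theorem exists_square_of_isFace {m : ℕ} {a : P.cube 0} :
    ∀ {y : P.cube (m + 2)}, IsFace P a y → ∃ z : P.cube 2, IsFace P a z ∧ IsFace P z y := by
  induction m with
  | zero => exact fun {y} h => ⟨y, h, .refl y⟩
  | succ m ih =>
    intro y h
    cases h with
    | step _ l j y h =>
      obtain ⟨z, h1, h2⟩ := ih h
      exact ⟨z, h1, .step _ l j y h2⟩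

/-- The pair `(p, q)` gives the coordinates of the vertex in the square. Recording it once on each
of the two edges through the vertex gives access to both of these edges. -/
theorem exists_face_face_of_isFace {a : P.cube 0} {z : P.cube 2} (h : IsFace P a z) :
    ∃ p q : Bool, a = P.face p 0 (P.face q 1 z) ∧ a = P.face q 0 (P.face p 0 z) := by
  have key : ∀ (q : Bool) (j : Fin 2) (p : Bool), a = P.face p 0 (P.face q j z) →
      ∃ p q : Bool, a = P.face p 0 (P.face q 1 z) ∧ a = P.face q 0 (P.face p 0 z) := by
    intro q j p e
    fin_cases j
    · exact ⟨q, p, e.trans (P.face_face q p 0 0 le_rfl z).symm, e⟩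
    · exact ⟨p, q, e, e.trans (P.face_face p q 0 0 le_rfl z)⟩
  cases h with
  | step _ q j z h =>
    cases h with
    | step _ p l y h =>
      have e := h.eq_of_degree
      rw [Subsingleton.elim (α := Fin 1) l 0] at e
      exact key q j p e

/-- Every cube that contains the vertex `d_1^{1-k} ⋯ d_1^{1-k} d^k_i x`, apart from this vertex and
the edge `e^k_i x`, has an edge leaving this vertex (entering it, for `k = 0`). -/
theorem exists_edge_of_isFace (h : P.IsFreeCube x k i) {m : ℕ} {y : P.cube m}
    (hy : IsFace P (P.corner (!k) (P.face k i x)) y)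
    (h0 : (⟨m, y⟩ : P.Cubes) ≠ ⟨0, P.corner (!k) (P.face k i x)⟩)
    (h1 : (⟨m, y⟩ : P.Cubes) ≠ ⟨1, P.edge k i x⟩) :
    ∃ e : P.cube 1, IsFace P e y ∧ P.face (!k) 0 e = P.corner (!k) (P.face k i x) := by
  match m, y, hy, h0, h1 with
  | 0, y, hy, h0, _ => exact absurd (by rw [hy.eq_of_degree]) h0
  | 1, y, hy, _, h1 =>
    cases hy with
    | step _ l j y hy =>
      have e := hy.eq_of_degree
      rw [Subsingleton.elim (α := Fin 1) j 0] at e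
      by_cases hl : l = k
      · subst hl
        exact absurd (by rw [h.edge_unique y e.symm]) h1
      · obtain rfl : l = !k := by cases l <;> cases k <;> simp_all
        exact ⟨y, .refl y, e.symm⟩
  | m + 2, y, hy, _, _ =>
    obtain ⟨z, hz, hzy⟩ := exists_square_of_isFace hy
    obtain ⟨p, q, e1, e2⟩ := exists_face_face_of_isFace hz
    -- If both coordinates are `k`, the two edges of `z` at `v` point into `v` and are both equal to
    -- `e^k_i x`, against weak regularity. A coordinate `1 - k` gives an edge leaving `v`.
    by_cases hp : p = k
    · by_cases hq : q = k
      · subst hp hq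
        have := (h.edge_unique _ e2.symm).trans (h.edge_unique _ e1.symm).symm
        exact absurd this (h.weaklyRegular.face_ne _ z)
      · obtain rfl : q = !k := by cases q <;> cases k <;> simp_all
        exact ⟨P.face p 0 z, (IsFace.refl z).face p 0 |>.trans hzy, e2.symm⟩
    · obtain rfl : p = !k := by cases p <;> cases k <;> simp_all
      exact ⟨P.face q 1 z, (IsFace.refl z).face q 1 |>.trans hzy, e1.symm⟩

/-- The vertex `v` is harmless in `X` if some edge of `X` leaves it. If none does, then `e^k_i x`
and `v` itself are the only cubes of `X` that can contain `v`. After `e^k_i x` is adjoined, `v` is a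
free face of it and can be collapsed away. -/
theorem exists_sub_le_avoiding (h : P.IsFreeCube x k i) (X : P.Sub)
    (hX : X.le (P.removeStar (P.face k i x))) :
    ∃ X' : P.Sub, X'.le (P.removeStar (P.face k i x)) ∧
      (∀ (R : Type w) [CommRing R], X.classes R ⊆ X'.classes R) ∧
      ∀ a ∈ X'.carrier 0, (a ∈ X.carrier 0 ∨ (a = P.corner (!k) x ∧
          P.corner (!k) (P.face k i x) ∈ X.carrier 0)) ∧
        (a = P.corner (!k) (P.face k i x) → ∃ e ∈ X.carrier 1, P.face (!k) 0 e = a) := by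
  by_cases hv : P.corner (!k) (P.face k i x) ∈ X.carrier 0
  swap
  · exact ⟨X, hX, fun R _ => subset_rfl, fun a ha => ⟨.inl ha, fun e => absurd (e ▸ ha) hv⟩⟩
  by_cases he : ∃ e ∈ X.carrier 1, P.face (!k) 0 e = P.corner (!k) (P.face k i x)
  · exact ⟨X, hX, fun R _ => subset_rfl, fun a ha => ⟨.inl ha, fun e => e ▸ he⟩⟩
  have hface : P.face k 0 (P.edge k i x) = P.corner (!k) (P.face k i x) := (P.edge_spec k i x).2
  have hstar : ∀ (m : ℕ), ∀ y ∈ X.carrier m, IsFace P (P.corner (!k) (P.face k i x)) y →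
      (⟨m, y⟩ : P.Cubes) = ⟨1, P.edge k i x⟩ ∨
      (⟨m, y⟩ : P.Cubes) = ⟨0, P.corner (!k) (P.face k i x)⟩ := by
    intro m y hy hvy
    by_contra! hne
    obtain ⟨e, hey, h2⟩ := h.exists_edge_of_isFace hvy hne.2 hne.1
    exact he ⟨e, hey.mem X hy, h2⟩
  have hedge : ∀ m (y : P.cube m), IsFace P y (P.edge k i x) →
      (⟨m, y⟩ : P.Cubes) = ⟨1, P.edge k i x⟩ ∨ (⟨m, y⟩ : P.Cubes) = ⟨0, P.corner (!k) x⟩ ∨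
      (⟨m, y⟩ : P.Cubes) = ⟨0, P.corner (!k) (P.face k i x)⟩ := by
    intro m y hy
    generalize hE : P.edge k i x = E at hy
    cases hy with
    | refl => exact .inl rfl
    | step _ l j _ hy =>
      subst hE
      rw [Subsingleton.elim (α := Fin 1) j 0] at hy
      have hm : m = 0 := Nat.le_zero.1 hy.degree_le
      subst hm
      have e := hy.eq_of_degree
      by_cases hl : l = k
      · subst hl
        exact .inr (.inr (by rw [e, hface]))
      · obtain rfl : l = !k := by cases l <;> cases k <;> simp_all
        exact .inr (.inl (by rw [e, (P.edge_spec k i x).1]))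
  -- The corner of `x` is added explicitly because `v` may be in `X` without `e^k_i x`; collapsing
  -- the adjoined edge then moves `v` to that corner.
  let X' : P.Sub :=
    { carrier := fun m => {y | (y ∈ X.carrier m ∨ (⟨m, y⟩ : P.Cubes) = ⟨0, P.corner (!k) x⟩) ∧
        (⟨m, y⟩ : P.Cubes) ≠ ⟨1, P.edge k i x⟩ ∧
        (⟨m, y⟩ : P.Cubes) ≠ ⟨0, P.corner (!k) (P.face k i x)⟩}
      face_mem := by
        rintro m l j y ⟨hy | hy, h1, h2⟩
        · refine ⟨.inl (X.face_mem l j y hy), ?_⟩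
          -- A cube of `X'` with `e^k_i x` or `v` among its faces would contain `v`, hence be one of
          -- the two deleted cubes.
          have hn : ¬ IsFace P (P.corner (!k) (P.face k i x)) y := fun hvy =>
            (hstar _ y hy hvy).elim h1 h2
          constructor
          · intro e
            obtain ⟨rfl, e⟩ := Sigma.mk.inj e
            refine hn (.step _ l j y ?_)
            rw [eq_of_heq e]
            exact .step _ k 0 _ (by rw [hface]; exact .refl _)
          · intro e
            obtain ⟨rfl, e⟩ := Sigma.mk.inj e
            refine hn (.step _ l j y ?_)
            rw [eq_of_heq e]
            exact .refl _
        · exact absurd (Sigma.mk.inj hy).1 (by omega) }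
  have hc : (X.adjoin (P.edge k i x)).Collapses X' (P.edge k i x) k 0 :=
    { le := by
        rintro m y ⟨hy | hy, -⟩
        · exact .inl hy
        · obtain ⟨rfl, hy⟩ := Sigma.mk.inj hy
          obtain rfl := eq_of_heq hy
          refine .inr (.step _ (!k) 0 _ ?_)
          rw [(P.edge_spec k i x).1]
          exact .refl _
      mem := .inr (.refl _)
      notMem := fun hy => hy.2.1 rfl
      notMem_face := fun hy => hy.2.2 (by rw [hface])
      cover := by
        intro m y hy
        rw [hface]
        by_contra! hne
        refine hne.1 ⟨?_, hne.2.1, hne.2.2⟩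
        rcases hy with hy | hy
        · exact .inl hy
        · rcases hedge m y hy with e | e | e
          · exact absurd e hne.2.1
          · exact .inr e
          · exact absurd e hne.2.2
      face_ne := by
        intro l m hlm
        rw [Subsingleton.elim (α := Fin 1) m 0, hface]
        obtain rfl : l = !k := by
          rw [Subsingleton.elim (α := Fin 1) m 0] at hlm
          cases l <;> cases k <;> simp_all
        rw [(P.edge_spec k i x).1]
        exact h.corner_ne }
  refine ⟨X', ?_, fun R _ => ?_, ?_⟩
  · rintro m y ⟨hy | hy, -⟩
    · exact hX m hy
    · obtain ⟨rfl, hy⟩ := Sigma.mk.inj hy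
      exact h.mem_of_lt h.pos y
  · rw [← hc.classes_eq R]
    exact Sub.classes_mono R fun m y hy => .inl hy
  · rintro a ⟨ha, -, h2⟩
    refine ⟨ha.imp_right fun e => ⟨eq_of_heq (Sigma.mk.inj e).2, hv⟩, fun e => ?_⟩
    exact absurd (by rw [e]) h2

/-- The vertices added to `X` and `Y` are vertices of `x`, which reach or are reached from vertices
of the original subsets. Only the starting vertex matters when chains are moved into `Q`, so `v` has
to be avoided in `X` but not in `Y`. -/
theorem exists_subs_reachesTo (h : P.IsFreeCube x k i) (X Y : P.Sub)
    (hXY : ∀ a ∈ X.carrier 0, ∀ b ∈ Y.carrier 0, P.ReachesTo k a b) :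
    ∃ X' Y' : P.Sub, X'.le (P.removeStar (P.face k i x)) ∧
      Y'.le (P.removeStar (P.face k i x)) ∧
      (∀ (R : Type w) [CommRing R], X.classes R ⊆ X'.classes R) ∧
      (∀ (R : Type w) [CommRing R], Y.classes R ⊆ Y'.classes R) ∧
      ∀ a ∈ X'.carrier 0, ∀ b ∈ Y'.carrier 0,
        (P.removeStar (P.face k i x)).ReachesTo k a b := by
  obtain ⟨Y', hY', hYc, hY0⟩ := h.exists_sub_le Y
  obtain ⟨X₁, hX₁, hXc₁, hX₀⟩ := h.exists_sub_le X
  obtain ⟨X', hX', hXc', hX0'⟩ := h.exists_sub_le_avoiding X₁ hX₁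
  have hvx : IsFace P (P.corner (!k) (P.face k i x)) x := .step _ k i x (isFace_corner P _ _)
  -- An added vertex of `x` reaches the corner of type `k` of `x`, which is also a corner of the
  -- free face and so belongs to `X`.
  have hsrc : ∀ a ∈ X₁.carrier 0, ∃ c ∈ X.carrier 0, P.ReachesTo k a c := by
    intro a ha
    rcases hX₀ a ha with ha | ⟨hf, ha⟩
    · exact ⟨a, ha, .refl⟩
    · refine ⟨P.corner k x, ?_, (ha.reachesTo k).2⟩
      rw [← P.corner_face k i x]
      exact (isFace_corner P k _).mem X hf
  have htgt : ∀ a, a ≠ P.corner (!k) (P.face k i x) → (∃ c ∈ X.carrier 0, P.ReachesTo k a c) →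
      ∀ b ∈ Y'.carrier 0, (P.removeStar (P.face k i x)).ReachesTo k a b := by
    rintro a hav ⟨c, hc, hac⟩ b hb
    refine h.sub_reachesTo hav ?_
    rcases hY0 b hb with hb | ⟨hf, hb⟩
    · exact hac.trans (hXY c hc b hb)
    · have hv := hac.trans (hXY c hc _ ((isFace_corner P (!k) (P.face k i x)).mem Y hf))
      exact (h.reachesTo_corner hav hv).trans (hb.reachesTo k).1
  refine ⟨X', Y', hX', hY', fun R _ => (hXc₁ R).trans (hXc' R), hYc, fun a ha b hb => ?_⟩
  obtain ⟨ha', hav⟩ := hX0' a ha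
  -- If `v` survives in `X'`, an edge of `X₁` leaves it. That edge lies in `Q`, and from its end,
  -- which is not `v`, the previous argument applies.
  by_cases e : a = P.corner (!k) (P.face k i x)
  · obtain ⟨y, hy, rfl⟩ := hav e
    have hne := h.face_ne_corner e
    exact .head ⟨y, hX₁ 1 hy, rfl, rfl⟩
      (htgt _ hne (hsrc _ (X₁.face_mem k 0 y hy)) b hb)
  · refine htgt a e ?_ b hb
    rcases ha' with ha' | ⟨rfl, hv⟩
    · exact hsrc a ha'
    · obtain ⟨c, hc, hvc⟩ := hsrc _ hv
      exact ⟨c, hc, ((hvx.reachesTo k).1).trans hvc⟩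

theorem isHomologyGraphIso (h : P.IsFreeCube x k i) (R : Type w) [CommRing R] :
    IsHomologyGraphIso R (P.removeStar (P.face k i x)).incl.realize := by
  have hbij := h.isCollapse.homologyMap_bijective R
  refine ⟨hbij, fun α β => ⟨?_, ?_⟩⟩
  · rintro ⟨X, Y, hα, hβ, hXY⟩
    refine ⟨Sub.image X, Sub.image Y, Sub.mem_classes_image R hα, Sub.mem_classes_image R hβ, ?_⟩
    rintro a ⟨ha, ha'⟩ b ⟨hb, hb'⟩
    have := reaches_iff.1 (hXY _ ha' _ hb')
    exact reaches_iff.2 (Sub.ReachesTo.of_sub (Sub.reachesTo_iff.1 this))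
  · rintro ⟨X, Y, hα, hβ, hXY⟩
    -- For `k = 0` chains run against the edges, so the target subset `Y` takes the role of the
    -- starting one.
    cases k
    · obtain ⟨Y', X', hY, hX, hYc, hXc, hr⟩ := h.exists_subs_reachesTo Y X fun b hb a ha =>
        reachesTo_false_iff.2 (reaches_iff.1 (hXY a ha b hb))
      refine ⟨Sub.comap _ X', Sub.comap _ Y', Sub.mem_classes_comap hX R hbij.1 (hXc R hα),
        Sub.mem_classes_comap hY R hbij.1 (hYc R hβ), fun a ha b hb => reaches_iff.2 ?_⟩
      rw [← reachesTo_false_iff]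
      exact Sub.reachesTo_iff.2 (hr b.1 hb a.1 ha)
    · obtain ⟨X', Y', hX, hY, hXc, hYc, hr⟩ := h.exists_subs_reachesTo X Y fun a ha b hb =>
        reaches_iff.1 (hXY a ha b hb)
      refine ⟨Sub.comap _ X', Sub.comap _ Y', Sub.mem_classes_comap hX R hbij.1 (hXc R hα),
        Sub.mem_classes_comap hY R hbij.1 (hYc R hβ), fun a ha b hb => reaches_iff.2 ?_⟩
      exact Sub.reachesTo_iff.2 (hr a.1 ha b.1 hb)

end IsFreeCube

end PrecubicalSet

namespace PrecubicalSet

/-! ### Points of the realization of a precubical interval -/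

theorem interval.eq_vertex {k : ℕ} (c : (interval k).cube 0) :
    c = interval.vertex (BoxCell.base c 0) (BoxCell.base_le c 0) := by
  refine BoxCell.ext ?_ ?_
  · ext a; exact a.elim0
  · funext a
    rw [Subsingleton.elim a 0]
    rfl

theorem interval.eq_edge {k : ℕ} (c : (interval k).cube 1) :
    ∃ (j : ℕ) (hj : j < k), c = interval.edge j hj := by
  have h : BoxCell.base c 0 < k := by
    have := BoxCell.base_dir_lt c 0
    rwa [Subsingleton.elim (α := Fin 1) (BoxCell.dir c 0) 0] at this
  refine ⟨BoxCell.base c 0, h, BoxCell.ext ?_ ?_⟩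
  · ext a
    exact congrArg Fin.val (Subsingleton.elim (α := Fin 1) _ _)
  · funext a
    rw [Subsingleton.elim a 0]
    rfl

theorem interval.boxCoord_vertex {k j : ℕ} (hj : j ≤ k) :
    boxCoord (fun _ : Fin 1 => k) ((interval k).vertexPoint (interval.vertex j hj)) =
      fun _ => (j : ℝ) := by
  funext a
  change (j : ℝ) + ∑ a : Fin 0, _ = j
  simp

theorem interval.boxCoord_edge {k j : ℕ} (hj : j < k) (z : Fin 1 → unitInterval) :
    boxCoord (fun _ : Fin 1 => k) ((interval k).point (interval.edge j hj) z) =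
      fun _ => (j : ℝ) + z 0 := by
  funext a
  change (j : ℝ) + ∑ b : Fin 1, (if (RelEmbedding.refl _ : Fin 1 ↪o Fin 1) b = a then _ else _) = _
  simp [Subsingleton.elim a 0]

theorem interval.exists_eq {k : ℕ} (t : (interval k).Realization) :
    (∃ (j : ℕ) (hj : j ≤ k), t = (interval k).vertexPoint (interval.vertex j hj)) ∨
    ∃ (j : ℕ) (hj : j < k) (z : Fin 1 → unitInterval), (∀ a, z a ≠ 0 ∧ z a ≠ 1) ∧
      t = (interval k).point (interval.edge j hj) z := by
  have hv : ∀ c z, (interval k).point (n := 0) c z =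
      (interval k).vertexPoint (interval.vertex (BoxCell.base c 0) (BoxCell.base_le c 0)) := by
    intro c z
    rw [← interval.eq_vertex c]
    exact congrArg _ (Subsingleton.elim _ _)
  induction t using Realization.ind with
  | h m c z =>
  match m, c, z with
  | 0, c, z => exact .inl ⟨_, _, hv c z⟩
  | 1, c, z =>
    obtain ⟨j, hj, rfl⟩ := interval.eq_edge c
    by_cases h0 : z 0 = bit false
    · rw [(interval k).point_face false 0 _ _ h0]
      exact .inl ⟨_, _, hv _ _⟩
    · by_cases h1 : z 0 = bit true
      · rw [(interval k).point_face true 0 _ _ h1]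
        exact .inl ⟨_, _, hv _ _⟩
      · refine .inr ⟨j, hj, z, fun a => ?_, rfl⟩
        rw [Subsingleton.elim (α := Fin 1) a 0]
        exact ⟨h0, h1⟩
  | m + 2, c, z => exact (BoxCell.degree_le_one c).elim

theorem PathOfLength.realize_edge_ne {P : PrecubicalSet.{u}} {k : ℕ} (ω : P.PathOfLength k)
    {j : ℕ} (hj : j < k) {z : Fin 1 → unitInterval} (hz : ∀ a, z a ≠ 0 ∧ z a ≠ 1)
    (p : P.cube 0) : ω.realize ((interval k).point (interval.edge j hj) z) ≠ P.vertexPoint p := by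
  intro h
  have := sigma_eq_of_point_eq hz (fun a => a.elim0) h
  exact absurd (Sigma.mk.inj this).1 one_ne_zero

theorem PathOfLength.realize_vertex {P : PrecubicalSet.{u}} {k : ℕ} (ω : P.PathOfLength k)
    {j : ℕ} (hj : j ≤ k) : ω.realize ((interval k).vertexPoint (interval.vertex j hj)) =
      P.vertexPoint (ω.vertex j hj) := rfl

theorem PathOfLength.ext {P : PrecubicalSet.{u}} {k : ℕ} {ω ν : P.PathOfLength k}
    (h0 : ∀ j hj, ω.vertex j hj = ν.vertex j hj) (h1 : ∀ j hj, ω.edge j hj = ν.edge j hj) :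
    ω = ν := by
  refine Hom.ext ?_
  funext m c
  match m, c with
  | 0, c =>
    rw [interval.eq_vertex c]
    exact h0 _ _
  | 1, c =>
    obtain ⟨j, hj, rfl⟩ := interval.eq_edge c
    exact h1 j hj
  | m + 2, c => exact (BoxCell.degree_le_one c).elim

/-- A path sends interior points of edges to interior points of edges, never to vertices, so a
reparametrization has to send vertices to vertices. -/
theorem PathOfLength.exists_vertex_of_realize_eq {P : PrecubicalSet.{u}} {k l : ℕ}
    {ω : P.PathOfLength k} {ν : P.PathOfLength l}
    {φ : (interval k).Realization → (interval l).Realization}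
    (h : ∀ t, ω.realize t = ν.realize (φ t)) (j : Fin (k + 1)) :
    ∃ j' : Fin (l + 1), φ ((interval k).vertexPoint (interval.vertex j j.is_le)) =
      (interval l).vertexPoint (interval.vertex j' j'.is_le) := by
  have h1 := h ((interval k).vertexPoint (interval.vertex j j.is_le))
  rcases interval.exists_eq (φ ((interval k).vertexPoint (interval.vertex j j.is_le))) with
    ⟨j', hj', e⟩ | ⟨j', hj', z, hz, e⟩
  · exact ⟨⟨j', Nat.lt_succ_of_le hj'⟩, e⟩
  · rw [e] at h1
    exact absurd h1.symm (ν.realize_edge_ne hj' hz _)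

theorem interval.vertexPoint_inj {k : ℕ} {i j : Fin (k + 1)}
    (h : (interval k).vertexPoint (interval.vertex i i.is_le) =
      (interval k).vertexPoint (interval.vertex j j.is_le)) : i = j := by
  have := congrArg (fun c => BoxCell.base c 0) ((interval k).vertexPoint_injective h)
  exact Fin.ext this

/-- A path is determined by its realization, up to increasing reparametrization. -/
theorem PathOfLength.eq_of_realize_eq {P : PrecubicalSet.{u}} {k l : ℕ}
    {ω : P.PathOfLength k} {ν : P.PathOfLength l}
    {φ : (interval k).Realization ≃ₜ (interval l).Realization} (hφ : IsDihomeomorphism φ)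
    (h : ∀ t, ω.realize t = ν.realize (φ t)) :
    (⟨k, ω⟩ : Σ k, P.PathOfLength k) = ⟨l, ν⟩ := by
  have h' : ∀ t, ν.realize t = ω.realize (φ.symm t) := fun t => by rw [h, φ.apply_symm_apply]
  choose f hf using PathOfLength.exists_vertex_of_realize_eq h
  choose g hg using PathOfLength.exists_vertex_of_realize_eq h'
  have hle : ∀ i j : Fin (k + 1), f i ≤ f j ↔ i ≤ j := by
    intro i j
    have := hφ ((interval k).vertexPoint (interval.vertex i i.is_le))
      ((interval k).vertexPoint (interval.vertex j j.is_le))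
    rw [hf, hf, interval.boxCoord_vertex, interval.boxCoord_vertex, interval.boxCoord_vertex,
      interval.boxCoord_vertex] at this
    simpa [Pi.le_def] using this.symm
  have hfg : ∀ j, f (g j) = j := by
    intro j
    apply interval.vertexPoint_inj
    rw [← hf, ← hg, φ.apply_symm_apply]
  have hgf : ∀ j, g (f j) = j := by
    intro j
    apply interval.vertexPoint_inj
    rw [← hg, ← hf, φ.symm_apply_apply]
  -- The reparametrization restricts to an order isomorphism of finite chains, which forces equal
  -- lengths and the identity on vertices.
  let F : Fin (k + 1) ≃o Fin (l + 1) := ⟨⟨f, g, hgf, hfg⟩, hle _ _⟩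
  obtain rfl : k = l := by
    have := Fintype.card_congr F.toEquiv
    simpa using this
  have hid : ∀ j, f j = j := fun j => DFunLike.congr_fun (Subsingleton.elim F (OrderIso.refl _)) j
  congr 1
  refine PathOfLength.ext (fun j hj => ?_) fun j hj => ?_
  · apply P.vertexPoint_injective
    have := hf ⟨j, Nat.lt_succ_of_le hj⟩
    rw [hid] at this
    rw [← PathOfLength.realize_vertex, ← PathOfLength.realize_vertex, h]
    exact congrArg _ this
  · have hz : ∀ a : Fin 1, (fun _ => ⟨1 / 2, by norm_num, by norm_num⟩ : Fin 1 → unitInterval) a ≠ 0 ∧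
        (fun _ => ⟨1 / 2, by norm_num, by norm_num⟩ : Fin 1 → unitInterval) a ≠ 1 := by
      intro a
      constructor <;> · intro e; have := congrArg Subtype.val e; norm_num at this
    -- Any interior point of the edge would do. Its image is an interior point of an edge lying
    -- between the vertices `j` and `j + 1`, hence of the edge `[j, j + 1]`, and interior points
    -- determine their cube.
    set z : Fin 1 → unitInterval := fun _ => ⟨1 / 2, by norm_num, by norm_num⟩ with hzdef
    have h1 := h ((interval k).point (interval.edge j hj) z)
    have hlo := (hφ ((interval k).vertexPoint (interval.vertex j hj.le))
      ((interval k).point (interval.edge j hj) z)).1 (by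
        rw [interval.boxCoord_vertex, interval.boxCoord_edge]
        intro a
        have := (z 0).2.1
        simpa using this)
    have hhi := (hφ ((interval k).point (interval.edge j hj) z)
      ((interval k).vertexPoint (interval.vertex (j + 1) hj))).1 (by
        rw [interval.boxCoord_vertex, interval.boxCoord_edge]
        intro a
        have := (z 0).2.2
        push_cast
        simpa using this)
    have e1 := hf ⟨j, Nat.lt_succ_of_le hj.le⟩
    have e2 := hf ⟨j + 1, Nat.succ_lt_succ hj⟩
    rw [hid] at e1 e2
    simp only at e1 e2
    rw [e1, interval.boxCoord_vertex] at hlo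
    rw [e2, interval.boxCoord_vertex] at hhi
    rcases interval.exists_eq (φ ((interval k).point (interval.edge j hj) z)) with
      ⟨j', hj', e⟩ | ⟨j', hj', z', hz', e⟩
    · rw [e] at h1
      exact absurd h1 (ω.realize_edge_ne hj hz _)
    · rw [e] at h1
      rw [e, interval.boxCoord_edge] at hlo hhi
      have hlo0 := hlo 0
      have hhi0 := hhi 0
      simp only at hlo0 hhi0
      have hz0 : (0 : ℝ) < z' 0 := lt_of_le_of_ne (z' 0).2.1 fun e => (hz' 0).1 (Subtype.ext e.symm)
      have hz1 : (z' 0 : ℝ) < 1 := lt_of_le_of_ne (z' 0).2.2 fun e => (hz' 0).2 (Subtype.ext e)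
      obtain rfl : j = j' := by
        have a1 : (j : ℝ) < (j' + 1 : ℕ) := by push_cast; linarith
        have a2 : (j' : ℝ) < (j + 1 : ℕ) := by push_cast at hhi0 ⊢; linarith
        have a1' := Nat.cast_lt.1 a1
        have a2' := Nat.cast_lt.1 a2
        omega
      have := sigma_eq_of_point_eq hz hz' h1
      exact eq_of_heq (Sigma.mk.inj this).2

/-! ### Weak morphisms given by morphisms -/

/-- The weak morphism given by a morphism of precubical sets. -/
def Hom.toWeakMorphism {Q : PrecubicalSet.{u}} {P : PrecubicalSet.{v}} (g : Hom Q P) :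
    WeakMorphism Q P where
  toMap := g.realize
  exists_vertex x := ⟨g.map x, congrArg (P.point (g.map x)) (Subsingleton.elim _ _)⟩
  exists_box _ _ k hk ξ := ⟨k, hk, g.comp ξ, Homeomorph.refl _, fun _ _ => Iff.rfl, fun t => by
    rw [Hom.realize_comp]; rfl⟩

theorem Hom.toWeakMorphism_onVertex {Q : PrecubicalSet.{u}} {P : PrecubicalSet.{v}} (g : Hom Q P)
    (x : Q.cube 0) : g.toWeakMorphism.onVertex x = g.map x := by
  apply P.vertexPoint_injective
  exact (g.toWeakMorphism.exists_vertex x).choose_spec.symm.trans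
    (congrArg (P.point (g.map x)) (Subsingleton.elim _ _))

/-- The composite path has the same realization as `ν` up to reparametrization. Length and path are
compared together since the lengths are not known to agree beforehand. -/
theorem Hom.eq_comp_of_isPathImage {Q : PrecubicalSet.{u}} {P : PrecubicalSet.{v}} {g : Hom Q P}
    {k l : ℕ} {ω : Q.PathOfLength k} {ν : P.PathOfLength l}
    (h : g.toWeakMorphism.IsPathImage ω ν) :
    (⟨k, g.comp ω⟩ : Σ k, P.PathOfLength k) = ⟨l, ν⟩ := by
  obtain ⟨φ, hφ, h⟩ := h
  refine PathOfLength.eq_of_realize_eq hφ fun t => ?_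
  rw [← h, Hom.realize_comp]
  rfl

end PrecubicalSet

namespace PrecubicalSet

/-! ### Morphisms of fundamental categories -/

/-- A vertex as an object of the fundamental category. -/
def vertexOb {P : PrecubicalSet.{u}} (a : P.Vert) : P.FundamentalCategory :=
  FundamentalCategory.of P a

/-- An edge as a morphism of the fundamental category. -/
def edgeHom {P : PrecubicalSet.{u}} {a b : P.Vert} (y : a ⟶ b) : vertexOb a ⟶ vertexOb b :=
  (CategoryTheory.Quotient.functor P.Square).map (X := a) (Y := b) y.toPath

/-- Every morphism is represented by a path, so induction on the last edge applies. -/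
theorem hom_induction {P : PrecubicalSet.{u}} {a : P.Vert}
    {M : ∀ b : P.Vert, (vertexOb a ⟶ vertexOb b) → Prop} (id : M a (𝟙 _))
    (comp : ∀ (b c : P.Vert) (p : vertexOb a ⟶ vertexOb b) (y : b ⟶ c), M b p →
      M c (p ≫ edgeHom y))
    (b : P.Vert) (p : vertexOb a ⟶ vertexOb b) : M b p := by
  obtain ⟨p, rfl⟩ := (CategoryTheory.Quotient.functor P.Square).map_surjective
    (X := (show Paths P.Vert from a)) (Y := (show Paths P.Vert from b)) p
  change Quiver.Path (V := P.Vert) a b at p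
  induction p with
  | nil => exact id
  | cons p y ih => exact comp _ _ _ y ih

/-- The functor on the fundamental category with given values on vertices and edges. -/
def FundamentalCategory.lift {P : PrecubicalSet.{u}} {C : Type v} [Category.{w} C]
    (φ : P.Vert ⥤q C)
    (h : ∀ z : P.cube 2,
      φ.map (P.arrow (P.face false 0 z) rfl rfl) ≫
        φ.map (P.arrow (P.face true 1 z) (P.face_face false true 0 0 le_rfl z)
            (P.face_face true true 0 0 le_rfl z)) =
      φ.map (P.arrow (P.face false 1 z) (P.face_face false false 0 0 le_rfl z) rfl) ≫
        φ.map (P.arrow (P.face true 0 z) (P.face_face true false 0 0 le_rfl z).symm rfl)) :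
    P.FundamentalCategory ⥤ C :=
  CategoryTheory.Quotient.lift P.Square (Paths.lift φ) (by
    rintro _ _ _ _ ⟨z⟩
    have := h z
    simpa [Paths.lift] using this)

/-- The edges `y₁, y₂` and `y₃, y₄` form the two paths around the boundary of `z`, in one of the two
possible orders. -/
def IsBoundary {P : PrecubicalSet.{u}} (z : P.cube 2) {a b c d : P.Vert} (y₁ : a ⟶ b) (y₂ : b ⟶ d)
    (y₃ : a ⟶ c) (y₄ : c ⟶ d) : Prop :=
  (y₁.1 = P.face false 0 z ∧ y₂.1 = P.face true 1 z ∧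
    y₃.1 = P.face false 1 z ∧ y₄.1 = P.face true 0 z) ∨
  (y₃.1 = P.face false 0 z ∧ y₄.1 = P.face true 1 z ∧
    y₁.1 = P.face false 1 z ∧ y₂.1 = P.face true 0 z)

theorem IsBoundary.symm {P : PrecubicalSet.{u}} {z : P.cube 2} {a b c d : P.Vert} {y₁ : a ⟶ b}
    {y₂ : b ⟶ d} {y₃ : a ⟶ c} {y₄ : c ⟶ d} (h : IsBoundary z y₁ y₂ y₃ y₄) :
    IsBoundary z y₃ y₄ y₁ y₂ := Or.symm h

/-- Functors are used through this unpacked form: the images of objects are given by a function on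
vertices, so no equalities of objects have to be transported. -/
theorem exists_lift {P : PrecubicalSet.{u}} {C : Type v} [Category.{w} C] (o : P.Vert → C)
    (γ : ∀ {a b : P.Vert}, (a ⟶ b) → (o a ⟶ o b))
    (h : ∀ (z : P.cube 2) {a b c d : P.Vert} (y₁ : a ⟶ b) (y₂ : b ⟶ d) (y₃ : a ⟶ c) (y₄ : c ⟶ d),
      IsBoundary z y₁ y₂ y₃ y₄ → γ y₁ ≫ γ y₂ = γ y₃ ≫ γ y₄) :
    ∃ G : ∀ {a b : P.Vert}, (vertexOb a ⟶ vertexOb b) → (o a ⟶ o b),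
      (∀ a : P.Vert, G (𝟙 (vertexOb a)) = 𝟙 (o a)) ∧
      (∀ {a b c : P.Vert} (p : vertexOb a ⟶ vertexOb b) (q : vertexOb b ⟶ vertexOb c),
        G (p ≫ q) = G p ≫ G q) ∧
      ∀ {a b : P.Vert} (y : a ⟶ b), G (edgeHom y) = γ y := by
  let Φ := FundamentalCategory.lift (P := P) { obj := o, map := γ }
    (fun z => h z _ _ _ _ (.inl ⟨rfl, rfl, rfl, rfl⟩))
  exact ⟨fun {a b} p => Φ.map p, fun a => Φ.map_id _, fun p q => Φ.map_comp p q, fun y =>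
    Paths.lift_toPath _ y⟩

theorem edgeHom_square {P : PrecubicalSet.{u}} {z : P.cube 2} {a b c d : P.Vert}
    {y₁ : a ⟶ b} {y₂ : b ⟶ d} {y₃ : a ⟶ c} {y₄ : c ⟶ d} (h : IsBoundary z y₁ y₂ y₃ y₄) :
    edgeHom y₁ ≫ edgeHom y₂ = edgeHom y₃ ≫ edgeHom y₄ := by
  wlog h' : y₁.1 = P.face false 0 z ∧ y₂.1 = P.face true 1 z ∧
    y₃.1 = P.face false 1 z ∧ y₄.1 = P.face true 0 z generalizing b c
  · exact (this h.symm (h.resolve_left h')).symm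
  obtain ⟨e₁, h₁, h₁'⟩ := y₁
  obtain ⟨e₂, h₂, h₂'⟩ := y₂
  obtain ⟨e₃, h₃, h₃'⟩ := y₃
  obtain ⟨e₄, h₄, h₄'⟩ := y₄
  obtain ⟨rfl, rfl, rfl, rfl⟩ := h'
  obtain rfl := h₁
  obtain rfl := h₁'
  obtain rfl := h₃'
  obtain rfl := h₄'
  exact CategoryTheory.Quotient.sound P.Square (Square.mk z)

/-- The functor between fundamental categories induced by a morphism. -/
def Hom.fundamentalFunctor {Q : PrecubicalSet.{u}} {P : PrecubicalSet.{v}} (g : Hom Q P) :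
    Q.FundamentalCategory ⥤ P.FundamentalCategory :=
  FundamentalCategory.lift
    { obj := fun a => vertexOb (P := P) (g.map (n := 0) a)
      map := fun {a b} y => edgeHom (P := P) (a := g.map (n := 0) a) (b := g.map (n := 0) b)
        ⟨g.map y.1, by rw [← g.map_face, y.2.1], by rw [← g.map_face, y.2.2]⟩ }
    (fun z => edgeHom_square (z := g.map z)
      (.inl ⟨g.map_face _ _ _, g.map_face _ _ _, g.map_face _ _ _, g.map_face _ _ _⟩))

/-! ### Precubical subsets containing all vertices -/

section Wide

variable {P : PrecubicalSet.{u}} {Q : P.Sub} (hQ : ∀ a, a ∈ Q.carrier 0)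

/-- A vertex of `P` as an object of the fundamental category of `Q`. -/
def Sub.ob (a : P.Vert) : Q.toPrecubicalSet.FundamentalCategory :=
  FundamentalCategory.of Q.toPrecubicalSet ⟨a, hQ a⟩

/-- An edge of `Q` as a morphism of the fundamental category of `Q`. -/
def Sub.edgeHom {a b : P.Vert} (y : a ⟶ b) (hy : y.1 ∈ Q.carrier 1) :
    Sub.ob hQ a ⟶ Sub.ob hQ b :=
  PrecubicalSet.edgeHom (P := Q.toPrecubicalSet) (a := ⟨a, hQ a⟩) (b := ⟨b, hQ b⟩)
    ⟨⟨y.1, hy⟩, Subtype.ext y.2.1, Subtype.ext y.2.2⟩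

theorem Sub.edgeHom_square {z : P.cube 2} (hz : z ∈ Q.carrier 2) {a b c d : P.Vert}
    {y₁ : a ⟶ b} {y₂ : b ⟶ d} {y₃ : a ⟶ c} {y₄ : c ⟶ d} (h : IsBoundary z y₁ y₂ y₃ y₄)
    (h₁ h₂ h₃ h₄) : Sub.edgeHom hQ y₁ h₁ ≫ Sub.edgeHom hQ y₂ h₂ =
      Sub.edgeHom hQ y₃ h₃ ≫ Sub.edgeHom hQ y₄ h₄ := by
  refine PrecubicalSet.edgeHom_square (P := Q.toPrecubicalSet)
    (z := (⟨z, hz⟩ : Q.toPrecubicalSet.cube 2)) ?_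
  rcases h with ⟨e₁, e₂, e₃, e₄⟩ | ⟨e₁, e₂, e₃, e₄⟩
  · exact .inl ⟨Subtype.ext e₁, Subtype.ext e₂, Subtype.ext e₃, Subtype.ext e₄⟩
  · exact .inr ⟨Subtype.ext e₁, Subtype.ext e₂, Subtype.ext e₃, Subtype.ext e₄⟩

theorem IsBoundary.mem {z : P.cube 2} (hz : z ∈ Q.carrier 2) {a b c d : P.Vert}
    {y₁ : a ⟶ b} {y₂ : b ⟶ d} {y₃ : a ⟶ c} {y₄ : c ⟶ d} (h : IsBoundary z y₁ y₂ y₃ y₄) :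
    y₁.1 ∈ Q.carrier 1 ∧ y₂.1 ∈ Q.carrier 1 ∧ y₃.1 ∈ Q.carrier 1 ∧ y₄.1 ∈ Q.carrier 1 := by
  rcases h with ⟨e₁, e₂, e₃, e₄⟩ | ⟨e₁, e₂, e₃, e₄⟩ <;> rw [e₁, e₂, e₃, e₄] <;>
    exact ⟨Q.face_mem _ _ _ hz, Q.face_mem _ _ _ hz, Q.face_mem _ _ _ hz, Q.face_mem _ _ _ hz⟩

/-- The functor `π₁(Q) → π₁(P)` on morphisms. -/
def Sub.homMap {a b : P.Vert} (p : Sub.ob hQ a ⟶ Sub.ob hQ b) : vertexOb a ⟶ vertexOb b :=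
  Q.incl.fundamentalFunctor.map p

theorem Sub.homMap_id (a : P.Vert) : Sub.homMap hQ (𝟙 (Sub.ob hQ a)) = 𝟙 (vertexOb a) :=
  Q.incl.fundamentalFunctor.map_id _

theorem Sub.homMap_comp {a b c : P.Vert} (p : Sub.ob hQ a ⟶ Sub.ob hQ b)
    (q : Sub.ob hQ b ⟶ Sub.ob hQ c) :
    Sub.homMap hQ (p ≫ q) = Sub.homMap hQ p ≫ Sub.homMap hQ q :=
  Q.incl.fundamentalFunctor.map_comp _ _

theorem Sub.homMap_edgeHom {a b : P.Vert} (y : a ⟶ b) (hy : y.1 ∈ Q.carrier 1) :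
    Sub.homMap hQ (Sub.edgeHom hQ y hy) = PrecubicalSet.edgeHom y :=
  Paths.lift_toPath (V := Q.toPrecubicalSet.Vert) _ _

theorem Sub.hom_induction {a : P.Vert}
    {M : ∀ b : P.Vert, (Sub.ob hQ a ⟶ Sub.ob hQ b) → Prop}
    (id : M a (𝟙 _))
    (comp : ∀ (b c : P.Vert) (p : Sub.ob hQ a ⟶ Sub.ob hQ b)
      (y : b ⟶ c) (hy : y.1 ∈ Q.carrier 1), M b p → M c (p ≫ Sub.edgeHom hQ y hy))
    (b : P.Vert) (p : Sub.ob hQ a ⟶ Sub.ob hQ b) : M b p := by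
  refine PrecubicalSet.hom_induction (P := Q.toPrecubicalSet) (a := ⟨a, hQ a⟩)
    (M := fun b p => M b.1 p) id (fun b c p y h => ?_) ⟨b, hQ b⟩ p
  exact comp b.1 c.1 p ⟨y.1.1, congrArg Subtype.val y.2.1, congrArg Subtype.val y.2.2⟩ y.1.2 h

/-- If `Q` contains all edges and squares, the fundamental categories of `Q` and `P` agree. -/
theorem Sub.homMap_bijective_of_mem (h1 : ∀ y, y ∈ Q.carrier 1) (h2 : ∀ z, z ∈ Q.carrier 2)
    (a b : P.Vert) : Function.Bijective (Sub.homMap hQ : (Sub.ob hQ a ⟶ Sub.ob hQ b) → _) := by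
  obtain ⟨G, Gid, Gcomp, Gedge⟩ := exists_lift (fun a : P.Vert => Sub.ob hQ a)
    (fun y => Sub.edgeHom hQ y (h1 y.1)) (fun z _ _ _ _ _ _ _ _ h =>
      Sub.edgeHom_square hQ (h2 z) h _ _ _ _)
  refine Function.bijective_iff_has_inverse.2 ⟨G, fun p => ?_, fun q => ?_⟩
  · refine Sub.hom_induction hQ (M := fun b p => G (Sub.homMap hQ p) = p) ?_ ?_ b p
    · rw [Sub.homMap_id, Gid]
    · intro b c p y hy ih
      rw [Sub.homMap_comp, Gcomp, ih, Sub.homMap_edgeHom, Gedge]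
  · refine PrecubicalSet.hom_induction (M := fun b p => Sub.homMap hQ (G p) = p) ?_ ?_ b q
    · rw [Gid, Sub.homMap_id]
    · intro b c p y ih
      rw [Gcomp, Sub.homMap_comp, ih, Gedge, Sub.homMap_edgeHom]

end Wide

end PrecubicalSet

/-! ### Fundamental categories around a vertex with a single incoming or outgoing edge. -/

namespace PrecubicalSet

section Wide

variable {P : PrecubicalSet.{u}} {Q : P.Sub} (hQ : ∀ a, a ∈ Q.carrier 0)

/-- Let `e : w → v` be the only edge that ends in `v`, and suppose that all edges outside `Q` start
in `v`. If each of these becomes equivalent to a path in `Q` after precomposition with `e`, and the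
boundaries of the squares outside `Q` become equivalent in `Q` after precomposition with `e`, then
`π₁(Q)` and `π₁(P)` have the same morphisms between vertices other than `v`. -/
theorem Sub.homMap_bijective_of_unique_ingoing {v w : P.Vert} (e : w ⟶ v)
    (huniq : ∀ {c : P.Vert} (y : c ⟶ v), y.1 = e.1) (he : e.1 ∈ Q.carrier 1)
    (hedge : ∀ {a b : P.Vert} (y : a ⟶ b), y.1 ∉ Q.carrier 1 → a = v)
    (htgt : ∀ (z : P.cube 2) {a b c d : P.Vert} (y₁ : a ⟶ b) (y₂ : b ⟶ d) (y₃ : a ⟶ c)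
      (y₄ : c ⟶ d), IsBoundary z y₁ y₂ y₃ y₄ → d ≠ v)
    (hfirst : ∀ (z : P.cube 2) {a b c d : P.Vert} (y₁ : a ⟶ b) (y₂ : b ⟶ d) (y₃ : a ⟶ c)
      (y₄ : c ⟶ d), IsBoundary z y₁ y₂ y₃ y₄ → y₁.1 ∈ Q.carrier 1)
    (hdetour : ∀ {c a b : P.Vert} (e' : c ⟶ a) (y : a ⟶ b), a = v → y.1 ∉ Q.carrier 1 →
      ∃ ρ : Sub.ob hQ c ⟶ Sub.ob hQ b, Sub.homMap hQ ρ = PrecubicalSet.edgeHom e' ≫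
        PrecubicalSet.edgeHom y ∧ ∀ (z : P.cube 2) {d : P.Vert} (y₃ : c ⟶ d) (y₄ : d ⟶ b),
          IsBoundary z e' y y₃ y₄ → ∃ h₃ h₄, ρ = Sub.edgeHom hQ y₃ h₃ ≫ Sub.edgeHom hQ y₄ h₄)
    (hsquare : ∀ z ∉ Q.carrier 2, ∀ {a b c d : P.Vert} (y₁ : a ⟶ b) (y₂ : b ⟶ d) (y₃ : a ⟶ c)
      (y₄ : c ⟶ d), IsBoundary z y₁ y₂ y₃ y₄ → ∀ h₁ h₂ h₃ h₄, a = v ∧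
        ∀ {s : P.Vert} (e' : s ⟶ a) (h : e'.1 ∈ Q.carrier 1),
          Sub.edgeHom hQ e' h ≫ Sub.edgeHom hQ y₁ h₁ ≫ Sub.edgeHom hQ y₂ h₂ =
          Sub.edgeHom hQ e' h ≫ Sub.edgeHom hQ y₃ h₃ ≫ Sub.edgeHom hQ y₄ h₄)
    {a b : P.Vert} (ha : a ≠ v) (hb : b ≠ v) :
    Function.Bijective (Sub.homMap hQ : (Sub.ob hQ a ⟶ Sub.ob hQ b) → _) := by
  have hsrc : ∀ {c : P.Vert} (y : c ⟶ v), c = w := fun y => by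
    rw [← y.2.1, ← e.2.1, huniq y]
  have hmem : ∀ {c a : P.Vert} (y : c ⟶ a), a = v → y.1 ∈ Q.carrier 1 := by
    rintro c a y rfl
    rw [huniq y]
    exact he
  -- The inverse functor will send `v` to `w` and fix all other vertices. The comparison `ι` from
  -- the new object to the old one is `e` at `v` and the identity elsewhere; `μ` records that every
  -- edge into `v` has source `w`.
  have hex : ∀ a : P.Vert, ∃ (o : Q.toPrecubicalSet.FundamentalCategory) (ι : o ⟶ Sub.ob hQ a)
      (μ : ∀ {c : P.Vert}, (c ⟶ a) → a = v → (Sub.ob hQ c ≅ o)), (a ≠ v → IsIso ι) ∧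
      ∀ {c : P.Vert} (y : c ⟶ a) (ha : a = v) (hy : y.1 ∈ Q.carrier 1),
        (μ y ha).hom ≫ ι = Sub.edgeHom hQ y hy := by
    intro a
    by_cases ha : a = v
    · subst ha
      refine ⟨Sub.ob hQ w, Sub.edgeHom hQ e he, fun {c} y _ => eqToIso (by rw [hsrc y]),
        fun h => absurd rfl h, fun {c} y _ hy => ?_⟩
      obtain rfl := hsrc y
      obtain rfl : y = e := Subtype.ext (huniq y)
      simp
    · exact ⟨Sub.ob hQ a, 𝟙 _, fun _ h => absurd h ha, fun _ => inferInstance,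
        fun _ h => absurd h ha⟩
  choose o ι μ hι hμ using hex
  choose ρ hρ hρ' using @hdetour
  -- Edges into `v` become trivial up to `ι` and `μ`, other edges of `Q` are precomposed with `ι`,
  -- and removed edges are replaced by the detour `ρ`. The clauses express naturality of `ι` on
  -- edges of `Q` and its substitutes for edges into `v` and for removed edges.
  have hγ : ∀ (a b : P.Vert) (y : a ⟶ b), ∃ γ : o a ⟶ o b,
      (∀ hy, γ ≫ ι b = ι a ≫ Sub.edgeHom hQ y hy) ∧ (∀ h : b = v, γ = ι a ≫ (μ b y h).hom) ∧
      ∀ {c : P.Vert} (e' : c ⟶ a) (h : a = v) (hy : y.1 ∉ Q.carrier 1),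
        (μ a e' h).hom ≫ γ ≫ ι b = ρ e' y h hy := by
    intro a b y
    by_cases hb : b = v
    · refine ⟨ι a ≫ (μ b y hb).hom, fun hy => ?_, fun _ => rfl, fun _ _ hy => absurd (hmem y hb) hy⟩
      rw [Category.assoc, hμ _ _ _ hy]
    · have := hι b hb
      by_cases hy : y.1 ∈ Q.carrier 1
      · exact ⟨ι a ≫ Sub.edgeHom hQ y hy ≫ inv (ι b), fun _ => by simp, fun h => absurd h hb,
          fun _ _ h => absurd hy h⟩
      · obtain rfl := hedge y hy
        refine ⟨(μ a e rfl).inv ≫ ρ e y rfl hy ≫ inv (ι b), fun h => absurd h hy,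
          fun h => absurd h hb, fun {c} e' _ _ => ?_⟩
        obtain rfl := hsrc e'
        obtain rfl : e' = e := Subtype.ext (huniq e')
        simp
  choose γ hγ1 hγ2 hγ3 using hγ
  have key : ∀ {a b c d : P.Vert} (y₁ : a ⟶ b) (y₂ : b ⟶ d) (y₃ : a ⟶ c) (y₄ : c ⟶ d)
      (z : P.cube 2), IsBoundary z y₁ y₂ y₃ y₄ → y₂.1 ∉ Q.carrier 1 →
      (γ _ _ y₁ ≫ γ _ _ y₂) ≫ ι d = (γ _ _ y₃ ≫ γ _ _ y₄) ≫ ι d := by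
    intro a b c d y₁ y₂ y₃ y₄ z h h₂
    obtain rfl := hedge y₂ h₂
    obtain ⟨h₃, h₄, e'⟩ := hρ' y₁ y₂ rfl h₂ z y₃ y₄ h
    rw [Category.assoc, Category.assoc, hγ1 _ _ y₄ h₄, reassoc_of% (hγ1 _ _ y₃ h₃), ← e',
      hγ2 _ _ y₁ rfl, Category.assoc, hγ3 _ _ y₂ y₁ rfl h₂]
  obtain ⟨G, Gid, Gcomp, Gedge⟩ := exists_lift o (fun {a b} y => γ a b y) (by
    intro z a b c d y₁ y₂ y₃ y₄ h
    have := hι d (htgt z y₁ y₂ y₃ y₄ h)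
    -- No square ends in `v`, so `ι` is invertible at the last vertex and the relation may be
    -- checked after composing with it.
    rw [← cancel_mono (ι d)]
    by_cases h₂ : y₂.1 ∈ Q.carrier 1
    swap
    · exact key y₁ y₂ y₃ y₄ z h h₂
    by_cases h₄ : y₄.1 ∈ Q.carrier 1
    swap
    · exact (key y₃ y₄ y₁ y₂ z h.symm h₄).symm
    have h₁ := hfirst z y₁ y₂ y₃ y₄ h
    have h₃ := hfirst z y₃ y₄ y₁ y₂ h.symm
    rw [Category.assoc, Category.assoc, hγ1 _ _ y₄ h₄, reassoc_of% (hγ1 _ _ y₃ h₃),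
      hγ1 _ _ y₂ h₂, reassoc_of% (hγ1 _ _ y₁ h₁)]
    by_cases hz : z ∈ Q.carrier 2
    · rw [Sub.edgeHom_square hQ hz h h₁ h₂ h₃ h₄]
    · obtain ⟨rfl, hs⟩ := hsquare z hz y₁ y₂ y₃ y₄ h h₁ h₂ h₃ h₄
      rw [← cancel_epi (μ a e rfl).hom, reassoc_of% (hμ a e rfl he), reassoc_of% (hμ a e rfl he)]
      exact hs e he)
  have := hι a ha
  have := hι b hb
  -- This is naturality of `ι` from the composite of the inclusion with `G` to the identity of
  -- `π₁(Q)`.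
  have h1 : ∀ p : Sub.ob hQ a ⟶ Sub.ob hQ b, G (Sub.homMap hQ p) ≫ ι b = ι a ≫ p := by
    refine Sub.hom_induction hQ (M := fun b p => G (Sub.homMap hQ p) ≫ ι b = ι a ≫ p) ?_ ?_ b
    · rw [Sub.homMap_id, Gid]; simp
    · intro b c p y hy ih
      rw [Sub.homMap_comp, Gcomp, Sub.homMap_edgeHom, Gedge, Category.assoc, hγ1 _ _ _ hy,
        reassoc_of% ih]
  refine Function.bijective_iff_has_inverse.2 ⟨fun q => inv (ι a) ≫ G q ≫ ι b, fun p => ?_,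
    fun q => ?_⟩
  · simp only
    rw [h1, IsIso.inv_hom_id_assoc]
  -- The induction runs over all end vertices, including `v`. A removed edge can only be appended at
  -- `v`, where the previous morphism already factors through `e`, and `e` followed by that edge is
  -- the image of the detour.
  · refine PrecubicalSet.hom_induction
      (M := fun b q => Sub.homMap hQ (inv (ι a) ≫ G q ≫ ι b) = q) ?_ ?_ b q
    · rw [Gid, Category.id_comp, IsIso.inv_hom_id, Sub.homMap_id]
    · intro b c q y ih
      rw [Gcomp, Gedge, Category.assoc]
      by_cases hy : y.1 ∈ Q.carrier 1
      · rw [hγ1 _ _ y hy]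
        simp only [← Category.assoc, Sub.homMap_comp _ _ (Sub.edgeHom hQ y hy)]
        simp only [Category.assoc, ih, Sub.homMap_edgeHom]
      · obtain rfl := hedge y hy
        have e1 : inv (ι a) ≫ G q ≫ γ b c y ≫ ι c =
            (inv (ι a) ≫ G q ≫ (μ b e rfl).inv) ≫ ρ e y rfl hy := by
          rw [← hγ3 _ _ y e rfl hy]
          simp
        have e2 : inv (ι a) ≫ G q ≫ ι b =
            (inv (ι a) ≫ G q ≫ (μ b e rfl).inv) ≫ Sub.edgeHom hQ e he := by
          rw [← hμ b e rfl he]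
          simp
        rw [e2, Sub.homMap_comp, Sub.homMap_edgeHom] at ih
        rw [e1, Sub.homMap_comp, hρ, ← Category.assoc, ih]

/-- The dual of `Sub.homMap_bijective_of_unique_ingoing`. -/
theorem Sub.homMap_bijective_of_unique_outgoing {v w : P.Vert} (e : v ⟶ w)
    (huniq : ∀ {c : P.Vert} (y : v ⟶ c), y.1 = e.1) (he : e.1 ∈ Q.carrier 1)
    (hedge : ∀ {a b : P.Vert} (y : a ⟶ b), y.1 ∉ Q.carrier 1 → b = v)
    (hsrc' : ∀ (z : P.cube 2) {a b c d : P.Vert} (y₁ : a ⟶ b) (y₂ : b ⟶ d) (y₃ : a ⟶ c)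
      (y₄ : c ⟶ d), IsBoundary z y₁ y₂ y₃ y₄ → a ≠ v)
    (hlast : ∀ (z : P.cube 2) {a b c d : P.Vert} (y₁ : a ⟶ b) (y₂ : b ⟶ d) (y₃ : a ⟶ c)
      (y₄ : c ⟶ d), IsBoundary z y₁ y₂ y₃ y₄ → y₂.1 ∈ Q.carrier 1)
    (hdetour : ∀ {a b c : P.Vert} (y : a ⟶ b) (e' : b ⟶ c), b = v → y.1 ∉ Q.carrier 1 →
      ∃ ρ : Sub.ob hQ a ⟶ Sub.ob hQ c, Sub.homMap hQ ρ = PrecubicalSet.edgeHom y ≫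
        PrecubicalSet.edgeHom e' ∧ ∀ (z : P.cube 2) {d : P.Vert} (y₃ : a ⟶ d) (y₄ : d ⟶ c),
          IsBoundary z y e' y₃ y₄ → ∃ h₃ h₄, ρ = Sub.edgeHom hQ y₃ h₃ ≫ Sub.edgeHom hQ y₄ h₄)
    (hsquare : ∀ z ∉ Q.carrier 2, ∀ {a b c d : P.Vert} (y₁ : a ⟶ b) (y₂ : b ⟶ d) (y₃ : a ⟶ c)
      (y₄ : c ⟶ d), IsBoundary z y₁ y₂ y₃ y₄ → ∀ h₁ h₂ h₃ h₄, d = v ∧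
        ∀ {s : P.Vert} (e' : d ⟶ s) (h : e'.1 ∈ Q.carrier 1),
          (Sub.edgeHom hQ y₁ h₁ ≫ Sub.edgeHom hQ y₂ h₂) ≫ Sub.edgeHom hQ e' h =
          (Sub.edgeHom hQ y₃ h₃ ≫ Sub.edgeHom hQ y₄ h₄) ≫ Sub.edgeHom hQ e' h)
    {a b : P.Vert} (ha : a ≠ v) (hb : b ≠ v) :
    Function.Bijective (Sub.homMap hQ : (Sub.ob hQ a ⟶ Sub.ob hQ b) → _) := by
  have htgt : ∀ {c : P.Vert} (y : v ⟶ c), c = w := fun y => by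
    rw [← y.2.2, ← e.2.2, huniq y]
  have hmem : ∀ {c a : P.Vert} (y : a ⟶ c), a = v → y.1 ∈ Q.carrier 1 := by
    rintro c a y rfl
    rw [huniq y]
    exact he
  -- Here `v` is pushed forward along the unique edge leaving it, so `ι` goes from the old object to
  -- the new one.
  have hex : ∀ a : P.Vert, ∃ (o : Q.toPrecubicalSet.FundamentalCategory) (ι : Sub.ob hQ a ⟶ o)
      (μ : ∀ {c : P.Vert}, (a ⟶ c) → a = v → (Sub.ob hQ c ≅ o)), (a ≠ v → IsIso ι) ∧
      ∀ {c : P.Vert} (y : a ⟶ c) (ha : a = v) (hy : y.1 ∈ Q.carrier 1),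
        ι = Sub.edgeHom hQ y hy ≫ (μ y ha).hom := by
    intro a
    by_cases ha : a = v
    · subst ha
      refine ⟨Sub.ob hQ w, Sub.edgeHom hQ e he, fun {c} y _ => eqToIso (by rw [htgt y]),
        fun h => absurd rfl h, fun {c} y _ hy => ?_⟩
      obtain rfl := htgt y
      obtain rfl : y = e := Subtype.ext (huniq y)
      simp
    · exact ⟨Sub.ob hQ a, 𝟙 _, fun _ h => absurd h ha, fun _ => inferInstance,
        fun _ h => absurd h ha⟩
  choose o ι μ hι hμ using hex
  choose ρ hρ hρ' using @hdetour
  have hγ : ∀ (a b : P.Vert) (y : a ⟶ b), ∃ γ : o a ⟶ o b,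
      (∀ hy, ι a ≫ γ = Sub.edgeHom hQ y hy ≫ ι b) ∧ (∀ h : a = v, γ = (μ a y h).inv ≫ ι b) ∧
      ∀ {c : P.Vert} (e' : b ⟶ c) (h : b = v) (hy : y.1 ∉ Q.carrier 1),
        ι a ≫ γ = ρ y e' h hy ≫ (μ b e' h).hom := by
    intro a b y
    by_cases ha : a = v
    · refine ⟨(μ a y ha).inv ≫ ι b, fun hy => ?_, fun _ => rfl, fun _ _ hy => absurd (hmem y ha) hy⟩
      rw [hμ _ y ha hy]
      simp
    · have := hι a ha
      by_cases hy : y.1 ∈ Q.carrier 1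
      · exact ⟨inv (ι a) ≫ Sub.edgeHom hQ y hy ≫ ι b, fun _ => by simp, fun h => absurd h ha,
          fun _ _ h => absurd hy h⟩
      · obtain rfl := hedge y hy
        refine ⟨inv (ι a) ≫ ρ y e rfl hy ≫ (μ b e rfl).hom, fun h => absurd h hy,
          fun h => absurd h ha, fun {c} e' _ _ => ?_⟩
        obtain rfl := htgt e'
        obtain rfl : e' = e := Subtype.ext (huniq e')
        simp
  choose γ hγ1 hγ2 hγ3 using hγ
  have key : ∀ {a b c d : P.Vert} (y₁ : a ⟶ b) (y₂ : b ⟶ d) (y₃ : a ⟶ c) (y₄ : c ⟶ d)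
      (z : P.cube 2), IsBoundary z y₁ y₂ y₃ y₄ → y₁.1 ∉ Q.carrier 1 →
      ι a ≫ γ _ _ y₁ ≫ γ _ _ y₂ = ι a ≫ γ _ _ y₃ ≫ γ _ _ y₄ := by
    intro a b c d y₁ y₂ y₃ y₄ z h h₁
    obtain rfl := hedge y₁ h₁
    obtain ⟨h₃, h₄, e'⟩ := hρ' y₁ y₂ rfl h₁ z y₃ y₄ h
    rw [reassoc_of% (hγ1 _ _ y₃ h₃), hγ1 _ _ y₄ h₄, ← Category.assoc (Sub.edgeHom hQ y₃ h₃), ← e',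
      hγ2 _ _ y₂ rfl, reassoc_of% (hγ3 _ _ y₁ y₂ rfl h₁), Iso.hom_inv_id_assoc]
  obtain ⟨G, Gid, Gcomp, Gedge⟩ := exists_lift o (fun {a b} y => γ a b y) (by
    intro z a b c d y₁ y₂ y₃ y₄ h
    have := hι a (hsrc' z y₁ y₂ y₃ y₄ h)
    rw [← cancel_epi (ι a)]
    by_cases h₁ : y₁.1 ∈ Q.carrier 1
    swap
    · exact key y₁ y₂ y₃ y₄ z h h₁
    by_cases h₃ : y₃.1 ∈ Q.carrier 1
    swap
    · exact (key y₃ y₄ y₁ y₂ z h.symm h₃).symm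
    have h₂ := hlast z y₁ y₂ y₃ y₄ h
    have h₄ := hlast z y₃ y₄ y₁ y₂ h.symm
    rw [reassoc_of% (hγ1 _ _ y₃ h₃), hγ1 _ _ y₄ h₄, reassoc_of% (hγ1 _ _ y₁ h₁),
      hγ1 _ _ y₂ h₂, ← Category.assoc, ← Category.assoc]
    by_cases hz : z ∈ Q.carrier 2
    · rw [Sub.edgeHom_square hQ hz h h₁ h₂ h₃ h₄]
    · obtain ⟨rfl, hs⟩ := hsquare z hz y₁ y₂ y₃ y₄ h h₁ h₂ h₃ h₄
      rw [hμ d e rfl he, ← Category.assoc, hs e he, Category.assoc])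
  have := hι a ha
  have := hι b hb
  have h1 : ∀ p : Sub.ob hQ a ⟶ Sub.ob hQ b, ι a ≫ G (Sub.homMap hQ p) = p ≫ ι b := by
    refine Sub.hom_induction hQ (M := fun b p => ι a ≫ G (Sub.homMap hQ p) = p ≫ ι b) ?_ ?_ b
    · rw [Sub.homMap_id, Gid]; simp
    · intro b c p y hy ih
      rw [Sub.homMap_comp, Gcomp, Sub.homMap_edgeHom, Gedge, reassoc_of% ih, hγ1 _ _ _ hy,
        Category.assoc]
  refine Function.bijective_iff_has_inverse.2 ⟨fun q => ι a ≫ G q ≫ inv (ι b), fun p => ?_,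
    fun q => ?_⟩
  · simp only
    rw [reassoc_of% (h1 p), IsIso.hom_inv_id, Category.comp_id]
  -- The induction adds edges at the end, and at an intermediate vertex `v` the morphism `ι` cannot
  -- be inverted. The claim is therefore proved for an arbitrary continuation `j` in `Q` and used
  -- with the inverse of `ι b`.
  · have h2 : ∀ (s : P.Vert) (j : o b ⟶ Sub.ob hQ s),
        Sub.homMap hQ (ι a ≫ G q ≫ j) = q ≫ Sub.homMap hQ (ι b ≫ j) := by
      refine PrecubicalSet.hom_induction (M := fun b q => ∀ (s : P.Vert) (j : o b ⟶ Sub.ob hQ s),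
        Sub.homMap hQ (ι a ≫ G q ≫ j) = q ≫ Sub.homMap hQ (ι b ≫ j)) ?_ ?_ b q
      · intro s j
        rw [Gid, Category.id_comp, Category.id_comp]
      · intro b c q y ih s j
        rw [Gcomp, Gedge, Category.assoc, ih, Category.assoc]
        congr 1
        by_cases hy : y.1 ∈ Q.carrier 1
        · rw [reassoc_of% (hγ1 _ _ y hy), Sub.homMap_comp, Sub.homMap_edgeHom]
        · obtain rfl := hedge y hy
          rw [reassoc_of% (hγ3 _ _ y e rfl hy), Sub.homMap_comp, hρ, hμ c e rfl he, Category.assoc,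
            Category.assoc, Sub.homMap_comp hQ (Sub.edgeHom hQ e he), Sub.homMap_edgeHom]
    simp only
    rw [h2, IsIso.hom_inv_id, Sub.homMap_id, Category.comp_id]

end Wide

end PrecubicalSet

namespace PrecubicalSet

/-! ### The faces of a three-dimensional cube -/

section Hexagon

variable {C : Type u} [Category.{v} C]

/-- Five commuting faces of a cube give the sixth one after precomposition with the edge from the
first vertex of the cube to the first vertex of that face. The five squares are traversed one after
another. -/
theorem hexagon_precomp {W V A B D X Y Z : C} {e : W ⟶ V} {a₁ : V ⟶ A} {a₂ : A ⟶ D} {b₁ : V ⟶ B}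
    {b₂ : B ⟶ D} {u : W ⟶ X} {p : X ⟶ A} {s : W ⟶ Y} {m : Y ⟶ B} {q : X ⟶ Z} {r : Y ⟶ Z}
    {t : Z ⟶ D} (h₁ : e ≫ a₁ = u ≫ p) (h₂ : p ≫ a₂ = q ≫ t) (h₃ : u ≫ q = s ≫ r)
    (h₄ : r ≫ t = m ≫ b₂) (h₅ : s ≫ m = e ≫ b₁) : e ≫ a₁ ≫ a₂ = e ≫ b₁ ≫ b₂ := by
  rw [reassoc_of% h₁, h₂, reassoc_of% h₃, h₄, reassoc_of% h₅]

theorem hexagon_postcomp {W V A B D X Y Z : C} {e : V ⟶ D} {a₁ : W ⟶ A} {a₂ : A ⟶ V} {b₁ : W ⟶ B}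
    {b₂ : B ⟶ V} {p : A ⟶ X} {q : X ⟶ D} {u : W ⟶ Y} {r : Y ⟶ X} {s : Y ⟶ Z} {t : Z ⟶ D}
    {m : B ⟶ Z} (h₁ : a₂ ≫ e = p ≫ q) (h₂ : a₁ ≫ p = u ≫ r) (h₃ : r ≫ q = s ≫ t)
    (h₄ : u ≫ s = b₁ ≫ m) (h₅ : m ≫ t = b₂ ≫ e) : (a₁ ≫ a₂) ≫ e = (b₁ ≫ b₂) ≫ e := by
  rw [Category.assoc, h₁, reassoc_of% h₂, h₃, reassoc_of% h₄, h₅, Category.assoc]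

end Hexagon

section Cube

variable {P : PrecubicalSet.{u}} (x : P.cube 3)

/-- The vertex `(p, q, r)` of a three-dimensional cube. -/
def cubeVertex (p q r : Bool) : P.Vert := P.face p 0 (P.face q 1 (P.face r 2 x))

/-- The edge from `(0, q, r)` to `(1, q, r)`. -/
def cubeEdge₀ (q r : Bool) : cubeVertex x false q r ⟶ cubeVertex x true q r :=
  ⟨P.face q 1 (P.face r 2 x), rfl, rfl⟩

/-- The edge from `(p, 0, r)` to `(p, 1, r)`. -/
def cubeEdge₁ (p r : Bool) : cubeVertex x p false r ⟶ cubeVertex x p true r :=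
  ⟨P.face p 0 (P.face r 2 x), (P.face_face p _ 0 0 le_rfl _).symm,
    (P.face_face p _ 0 0 le_rfl _).symm⟩

theorem face_cubeEdge₂ (p q l : Bool) :
    P.face l 0 (P.face p 0 (P.face q 1 x)) = cubeVertex x p q l := by
  have h : P.face q 1 (P.face l 2 x) = P.face l 1 (P.face q 1 x) := P.face_face q l 1 1 le_rfl x
  rw [cubeVertex, h]
  exact (P.face_face p l 0 0 le_rfl _).symm

/-- The edge from `(p, q, 0)` to `(p, q, 1)`. -/
def cubeEdge₂ (p q : Bool) : cubeVertex x p q false ⟶ cubeVertex x p q true :=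
  ⟨P.face p 0 (P.face q 1 x), face_cubeEdge₂ x p q false, face_cubeEdge₂ x p q true⟩

theorem isBoundary_face₀ (p : Bool) : IsBoundary (P.face p 0 x) (cubeEdge₂ x p false)
    (cubeEdge₁ x p true) (cubeEdge₁ x p false) (cubeEdge₂ x p true) :=
  .inl ⟨P.face_face p _ 0 0 le_rfl x, P.face_face p _ 0 1 (Fin.zero_le _) x,
    P.face_face p _ 0 1 (Fin.zero_le _) x, P.face_face p _ 0 0 le_rfl x⟩

theorem isBoundary_face₁ (q : Bool) : IsBoundary (P.face q 1 x) (cubeEdge₂ x false q)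
    (cubeEdge₀ x q true) (cubeEdge₀ x q false) (cubeEdge₂ x true q) :=
  .inl ⟨rfl, P.face_face q _ 1 1 le_rfl x, P.face_face q _ 1 1 le_rfl x, rfl⟩

theorem isBoundary_face₂ (r : Bool) : IsBoundary (P.face r 2 x) (cubeEdge₁ x false r)
    (cubeEdge₀ x true r) (cubeEdge₀ x false r) (cubeEdge₁ x true r) :=
  .inl ⟨rfl, rfl, rfl, rfl⟩

end Cube

theorem face_face_of_ne {P : PrecubicalSet.{u}} (z : P.cube 2) (k l : Bool) {p q : Fin 2}
    (h : p ≠ q) : P.face l 0 (P.face k p z) = P.face k 0 (P.face l q z) := by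
  obtain ⟨rfl, rfl⟩ | ⟨rfl, rfl⟩ : (p = 0 ∧ q = 1) ∨ (p = 1 ∧ q = 0) := by omega
  · exact (P.face_face k l 0 0 le_rfl z).symm
  · exact P.face_face l k 0 0 le_rfl z

section Boundary

variable {P : PrecubicalSet.{u}} {z : P.cube 2} {a b c d : P.Vert} {y₁ : a ⟶ b} {y₂ : b ⟶ d}
  {y₃ : a ⟶ c} {y₄ : c ⟶ d}

theorem isBoundary_iff : IsBoundary z y₁ y₂ y₃ y₄ ↔ ∃ p q : Fin 2, p ≠ q ∧
    y₁.1 = P.face false p z ∧ y₂.1 = P.face true q z ∧ y₃.1 = P.face false q z ∧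
    y₄.1 = P.face true p z := by
  constructor
  · rintro (⟨h₁, h₂, h₃, h₄⟩ | ⟨h₁, h₂, h₃, h₄⟩)
    · exact ⟨0, 1, by decide, h₁, h₂, h₃, h₄⟩
    · exact ⟨1, 0, by decide, h₃, h₄, h₁, h₂⟩
  · rintro ⟨p, q, h, h₁, h₂, h₃, h₄⟩
    obtain ⟨rfl, rfl⟩ | ⟨rfl, rfl⟩ : (p = 0 ∧ q = 1) ∨ (p = 1 ∧ q = 0) := by omega
    · exact .inl ⟨h₁, h₂, h₃, h₄⟩
    · exact .inr ⟨h₃, h₄, h₁, h₂⟩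

theorem IsBoundary.source_eq (h : IsBoundary z y₁ y₂ y₃ y₄) : a = P.corner false z := by
  obtain ⟨p, q, -, h₁, -⟩ := isBoundary_iff.1 h
  rw [← y₁.2.1, h₁]
  exact P.corner_face false p z

theorem IsBoundary.target_eq (h : IsBoundary z y₁ y₂ y₃ y₄) : d = P.corner true z := by
  obtain ⟨p, q, -, -, h₂, -⟩ := isBoundary_iff.1 h
  rw [← y₂.2.2, h₂]
  exact P.corner_face true q z

theorem vert_eq_of_val_eq {a b a' b' : P.Vert} {y : a ⟶ b} {y' : a' ⟶ b'} (h : y.1 = y'.1) :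
    a = a' ∧ b = b' :=
  ⟨by rw [← y.2.1, ← y'.2.1, h], by rw [← y.2.2, ← y'.2.2, h]⟩

/-- The boundary of a square is determined up to exchanging the two paths. A symmetric property
therefore needs to be checked only for one presentation, such as the coordinate one inside a 3-cube.
-/
theorem IsBoundary.transport (M : ∀ {a b c d : P.Vert}, (a ⟶ b) → (b ⟶ d) → (a ⟶ c) → (c ⟶ d) →
      Prop) (hM : ∀ {a b c d : P.Vert} {y₁ : a ⟶ b} {y₂ : b ⟶ d} {y₃ : a ⟶ c} {y₄ : c ⟶ d},
      M y₁ y₂ y₃ y₄ → M y₃ y₄ y₁ y₂)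
    (h : IsBoundary z y₁ y₂ y₃ y₄) {a' b' c' d' : P.Vert} {y₁' : a' ⟶ b'} {y₂' : b' ⟶ d'}
    {y₃' : a' ⟶ c'} {y₄' : c' ⟶ d'} (h' : IsBoundary z y₁' y₂' y₃' y₄') (hm : M y₁ y₂ y₃ y₄) :
    M y₁' y₂' y₃' y₄' := by
  wlog hl : y₁.1 = P.face false 0 z ∧ y₂.1 = P.face true 1 z ∧
    y₃.1 = P.face false 1 z ∧ y₄.1 = P.face true 0 z generalizing b c
  · exact this h.symm (hM hm) (h.resolve_left hl)
  wlog hl' : y₁'.1 = P.face false 0 z ∧ y₂'.1 = P.face true 1 z ∧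
    y₃'.1 = P.face false 1 z ∧ y₄'.1 = P.face true 0 z generalizing b' c'
  · exact hM (this h'.symm (h'.resolve_left hl'))
  obtain ⟨h₁, h₂, h₃, h₄⟩ := hl
  obtain ⟨h₁', h₂', h₃', h₄'⟩ := hl'
  have e₁ := h₁.trans h₁'.symm
  have e₂ := h₂.trans h₂'.symm
  have e₃ := h₃.trans h₃'.symm
  have e₄ := h₄.trans h₄'.symm
  obtain ⟨rfl, rfl⟩ := vert_eq_of_val_eq e₁
  obtain ⟨-, rfl⟩ := vert_eq_of_val_eq e₂
  obtain ⟨-, rfl⟩ := vert_eq_of_val_eq e₃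
  obtain rfl : y₁ = y₁' := Subtype.ext e₁
  obtain rfl : y₂ = y₂' := Subtype.ext e₂
  obtain rfl : y₃ = y₃' := Subtype.ext e₃
  obtain rfl : y₄ = y₄' := Subtype.ext e₄
  exact hm

end Boundary

namespace IsFreeCube

variable {P : PrecubicalSet.{u}} {n : ℕ} {k : Bool}

theorem vertex_mem {x : P.cube (n + 1)} {i : Fin (n + 1)} (h : P.IsFreeCube x k i) (a : P.cube 0) :
    a ∈ (P.removeStar (P.face k i x)).carrier 0 := h.mem_of_lt h.pos a

/-- All edges and the other five faces of `x` lie in `Q`, so the hexagon argument takes place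
entirely in `π₁(Q)`. In each of the three directions `e` is the edge of `x` in direction `i` at its
first vertex. -/
theorem exists_canonical_hexagon_precomp {x : P.cube 3} {i : Fin 3}
    (h : P.IsFreeCube x true i) :
    ∃ (s a b c d : P.Vert) (e : s ⟶ a) (y₁ : a ⟶ b) (y₂ : b ⟶ d) (y₃ : a ⟶ c) (y₄ : c ⟶ d),
      IsBoundary (P.face true i x) y₁ y₂ y₃ y₄ ∧ ∀ h₀ h₁ h₂ h₃ h₄,
        Sub.edgeHom h.vertex_mem e h₀ ≫ Sub.edgeHom h.vertex_mem y₁ h₁ ≫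
          Sub.edgeHom h.vertex_mem y₂ h₂ =
        Sub.edgeHom h.vertex_mem e h₀ ≫ Sub.edgeHom h.vertex_mem y₃ h₃ ≫
          Sub.edgeHom h.vertex_mem y₄ h₄ := by
  have hm : ∀ y : P.cube 1, y ∈ (P.removeStar (P.face true i x)).carrier 1 :=
    h.mem_of_lt one_lt_two
  have sq := fun (l : Bool) (m : Fin 3) (hlm : (l, m) ≠ (true, i)) {a b c d : P.Vert}
    {y₁ : a ⟶ b} {y₂ : b ⟶ d} {y₃ : a ⟶ c} {y₄ : c ⟶ d}
    (hb : IsBoundary (P.face l m x) y₁ y₂ y₃ y₄) =>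
    Sub.edgeHom_square h.vertex_mem (h.face_mem hlm) hb (hm _) (hm _) (hm _) (hm _)
  match i, h, hm, sq with
  | 0, h, hm, sq =>
    refine ⟨_, _, _, _, _, cubeEdge₀ x false false, _, _, _, _, isBoundary_face₀ x true,
      fun _ _ _ _ _ => ?_⟩
    exact hexagon_precomp (sq false 1 (by simp) (isBoundary_face₁ x false).symm)
      (sq true 2 (by decide) (isBoundary_face₂ x true).symm)
      (sq false 0 (by simp) (isBoundary_face₀ x false))
      (sq true 1 (by decide) (isBoundary_face₁ x true))
      (sq false 2 (by simp) (isBoundary_face₂ x false))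
  | 1, h, hm, sq =>
    refine ⟨_, _, _, _, _, cubeEdge₁ x false false, _, _, _, _, isBoundary_face₁ x true,
      fun _ _ _ _ _ => ?_⟩
    exact hexagon_precomp (sq false 0 (by simp) (isBoundary_face₀ x false).symm)
      (sq true 2 (by decide) (isBoundary_face₂ x true))
      (sq false 1 (by simp) (isBoundary_face₁ x false))
      (sq true 0 (by decide) (isBoundary_face₀ x true))
      (sq false 2 (by simp) (isBoundary_face₂ x false).symm)
  | 2, h, hm, sq =>
    refine ⟨_, _, _, _, _, cubeEdge₂ x false false, _, _, _, _, isBoundary_face₂ x true,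
      fun _ _ _ _ _ => ?_⟩
    exact hexagon_precomp (sq false 0 (by simp) (isBoundary_face₀ x false))
      (sq true 1 (by decide) (isBoundary_face₁ x true))
      (sq false 2 (by simp) (isBoundary_face₂ x false))
      (sq true 0 (by decide) (isBoundary_face₀ x true).symm)
      (sq false 1 (by simp) (isBoundary_face₁ x false).symm)

theorem exists_canonical_hexagon_postcomp {x : P.cube 3} {i : Fin 3}
    (h : P.IsFreeCube x false i) :
    ∃ (s a b c d : P.Vert) (e : d ⟶ s) (y₁ : a ⟶ b) (y₂ : b ⟶ d) (y₃ : a ⟶ c) (y₄ : c ⟶ d),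
      IsBoundary (P.face false i x) y₁ y₂ y₃ y₄ ∧ ∀ h₀ h₁ h₂ h₃ h₄,
        (Sub.edgeHom h.vertex_mem y₁ h₁ ≫ Sub.edgeHom h.vertex_mem y₂ h₂) ≫
          Sub.edgeHom h.vertex_mem e h₀ =
        (Sub.edgeHom h.vertex_mem y₃ h₃ ≫ Sub.edgeHom h.vertex_mem y₄ h₄) ≫
          Sub.edgeHom h.vertex_mem e h₀ := by
  have hm : ∀ y : P.cube 1, y ∈ (P.removeStar (P.face false i x)).carrier 1 :=
    h.mem_of_lt one_lt_two
  have sq := fun (l : Bool) (m : Fin 3) (hlm : (l, m) ≠ (false, i)) {a b c d : P.Vert}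
    {y₁ : a ⟶ b} {y₂ : b ⟶ d} {y₃ : a ⟶ c} {y₄ : c ⟶ d}
    (hb : IsBoundary (P.face l m x) y₁ y₂ y₃ y₄) =>
    Sub.edgeHom_square h.vertex_mem (h.face_mem hlm) hb (hm _) (hm _) (hm _) (hm _)
  match i, h, hm, sq with
  | 0, h, hm, sq =>
    refine ⟨_, _, _, _, _, cubeEdge₀ x true true, _, _, _, _, isBoundary_face₀ x false,
      fun _ _ _ _ _ => ?_⟩
    exact hexagon_postcomp (sq true 2 (by simp) (isBoundary_face₂ x true))
      (sq false 1 (by decide) (isBoundary_face₁ x false))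
      (sq true 0 (by simp) (isBoundary_face₀ x true))
      (sq false 2 (by decide) (isBoundary_face₂ x false).symm)
      (sq true 1 (by simp) (isBoundary_face₁ x true).symm)
  | 1, h, hm, sq =>
    refine ⟨_, _, _, _, _, cubeEdge₁ x true true, _, _, _, _, isBoundary_face₁ x false,
      fun _ _ _ _ _ => ?_⟩
    exact hexagon_postcomp (sq true 2 (by simp) (isBoundary_face₂ x true).symm)
      (sq false 0 (by decide) (isBoundary_face₀ x false))
      (sq true 1 (by simp) (isBoundary_face₁ x true))
      (sq false 2 (by decide) (isBoundary_face₂ x false))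
      (sq true 0 (by simp) (isBoundary_face₀ x true).symm)
  | 2, h, hm, sq =>
    refine ⟨_, _, _, _, _, cubeEdge₂ x true true, _, _, _, _, isBoundary_face₂ x false,
      fun _ _ _ _ _ => ?_⟩
    exact hexagon_postcomp (sq true 1 (by simp) (isBoundary_face₁ x true).symm)
      (sq false 0 (by decide) (isBoundary_face₀ x false).symm)
      (sq true 2 (by simp) (isBoundary_face₂ x true))
      (sq false 1 (by decide) (isBoundary_face₁ x false))
      (sq true 0 (by simp) (isBoundary_face₀ x true))

end IsFreeCube

end PrecubicalSet

/-! ### Comparison of fundamental categories after removing a free face. -/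

namespace PrecubicalSet

namespace IsFreeCube

variable {P : PrecubicalSet.{u}} {n : ℕ} {k : Bool}

theorem eq_self_of_notMem {x : P.cube (n + 1)} {i : Fin (n + 1)} (h : P.IsFreeCube x k i)
    {y : P.cube (n + 1)} (hy : y ∉ (P.removeStar (P.face k i x)).carrier (n + 1)) : y = x := by
  rcases h.ne_of_notMem hy with e | e
  · exact eq_of_heq (Sigma.mk.inj e).2
  · exact absurd (Sigma.mk.inj e).1 (by omega)

theorem eq_face_of_notMem {x : P.cube (n + 1)} {i : Fin (n + 1)} (h : P.IsFreeCube x k i)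
    {y : P.cube n} (hy : y ∉ (P.removeStar (P.face k i x)).carrier n) : y = P.face k i x := by
  rcases h.ne_of_notMem hy with e | e
  · exact absurd (Sigma.mk.inj e).1 (by omega)
  · exact eq_of_heq (Sigma.mk.inj e).2

/-- The last two edges of a square ending in `v` would both be `e^k_i x`, while weak regularity
makes them distinct. -/
theorem target_ne {x : P.cube (n + 1)} {i : Fin (n + 1)} (h : P.IsFreeCube x true i)
    {z : P.cube 2} {a b c d : P.Vert} {y₁ : a ⟶ b} {y₂ : b ⟶ d} {y₃ : a ⟶ c} {y₄ : c ⟶ d}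
    (hb : IsBoundary z y₁ y₂ y₃ y₄) : d ≠ P.corner false (P.face true i x) := by
  rintro rfl
  have e₂ := h.edge_unique _ y₂.2.2
  have e₄ := h.edge_unique _ y₄.2.2
  have hw := h.weaklyRegular.face_ne true z
  rcases hb with ⟨-, h₂, -, h₄⟩ | ⟨-, h₄, -, h₂⟩
  · exact hw (by rw [← h₂, ← h₄, e₂, e₄])
  · exact hw (by rw [← h₂, ← h₄, e₂, e₄])

theorem source_ne {x : P.cube (n + 1)} {i : Fin (n + 1)} (h : P.IsFreeCube x false i)
    {z : P.cube 2} {a b c d : P.Vert} {y₁ : a ⟶ b} {y₂ : b ⟶ d} {y₃ : a ⟶ c} {y₄ : c ⟶ d}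
    (hb : IsBoundary z y₁ y₂ y₃ y₄) : a ≠ P.corner true (P.face false i x) := by
  rintro rfl
  have e₁ := h.edge_unique _ y₁.2.1
  have e₃ := h.edge_unique _ y₃.2.1
  have hw := h.weaklyRegular.face_ne false z
  rcases hb with ⟨h₁, -, h₃, -⟩ | ⟨h₃, -, h₁, -⟩
  · exact hw (by rw [← h₁, ← h₃, e₁, e₃])
  · exact hw (by rw [← h₁, ← h₃, e₁, e₃])

/-- The only missing edge is the free face, which starts in `v`; the detour is the other half of the
boundary of `x`. -/
theorem homMap_bijective_of_square_true {x : P.cube 2} {i : Fin 2} (h : P.IsFreeCube x true i)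
    {a b : P.Vert} (ha : a ≠ P.corner false (P.face true i x))
    (hb : b ≠ P.corner false (P.face true i x)) :
    Function.Bijective (Sub.homMap h.vertex_mem :
      (Sub.ob h.vertex_mem a ⟶ Sub.ob h.vertex_mem b) → _) := by
  have hz : ∀ {z : P.cube 2} {a b c d : P.Vert} {y₁ : a ⟶ b} {y₂ : b ⟶ d} {y₃ : a ⟶ c}
      {y₄ : c ⟶ d}, IsBoundary z y₁ y₂ y₃ y₄ →
      (y₁.1 ∉ (P.removeStar (P.face true i x)).carrier 1 ∨
        y₂.1 ∉ (P.removeStar (P.face true i x)).carrier 1) → z = x := by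
    intro z a b c d y₁ y₂ y₃ y₄ hb hy
    by_contra hzx
    have := hb.mem (Q := P.removeStar (P.face true i x))
      (by by_contra hz; exact hzx (h.eq_self_of_notMem hz))
    tauto
  have hreg : ∀ {l : Bool} {m : Fin 2}, P.face l m x = P.face true i x → l = true ∧ m = i := by
    intro l m e
    by_contra hlm
    exact h.regular.face_ne (l := l) (m := m) (by simpa using hlm) e
  refine Sub.homMap_bijective_of_unique_ingoing h.vertex_mem
    (P.arrow (P.edge true i x) (P.edge_spec true i x).1 (P.edge_spec true i x).2)
    (fun y => h.edge_unique y.1 y.2.2) h.edge_mem ?_ (fun _ _ _ _ _ _ _ _ _ => h.target_ne) ?_ ?_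
    ?_ ha hb
  · intro a b y hy
    rw [← y.2.1, h.eq_face_of_notMem hy]
    rfl
  -- A square with the missing edge in its boundary is `x`, and by regularity the free back face of
  -- `x` is not one of its front faces, with which the two boundary paths begin.
  · intro z a b c d y₁ y₂ y₃ y₄ hbd
    by_contra hy
    obtain rfl := hz hbd (.inl hy)
    obtain ⟨p, q, -, h₁, -⟩ := isBoundary_iff.1 hbd
    exact absurd (hreg (h₁.symm.trans (h.eq_face_of_notMem hy))).1 (by simp)
  · intro c a b e' y hav hy
    have hyf := h.eq_face_of_notMem hy
    obtain ⟨p, hp⟩ : ∃ p : Fin 2, p ≠ i := exists_ne i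
    -- The front face of `x` in the direction `p` ends in `v`, so by uniqueness it is the edge
    -- preceding the removed one.
    have he' : e'.1 = P.face false p x := by
      rw [h.edge_unique _ (e'.2.2.trans hav)]
      exact (h.edge_unique _ (face_face_of_ne x false true hp)).symm
    let t : P.Vert := P.face true 0 (P.face false i x)
    have hc : P.face false 0 (P.face false i x) = c := by
      rw [← e'.2.1, he']
      exact (face_face_of_ne x false false hp).symm
    have hd : P.face true 0 (P.face true p x) = b := by
      rw [← y.2.2, hyf]
      exact face_face_of_ne x true true hp
    let y₃ : c ⟶ t := P.arrow (P.face false i x) hc rfl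
    let y₄ : t ⟶ b := P.arrow (P.face true p x) (face_face_of_ne x true false hp) hd
    have hb : IsBoundary x e' y y₃ y₄ := isBoundary_iff.2 ⟨p, i, hp, he', hyf, rfl, rfl⟩
    have h₃ : y₃.1 ∈ (P.removeStar (P.face true i x)).carrier 1 := h.face_mem (by simp)
    have h₄ : y₄.1 ∈ (P.removeStar (P.face true i x)).carrier 1 := h.face_mem (by simp [hp])
    refine ⟨Sub.edgeHom h.vertex_mem y₃ h₃ ≫ Sub.edgeHom h.vertex_mem y₄ h₄, ?_, ?_⟩
    · rw [Sub.homMap_comp, Sub.homMap_edgeHom, Sub.homMap_edgeHom, edgeHom_square hb]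
    · intro z d y₃' y₄' hb'
      obtain rfl := hz hb' (.inr hy)
      obtain ⟨p', q', hpq, -, h₂', h₃', h₄'⟩ := isBoundary_iff.1 hb'
      obtain rfl := (hreg (h₂'.symm.trans hyf)).2
      obtain rfl : p = p' := by omega
      obtain ⟨-, rfl⟩ := vert_eq_of_val_eq (y := y₃) (y' := y₃') h₃'.symm
      obtain rfl : y₃ = y₃' := Subtype.ext h₃'.symm
      obtain rfl : y₄ = y₄' := Subtype.ext h₄'.symm
      exact ⟨h₃, h₄, rfl⟩
  -- Vacuous: the only square outside `Q` is `x`, and its boundary contains the missing edge.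
  · intro z hzQ a b c d y₁ y₂ y₃ y₄ hbd _ h₂ _ h₄
    exfalso
    obtain rfl := h.eq_self_of_notMem hzQ
    obtain ⟨p, q, hpq, -, e₂, -, e₄⟩ := isBoundary_iff.1 hbd
    obtain rfl | rfl : i = q ∨ i = p := by omega
    · exact (h.mem_removeStar.1 h₂).2 (by rw [e₂])
    · exact (h.mem_removeStar.1 h₄).2 (by rw [e₄])

theorem homMap_bijective_of_square_false {x : P.cube 2} {i : Fin 2} (h : P.IsFreeCube x false i)
    {a b : P.Vert} (ha : a ≠ P.corner true (P.face false i x))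
    (hb : b ≠ P.corner true (P.face false i x)) :
    Function.Bijective (Sub.homMap h.vertex_mem :
      (Sub.ob h.vertex_mem a ⟶ Sub.ob h.vertex_mem b) → _) := by
  have hz : ∀ {z : P.cube 2} {a b c d : P.Vert} {y₁ : a ⟶ b} {y₂ : b ⟶ d} {y₃ : a ⟶ c}
      {y₄ : c ⟶ d}, IsBoundary z y₁ y₂ y₃ y₄ →
      (y₁.1 ∉ (P.removeStar (P.face false i x)).carrier 1 ∨
        y₂.1 ∉ (P.removeStar (P.face false i x)).carrier 1) → z = x := by
    intro z a b c d y₁ y₂ y₃ y₄ hb hy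
    by_contra hzx
    have := hb.mem (Q := P.removeStar (P.face false i x))
      (by by_contra hz; exact hzx (h.eq_self_of_notMem hz))
    tauto
  have hreg : ∀ {l : Bool} {m : Fin 2}, P.face l m x = P.face false i x → l = false ∧ m = i := by
    intro l m e
    by_contra hlm
    exact h.regular.face_ne (l := l) (m := m) (by simpa using hlm) e
  refine Sub.homMap_bijective_of_unique_outgoing h.vertex_mem
    (P.arrow (P.edge false i x) (P.edge_spec false i x).2 (P.edge_spec false i x).1)
    (fun y => h.edge_unique y.1 y.2.1) h.edge_mem ?_ (fun _ _ _ _ _ _ _ _ _ => h.source_ne) ?_ ?_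
    ?_ ha hb
  · intro a b y hy
    rw [← y.2.2, h.eq_face_of_notMem hy]
    rfl
  · intro z a b c d y₁ y₂ y₃ y₄ hbd
    by_contra hy
    obtain rfl := hz hbd (.inr hy)
    obtain ⟨p, q, -, -, h₂, -⟩ := isBoundary_iff.1 hbd
    exact absurd (hreg (h₂.symm.trans (h.eq_face_of_notMem hy))).1 (by simp)
  · intro a b c y e' hav hy
    have hyf := h.eq_face_of_notMem hy
    obtain ⟨q, hq⟩ : ∃ q : Fin 2, q ≠ i := exists_ne i
    have he' : e'.1 = P.face true q x := by
      rw [h.edge_unique _ (e'.2.1.trans hav)]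
      exact (h.edge_unique _ (face_face_of_ne x true false hq)).symm
    let t : P.Vert := P.face false 0 (P.face true i x)
    have ha : P.face false 0 (P.face false q x) = a := by
      rw [← y.2.1, hyf]
      exact face_face_of_ne x false false hq
    have hc : P.face true 0 (P.face true i x) = c := by
      rw [← e'.2.2, he']
      exact (face_face_of_ne x true true hq).symm
    let y₃ : a ⟶ t := P.arrow (P.face false q x) ha (face_face_of_ne x false true hq)
    let y₄ : t ⟶ c := P.arrow (P.face true i x) rfl hc
    have hb : IsBoundary x y e' y₃ y₄ := isBoundary_iff.2 ⟨i, q, hq.symm, hyf, he', rfl, rfl⟩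
    have h₃ : y₃.1 ∈ (P.removeStar (P.face false i x)).carrier 1 := h.face_mem (by simp [hq])
    have h₄ : y₄.1 ∈ (P.removeStar (P.face false i x)).carrier 1 := h.face_mem (by simp)
    refine ⟨Sub.edgeHom h.vertex_mem y₃ h₃ ≫ Sub.edgeHom h.vertex_mem y₄ h₄, ?_, ?_⟩
    · rw [Sub.homMap_comp, Sub.homMap_edgeHom, Sub.homMap_edgeHom, edgeHom_square hb]
    · intro z d y₃' y₄' hb'
      obtain rfl := hz hb' (.inl hy)
      obtain ⟨p', q', hpq, h₁', -, h₃', h₄'⟩ := isBoundary_iff.1 hb'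
      obtain rfl := (hreg (h₁'.symm.trans hyf)).2
      obtain rfl : q = q' := by omega
      obtain ⟨-, rfl⟩ := vert_eq_of_val_eq (y := y₃) (y' := y₃') h₃'.symm
      obtain rfl : y₃ = y₃' := Subtype.ext h₃'.symm
      obtain rfl : y₄ = y₄' := Subtype.ext h₄'.symm
      exact ⟨h₃, h₄, rfl⟩
  · intro z hzQ a b c d y₁ y₂ y₃ y₄ hbd h₁ _ h₃ _
    exfalso
    obtain rfl := h.eq_self_of_notMem hzQ
    obtain ⟨p, q, hpq, e₁, -, e₃, -⟩ := isBoundary_iff.1 hbd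
    obtain rfl | rfl : i = p ∨ i = q := by omega
    · exact (h.mem_removeStar.1 h₁).2 (by rw [e₁])
    · exact (h.mem_removeStar.1 h₃).2 (by rw [e₃])

/-- No edge is missing, and the only missing square is the free face, which starts in `v`. Its
relation holds in `Q` after precomposition with the unique edge into `v`, by the hexagon. -/
theorem homMap_bijective_of_cube_true {x : P.cube 3} {i : Fin 3} (h : P.IsFreeCube x true i)
    {a b : P.Vert} (ha : a ≠ P.corner false (P.face true i x))
    (hb : b ≠ P.corner false (P.face true i x)) :
    Function.Bijective (Sub.homMap h.vertex_mem :
      (Sub.ob h.vertex_mem a ⟶ Sub.ob h.vertex_mem b) → _) := by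
  have hm : ∀ y : P.cube 1, y ∈ (P.removeStar (P.face true i x)).carrier 1 :=
    h.mem_of_lt one_lt_two
  refine Sub.homMap_bijective_of_unique_ingoing h.vertex_mem
    (P.arrow (P.edge true i x) (P.edge_spec true i x).1 (P.edge_spec true i x).2)
    (fun y => h.edge_unique y.1 y.2.2) h.edge_mem (fun _ hy => absurd (hm _) hy)
    (fun _ _ _ _ _ _ _ _ _ => h.target_ne) (fun _ _ _ _ _ _ _ _ _ _ => hm _)
    (fun _ _ _ hy => absurd (hm _) hy) ?_ ha hb
  intro z hz a b c d y₁ y₂ y₃ y₄ hbd _ _ _ _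
  obtain rfl := h.eq_face_of_notMem hz
  refine ⟨hbd.source_eq, ?_⟩
  obtain ⟨s', a', b', c', d', e, y₁', y₂', y₃', y₄', hb', hex⟩ :=
    h.exists_canonical_hexagon_precomp
  intro s e' _
  refine IsBoundary.transport (fun {a b c d} y₁ y₂ y₃ y₄ => ∀ {s : P.Vert} (e' : s ⟶ a),
    Sub.edgeHom h.vertex_mem e' (hm _) ≫ Sub.edgeHom h.vertex_mem y₁ (hm _) ≫
      Sub.edgeHom h.vertex_mem y₂ (hm _) = Sub.edgeHom h.vertex_mem e' (hm _) ≫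
        Sub.edgeHom h.vertex_mem y₃ (hm _) ≫ Sub.edgeHom h.vertex_mem y₄ (hm _))
    (fun H _ e' => (H e').symm) hb' hbd ?_ e'
  intro s e'
  have ha := hb'.source_eq
  have ee : e'.1 = e.1 := (h.edge_unique _ (e'.2.2.trans ha)).trans
    (h.edge_unique _ (e.2.2.trans ha)).symm
  obtain ⟨rfl, -⟩ := vert_eq_of_val_eq ee
  obtain rfl : e' = e := Subtype.ext ee
  exact hex _ _ _ _ _

theorem homMap_bijective_of_cube_false {x : P.cube 3} {i : Fin 3} (h : P.IsFreeCube x false i)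
    {a b : P.Vert} (ha : a ≠ P.corner true (P.face false i x))
    (hb : b ≠ P.corner true (P.face false i x)) :
    Function.Bijective (Sub.homMap h.vertex_mem :
      (Sub.ob h.vertex_mem a ⟶ Sub.ob h.vertex_mem b) → _) := by
  have hm : ∀ y : P.cube 1, y ∈ (P.removeStar (P.face false i x)).carrier 1 :=
    h.mem_of_lt one_lt_two
  refine Sub.homMap_bijective_of_unique_outgoing h.vertex_mem
    (P.arrow (P.edge false i x) (P.edge_spec false i x).2 (P.edge_spec false i x).1)
    (fun y => h.edge_unique y.1 y.2.1) h.edge_mem (fun _ hy => absurd (hm _) hy)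
    (fun _ _ _ _ _ _ _ _ _ => h.source_ne) (fun _ _ _ _ _ _ _ _ _ _ => hm _)
    (fun _ _ _ hy => absurd (hm _) hy) ?_ ha hb
  intro z hz a b c d y₁ y₂ y₃ y₄ hbd _ _ _ _
  obtain rfl := h.eq_face_of_notMem hz
  refine ⟨hbd.target_eq, ?_⟩
  obtain ⟨s', a', b', c', d', e, y₁', y₂', y₃', y₄', hb', hex⟩ :=
    h.exists_canonical_hexagon_postcomp
  intro s e' _
  refine IsBoundary.transport (fun {a b c d} y₁ y₂ y₃ y₄ => ∀ {s : P.Vert} (e' : d ⟶ s),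
    (Sub.edgeHom h.vertex_mem y₁ (hm _) ≫ Sub.edgeHom h.vertex_mem y₂ (hm _)) ≫
      Sub.edgeHom h.vertex_mem e' (hm _) = (Sub.edgeHom h.vertex_mem y₃ (hm _) ≫
        Sub.edgeHom h.vertex_mem y₄ (hm _)) ≫ Sub.edgeHom h.vertex_mem e' (hm _))
    (fun H _ e' => (H e').symm) hb' hbd ?_ e'
  intro s e'
  have ha := hb'.target_eq
  have ee : e'.1 = e.1 := (h.edge_unique _ (e'.2.1.trans ha)).trans
    (h.edge_unique _ (e.2.1.trans ha)).symm
  obtain ⟨-, rfl⟩ := vert_eq_of_val_eq ee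
  obtain rfl : e' = e := Subtype.ext ee
  exact hex _ _ _ _ _

/-- The vertex `v` has to be excluded only while an edge or a square is removed, that is, for `x` of
degree 2 or 3. From degree 4 on, both removed cubes have degree at least 3 and leave the fundamental
category unchanged. -/
theorem homMap_bijective {x : P.cube (n + 1)} {i : Fin (n + 1)} (h : P.IsFreeCube x k i)
    {a b : P.Vert} (ha : n ≤ 2 → a ≠ P.corner (!k) (P.face k i x))
    (hb : n ≤ 2 → b ≠ P.corner (!k) (P.face k i x)) :
    Function.Bijective (Sub.homMap h.vertex_mem :
      (Sub.ob h.vertex_mem a ⟶ Sub.ob h.vertex_mem b) → _) := by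
  have hpos := h.pos
  match n, k, x, i, h, ha, hb, hpos with
  | 1, true, _, _, h, ha, hb, _ =>
    exact h.homMap_bijective_of_square_true (ha (by norm_num)) (hb (by norm_num))
  | 1, false, _, _, h, ha, hb, _ =>
    exact h.homMap_bijective_of_square_false (ha (by norm_num)) (hb (by norm_num))
  | 2, true, _, _, h, ha, hb, _ =>
    exact h.homMap_bijective_of_cube_true (ha le_rfl) (hb le_rfl)
  | 2, false, _, _, h, ha, hb, _ =>
    exact h.homMap_bijective_of_cube_false (ha le_rfl) (hb le_rfl)
  | n + 3, _, _, _, h, _, _, _ =>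
    exact Sub.homMap_bijective_of_mem _ (fun y => h.mem_of_lt (by omega) y)
      (fun z => h.mem_of_lt (by omega) z) _ _

end IsFreeCube

end PrecubicalSet

namespace PrecubicalSet

/-! ### The functor induced by a morphism of precubical sets -/

/-- The dihomotopy class of an initial segment of a path. -/
def PathOfLength.segmentHom {P : PrecubicalSet.{u}} {k : ℕ} (ω : P.PathOfLength k) (j : ℕ)
    (hj : j ≤ k) :
    vertexOb (P := P) (ω.vertex 0 (Nat.zero_le k)) ⟶ vertexOb (P := P) (ω.vertex j hj) :=
  (CategoryTheory.Quotient.functor P.Square).map (X := (ω.vertex 0 (Nat.zero_le k) : P.Vert))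
    (Y := (ω.vertex j hj : P.Vert)) (ω.initialSegment j hj)

/-- An edge of a path, as an arrow. -/
def PathOfLength.edgeArrow {P : PrecubicalSet.{u}} {k : ℕ} (ω : P.PathOfLength k) (j : ℕ)
    (hj : j < k) : (show P.Vert from ω.vertex j hj.le) ⟶ (show P.Vert from ω.vertex (j + 1) hj) :=
  P.arrow (ω.edge j hj) (ω.face_edge_false j hj) (ω.face_edge_true j hj)

theorem PathOfLength.segmentHom_succ {P : PrecubicalSet.{u}} {k : ℕ} (ω : P.PathOfLength k) (j : ℕ)
    (hj : j < k) :
    ω.segmentHom (j + 1) hj = ω.segmentHom j hj.le ≫ edgeHom (ω.edgeArrow j hj) :=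
  (CategoryTheory.Quotient.functor P.Square).map_comp
    (X := (show Paths P.Vert from ω.vertex 0 (Nat.zero_le k)))
    (Y := (show Paths P.Vert from ω.vertex j hj.le))
    (Z := (show Paths P.Vert from ω.vertex (j + 1) hj)) (ω.initialSegment j hj.le)
    (ω.edgeArrow j hj).toPath

theorem Hom.fundamentalFunctor_map_segmentHom {Q : PrecubicalSet.{u}} {P : PrecubicalSet.{v}}
    (g : Hom Q P) {k : ℕ} (ω : Q.PathOfLength k) : ∀ (j : ℕ) (hj : j ≤ k),
    g.fundamentalFunctor.map (ω.segmentHom j hj) = PathOfLength.segmentHom (g.comp ω) j hj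
  | 0, _ => g.fundamentalFunctor.map_id _
  | j + 1, hj => by
    have ih := g.fundamentalFunctor_map_segmentHom ω j (Nat.le_of_succ_le hj)
    rw [ω.segmentHom_succ j hj, PathOfLength.segmentHom_succ (g.comp ω) j hj, ← ih]
    exact (g.fundamentalFunctor.map_comp (ω.segmentHom j (Nat.le_of_succ_le hj))
      (edgeHom (ω.edgeArrow j hj))).trans (congrArg (g.fundamentalFunctor.map _ ≫ ·)
        (Paths.lift_toPath (V := Q.Vert) _ _))

theorem Hom.isInducedFunctor {Q : PrecubicalSet.{u}} {P : PrecubicalSet.{v}} (g : Hom Q P) :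
    g.toWeakMorphism.IsInducedFunctor g.fundamentalFunctor := by
  refine ⟨fun x => ?_, fun k l ω ν h => ?_⟩
  · rw [g.toWeakMorphism_onVertex]
    rfl
  · cases Hom.eq_comp_of_isPathImage h
    exact congrArg Arrow.mk (g.fundamentalFunctor_map_segmentHom ω k le_rfl)

/-- An isomorphism of categories is required, not an equivalence. Bijectivity on objects gives a
section with only propositional equalities, which are absorbed by `eqToHom`. -/
theorem exists_strict_inverse {C : Type u} [Category.{v} C] {D : Type w} [Category.{w'} D]
    (F : C ⥤ D) (hobj : Function.Bijective F.obj)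
    (hmap : ∀ X Y : C, Function.Bijective (F.map : (X ⟶ Y) → _)) :
    ∃ G : D ⥤ C, F ⋙ G = 𝟭 C ∧ G ⋙ F = 𝟭 D := by
  choose o ho using hobj.2
  choose m hm using fun X Y => (hmap X Y).2
  have hcongr : ∀ {X Y : D} (f : X ⟶ Y), F.map (m _ _ (eqToHom (ho X) ≫ f ≫ eqToHom (ho Y).symm)) =
      eqToHom (ho X) ≫ f ≫ eqToHom (ho Y).symm := fun f => hm _ _ _
  let G : D ⥤ C :=
    { obj := o
      map := fun {X Y} f => m _ _ (eqToHom (ho X) ≫ f ≫ eqToHom (ho Y).symm)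
      map_id := fun X => (hmap _ _).1 (by rw [hcongr]; simp)
      map_comp := fun f g => (hmap _ _).1 (by rw [F.map_comp, hcongr, hcongr, hcongr]; simp) }
  refine ⟨G, CategoryTheory.Functor.ext (fun X => hobj.1 (ho _)) fun X Y f => (hmap _ _).1 ?_,
    CategoryTheory.Functor.ext (fun X => ho X) fun X Y f => hcongr f⟩
  refine (hcongr (F.map f)).trans ?_
  rw [F.map_comp, F.map_comp, eqToHom_map, eqToHom_map]
  rfl

end PrecubicalSet

/-! ### Restriction of an automaton to a precubical subset with all vertices, and its trace
category. -/

namespace HDA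

variable {M : Type w} [Monoid M] {A : HDA.{u} M} {Q : A.P.Sub}

theorem restrict_isWeakMorphism (A : HDA.{u} M) (Q : A.P.Sub) :
    IsWeakMorphism (A.restrict Q) A Q.incl.toWeakMorphism := by
  refine ⟨fun a ha => ?_, fun a ha => ?_, fun k l ω ν h => ?_⟩
  · exact (Hom.toWeakMorphism_onVertex Q.incl a).symm ▸ ha
  · exact (Hom.toWeakMorphism_onVertex Q.incl a).symm ▸ ha
  · cases Hom.eq_comp_of_isPathImage h
    rfl

theorem image_onVertex (Q : A.P.Sub) {S : Set (Q.toPrecubicalSet.cube 0)} {T : Set (A.P.cube 0)}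
    (hQ : ∀ a, a ∈ Q.carrier 0) (h : ∀ a, a ∈ S ↔ a.1 ∈ T) :
    Q.incl.toWeakMorphism.onVertex '' S = T := by
  ext a
  constructor
  · rintro ⟨b, hb, rfl⟩
    rw [Hom.toWeakMorphism_onVertex]
    exact (h b).1 hb
  · intro ha
    exact ⟨⟨a, hQ a⟩, (h _).2 ha, Hom.toWeakMorphism_onVertex _ _⟩

theorem traceObjects_of {a : A.P.cube 0} : A.traceObjects (FundamentalCategory.of A.P a) ↔
    a ∈ A.init ∪ A.final ∪ A.P.extremal false ∪ A.P.extremal true := by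
  constructor
  · rintro ⟨b, hb, e⟩
    have e' : a = b := congrArg (fun X : A.P.FundamentalCategory => (X.as : A.P.Vert)) e
    exact e' ▸ hb
  · exact fun h => ⟨a, h, rfl⟩

theorem restrict_isTraceCategoryIso (A : HDA.{u} M) (Q : A.P.Sub) (hQ : ∀ a, a ∈ Q.carrier 0)
    (hext : ∀ (b : Bool) (a : Q.toPrecubicalSet.cube 0),
      a ∈ Q.toPrecubicalSet.extremal b ↔ a.1 ∈ A.P.extremal b)
    (hmap : ∀ a b : A.P.Vert, A.traceObjects (vertexOb a) → A.traceObjects (vertexOb b) →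
      Function.Bijective (Sub.homMap hQ : (Sub.ob hQ a ⟶ Sub.ob hQ b) → _)) :
    IsTraceCategoryIso (B := A.restrict Q) (A := A) Q.incl.toWeakMorphism := by
  have hiff : ∀ a : Q.toPrecubicalSet.cube 0,
      (A.restrict Q).traceObjects (FundamentalCategory.of (A.restrict Q).P a) ↔
        A.traceObjects (FundamentalCategory.of A.P a.1) := by
    intro a
    refine (traceObjects_of (A := A.restrict Q)).trans (Iff.trans ?_ traceObjects_of.symm)
    exact or_congr (or_congr Iff.rfl (hext _ a)) (hext _ a)
  let F : (A.restrict Q).P.FundamentalCategory ⥤ A.P.FundamentalCategory :=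
    Q.incl.fundamentalFunctor
  have hF : ∀ X, (A.restrict Q).traceObjects X → A.traceObjects (F.obj X) := by
    rintro ⟨a⟩ ha
    exact (hiff a).1 ha
  let Φ : (A.restrict Q).TraceCategory ⥤ A.TraceCategory :=
    A.traceObjects.lift ((A.restrict Q).traceObjects.ι ⋙ F) fun X => hF _ X.2
  refine ⟨F, Q.incl.isInducedFunctor, Φ, rfl, exists_strict_inverse Φ ⟨?_, ?_⟩ ?_⟩
  · rintro ⟨⟨a⟩, ha⟩ ⟨⟨b⟩, hb⟩ e
    obtain rfl : a = b := Subtype.ext (congrArg (fun X => X.obj.as) e)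
    rfl
  · rintro ⟨⟨a⟩, ha⟩
    exact ⟨⟨⟨⟨a, hQ a⟩⟩, (hiff ⟨a, hQ a⟩).2 ha⟩, rfl⟩
  · rintro ⟨⟨a⟩, ha⟩ ⟨⟨b⟩, hb⟩
    have hab := hmap a.1 b.1 ((hiff a).1 ha) ((hiff b).1 hb)
    refine ⟨fun p q e => ?_, fun p => ?_⟩
    · exact ObjectProperty.hom_ext _ (hab.1 (congrArg (fun f : Φ.obj ⟨⟨a⟩, ha⟩ ⟶ Φ.obj ⟨⟨b⟩, hb⟩ => f.hom) e))
    · obtain ⟨q, hq⟩ := hab.2 p.hom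
      exact ⟨ObjectProperty.homMk q, ObjectProperty.hom_ext _ hq⟩

end HDA

/-! ### Extremal vertices and reachability of sets of states. -/

namespace PrecubicalSet.IsFreeCube

variable {P : PrecubicalSet.{u}} {n : ℕ} {x : P.cube (n + 1)} {k : Bool} {i : Fin (n + 1)}

/-- Only the free edge of a square needs a substitute. Its end of type `k` is shared by the other
face of type `k`; at the opposite end `v`, the additional edge assumed in degree 2 serves. -/
theorem exists_edge (h : P.IsFreeCube x k i)
    (halt : n = 1 → ∃ y : P.cube 1, (⟨1, y⟩ : P.Cubes) ≠ ⟨n, P.face k i x⟩ ∧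
      P.face (!k) 0 y = P.corner (!k) (P.face k i x)) (b : Bool) (y : P.cube 1) :
    ∃ y' ∈ (P.removeStar (P.face k i x)).carrier 1, P.face b 0 y' = P.face b 0 y := by
  by_cases hy : y ∈ (P.removeStar (P.face k i x)).carrier 1
  · exact ⟨y, hy, rfl⟩
  have hpos := h.pos
  rcases h.ne_of_notMem hy with e | e
  · exact absurd (Sigma.mk.inj e).1 (by omega)
  obtain ⟨rfl, e⟩ := Sigma.mk.inj e
  obtain rfl := eq_of_heq e
  obtain rfl | rfl : b = k ∨ b = !k := by cases b <;> cases k <;> simp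
  · obtain ⟨j, hj⟩ : ∃ j : Fin 2, j ≠ i := exists_ne i
    refine ⟨P.face b j x, h.face_mem (by simp [hj]), ?_⟩
    exact (P.corner_face b j x).trans (P.corner_face b i x).symm
  · obtain ⟨y', hy', e⟩ := halt rfl
    exact ⟨y', h.mem_removeStar.2 ⟨fun e => absurd (Sigma.mk.inj e).1 (by omega), hy'⟩, e⟩

theorem mem_extremal_iff (h : P.IsFreeCube x k i)
    (halt : n = 1 → ∃ y : P.cube 1, (⟨1, y⟩ : P.Cubes) ≠ ⟨n, P.face k i x⟩ ∧
      P.face (!k) 0 y = P.corner (!k) (P.face k i x)) (b : Bool)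
    (a : (P.removeStar (P.face k i x)).toPrecubicalSet.cube 0) :
    a ∈ (P.removeStar (P.face k i x)).toPrecubicalSet.extremal b ↔ a.1 ∈ P.extremal b := by
  refine not_congr ⟨?_, ?_⟩
  · rintro ⟨y, rfl⟩
    exact ⟨y.1, rfl⟩
  · rintro ⟨y, hy⟩
    obtain ⟨y', hy', e⟩ := h.exists_edge halt b y
    exact ⟨⟨y', hy'⟩, Subtype.ext (e.trans hy)⟩

/-- On one side there is the edge `e^k_i x`, on the other an edge of the free face, which has
positive degree. -/
theorem corner_notMem_extremal (h : P.IsFreeCube x k i) (b : Bool) :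
    P.corner (!k) (P.face k i x) ∉ P.extremal b := by
  refine not_not.2 ?_
  obtain rfl | rfl : b = k ∨ b = !k := by cases b <;> cases k <;> simp
  · exact ⟨P.edge b i x, (P.edge_spec b i x).2⟩
  · obtain ⟨m, rfl⟩ : ∃ m, n = m + 1 := ⟨n - 1, by have := h.pos; omega⟩
    refine ⟨P.edge k 0 (P.face k i x), (P.edge_spec k 0 _).1⟩

theorem sub_reachesTo_of_lt (h : P.IsFreeCube x k i) (hn : 1 < n) {a b : P.cube 0}
    (hr : P.ReachesTo k a b) : (P.removeStar (P.face k i x)).ReachesTo k a b :=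
  Relation.ReflTransGen.mono (fun _ _ ⟨y, hy⟩ => ⟨y, h.mem_of_lt hn y, hy⟩) _ _ hr

/-- Chains starting in `S` can be moved into `Q` because they do not start in `v`; when the free
face has degree at least 2, no edge is removed and nothing has to be moved. -/
theorem forall_exists_reachesTo_from_iff (h : P.IsFreeCube x k i) {S : Set (P.cube 0)}
    (hS : n ≤ 2 → P.corner (!k) (P.face k i x) ∉ S) :
    (∀ b, ∃ a ∈ S, P.ReachesTo k a b) ↔
      ∀ b, ∃ a ∈ S, (P.removeStar (P.face k i x)).ReachesTo k a b := by
  refine ⟨fun H b => ?_, fun H b => (H b).imp fun a ha => ⟨ha.1, ha.2.of_sub⟩⟩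
  obtain ⟨a, ha, hr⟩ := H b
  refine ⟨a, ha, ?_⟩
  rcases lt_or_ge 1 n with hn | hn
  · exact h.sub_reachesTo_of_lt hn hr
  · exact h.sub_reachesTo (fun e => hS (by omega) (e ▸ ha)) hr

/-- Here a chain may have to start in `v`. In degree 2 it is made to begin with the additional edge
of `Q` at `v`, whose end is not `v`, and it continues from there with a chain that can be moved into
`Q`. -/
theorem forall_exists_reachesTo_to_iff (h : P.IsFreeCube x k i)
    (halt : n = 1 → ∃ y : P.cube 1, (⟨1, y⟩ : P.Cubes) ≠ ⟨n, P.face k i x⟩ ∧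
      P.face (!k) 0 y = P.corner (!k) (P.face k i x)) {S : Set (P.cube 0)} :
    (∀ a, ∃ b ∈ S, P.ReachesTo k a b) ↔
      ∀ a, ∃ b ∈ S, (P.removeStar (P.face k i x)).ReachesTo k a b := by
  refine ⟨fun H a => ?_, fun H a => (H a).imp fun b hb => ⟨hb.1, hb.2.of_sub⟩⟩
  by_cases ha : a = P.corner (!k) (P.face k i x)
  · rcases lt_or_ge 1 n with hn | hn
    · exact (H a).imp fun b hb => ⟨hb.1, h.sub_reachesTo_of_lt hn hb.2⟩
    · have hpos := h.pos
      obtain ⟨y, hy, e⟩ := halt (by omega)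
      obtain ⟨b, hb, hr⟩ := H (P.face k 0 y)
      refine ⟨b, hb, (h.sub_reachesTo (h.face_ne_corner e) hr).head ⟨y, ?_, e.trans ha.symm, rfl⟩⟩
      exact h.mem_removeStar.2 ⟨fun e => absurd (Sigma.mk.inj e).1 (by omega), hy⟩
  · exact (H a).imp fun b hb => ⟨hb.1, h.sub_reachesTo ha hb.2⟩

end PrecubicalSet.IsFreeCube

theorem PrecubicalSet.Sub.reachesTo_false_iff {P : PrecubicalSet.{u}} {Q : P.Sub} {a b : P.cube 0} :
    Q.ReachesTo false a b ↔ Q.ReachesTo true b a := by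
  unfold Sub.ReachesTo
  rw [← Relation.reflTransGen_swap]
  have : Q.StepTo true = Function.swap (Q.StepTo false) := by
    funext a b
    simp [Sub.StepTo, Function.swap, and_comm]
  rw [this]

namespace HDA

variable {M : Type w} [Monoid M] {A : HDA.{u} M} {Q : A.P.Sub}

theorem isAccessible_iff : A.IsAccessible ↔ ∀ b, ∃ a ∈ A.init, A.P.ReachesTo true a b := by
  simp only [IsAccessible, reaches_iff]

theorem isCoaccessible_iff : A.IsCoaccessible ↔ ∀ a, ∃ b ∈ A.final, A.P.ReachesTo true a b := by
  simp only [IsCoaccessible, reaches_iff]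

theorem restrict_isAccessible_iff (hQ : ∀ a, a ∈ Q.carrier 0) :
    (A.restrict Q).IsAccessible ↔ ∀ b, ∃ a ∈ A.init, Q.ReachesTo true a b := by
  rw [isAccessible_iff]
  constructor
  · intro H b
    obtain ⟨a, ha, hr⟩ := H ⟨b, hQ b⟩
    exact ⟨a.1, ha, Sub.reachesTo_iff.1 hr⟩
  · intro H b
    obtain ⟨a, ha, hr⟩ := H b.1
    exact ⟨⟨a, hQ a⟩, ha, Sub.reachesTo_iff.2 hr⟩

theorem restrict_isCoaccessible_iff (hQ : ∀ a, a ∈ Q.carrier 0) :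
    (A.restrict Q).IsCoaccessible ↔ ∀ a, ∃ b ∈ A.final, Q.ReachesTo true a b := by
  rw [isCoaccessible_iff]
  constructor
  · intro H a
    obtain ⟨b, hb, hr⟩ := H ⟨a, hQ a⟩
    exact ⟨b.1, hb, Sub.reachesTo_iff.1 hr⟩
  · intro H a
    obtain ⟨b, hb, hr⟩ := H a.1
    exact ⟨⟨b, hQ b⟩, hb, Sub.reachesTo_iff.2 hr⟩

end HDA

theorem theorem5p3 {M : Type w} [Monoid M] (R : Type w') [CommRing R]
    (A : HDA.{u} M) (hA : A.P.IsWeaklyRegular)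
    {n : ℕ} (hn : 2 ≤ n + 1) (x : A.P.cube (n + 1)) (hx : A.P.IsRegular x)
    (k : Bool) (i : Fin (n + 1)) (hfree : A.P.IsFreeFace x k i)
    (hedge : ¬ ∃ y : A.P.cube 1, y ≠ A.P.edge k i x ∧
      A.P.face k 0 y = A.P.corner (!k) (A.P.face k i x))
    (hvertex : n + 1 ≤ 3 → A.P.corner (!k) (A.P.face k i x) ∉ A.init ∪ A.final)
    (halt : n + 1 = 2 → ∃ y : A.P.cube 1,
      (⟨1, y⟩ : A.P.Cubes) ≠ ⟨n, A.P.face k i x⟩ ∧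
      A.P.face (!k) 0 y = A.P.corner (!k) (A.P.face k i x)) :
    HDA.IsTopologicalAbstraction R (A.restrict (A.P.removeStar (A.P.face k i x))) A ∧
    (A.IsAccessible ↔ (A.restrict (A.P.removeStar (A.P.face k i x))).IsAccessible) ∧
    (A.IsCoaccessible ↔ (A.restrict (A.P.removeStar (A.P.face k i x))).IsCoaccessible) := by
  have h : A.P.IsFreeCube x k i :=
    { pos := by omega
      weaklyRegular := hA
      regular := hx
      free := hfree
      edge_unique := fun y hy => by_contra fun hne => hedge ⟨y, hne, hy⟩ }
  have hv : n ≤ 2 → A.P.corner (!k) (A.P.face k i x) ∉ A.init ∪ A.final :=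
    fun hn => hvertex (by omega)
  have halt' : n = 1 → ∃ y : A.P.cube 1, (⟨1, y⟩ : A.P.Cubes) ≠ ⟨n, A.P.face k i x⟩ ∧
      A.P.face (!k) 0 y = A.P.corner (!k) (A.P.face k i x) := fun hn => halt (by omega)
  have hext := h.mem_extremal_iff halt'
  -- In low degree `v` is neither initial, final nor extremal, so the comparison of morphisms covers
  -- all objects of the trace category.
  have htrace : ∀ a : A.P.Vert, A.traceObjects (vertexOb a) → n ≤ 2 →
      a ≠ A.P.corner (!k) (A.P.face k i x) := by
    rintro a ha hn rfl
    rcases HDA.traceObjects_of.1 ha with (ha | ha) | ha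
    · exact hv hn ha
    · exact h.corner_notMem_extremal _ ha
    · exact h.corner_notMem_extremal _ ha
  refine ⟨⟨(A.P.removeStar (A.P.face k i x)).incl.toWeakMorphism, A.restrict_isWeakMorphism _,
    HDA.image_onVertex _ h.vertex_mem fun _ => Iff.rfl,
    HDA.image_onVertex _ h.vertex_mem fun _ => Iff.rfl,
    fun b => HDA.image_onVertex _ h.vertex_mem (hext b), h.isCollapse.exists_homotopyEquiv,
    A.restrict_isTraceCategoryIso _ h.vertex_mem hext fun a b ha hb =>
      h.homMap_bijective (htrace a ha) (htrace b hb), h.isHomologyGraphIso R⟩, ?_, ?_⟩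
  · rw [HDA.isAccessible_iff, HDA.restrict_isAccessible_iff h.vertex_mem]
    -- For `k = 0` chains run backwards, so accessibility becomes the statement about reaching a
    -- set, and coaccessibility the one about starting from a set.
    cases k
    · simpa only [PrecubicalSet.reachesTo_false_iff, Sub.reachesTo_false_iff] using
        h.forall_exists_reachesTo_to_iff halt' (S := A.init)
    · exact h.forall_exists_reachesTo_from_iff fun hn hS => hv hn (.inl hS)
  · rw [HDA.isCoaccessible_iff, HDA.restrict_isCoaccessible_iff h.vertex_mem]
    cases k
    · simpa only [PrecubicalSet.reachesTo_false_iff, Sub.reachesTo_false_iff] using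
        h.forall_exists_reachesTo_from_iff (S := A.final) fun hn hS => hv hn (.inr hS)
    · exact h.forall_exists_reachesTo_to_iff halt'
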